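/- **Setting.** Let $m\in\mathbb N$. For each $\delta>0$ let $E^\delta_k:\mathbb R^m\to\mathbb R$, $d^\delta_{kl}:\mathbb R^m\to\mathbb C^m$ and $D^\delta_{kl}:\mathbb R^m\to\mathbb C$ $(k,l\in\{0,1\})$ be $C^\infty$ functions (the energy surfaces and the first and second order couplings of a two-state matrix Schrödinger equation). Let $K\subset\mathbb R^{2m}$ be compact and fix $t\ge 0$. **Hopping trajectories.** Let $l\in\{0,1\}$ be the initial surface, and for $k\ge 0$ let $l_k\in\{0,1\}$, $l_k\equiv l+k \pmod 2$, be the surface after $k$ hops. Given hopping times $T_{n:1}=(t_n,\dots,t_1)$, $0\le t_1\le\dots\le t_n$, and $z=(q,p)\in\mathbb R^{2m}$, define $(Q^{(n)},P^{(n)},S^{(n)},a^{(n)})(s,T_{n:1},z)$ by the following equations in $s$ (we omit $\delta$ and $l$): $$\dot Q^{(n)}=P^{(n)},\quad \dot P^{(n)}=-\nabla E_{l_n}(Q^{(n)}),\quad \dot S^{(n)}=\tfrac12|P^{(n)}|^2-E_{l_n}(Q^{(n)}),$$ $$\dot a^{(n)}=\tfrac12 a^{(n)}\,\mathrm{tr}\Bigl((Z^{(n)})^{-1}\bigl(\partial_zP^{(n)}-i\,\partial_zQ^{(n)}\nabla^2E_{l_n}(Q^{(n)})\bigr)\Bigr)-a^{(n)}\,d_{l_nl_n}(Q^{(n)})\cdot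 P^{(n)}.$$ Here $\partial_z=\partial_q-i\partial_p$, $(\partial_zQ)_{jk}=\partial_{z_j}Q_k$, $Z^{(n)}=\partial_z(Q^{(n)}+iP^{(n)})$, and $v\cdot p=\sum_j v_jp_j$. For $n=0$ the data at $s=0$ are $Q^{(0)}=q$, $P^{(0)}=p$, $S^{(0)}=0$, $a^{(0)}=2^{m/2}$; for $n\ge1$ the four quantities at $s=t_n$ equal those with index $n-1$ and times $T_{n-1:1}$. The hopping coefficients are $$\tau^{(k)}(T_{k:1},z)=-P^{(k)}(t_k,T_{k:1},z)\cdot d_{l_k\,l_{k-1}}\bigl(Q^{(k)}(t_k,T_{k:1},z)\bigr).$$ **The $n$-hop contribution.** For $\varepsilon>0$ and $u_0\in L^2(\mathbb R^m;\mathbb C)$ put $$u_l^{(n)}(t,x)=\frac1{(2\pi\varepsilon)^{3m/2}}\int_K dz\int_{0\le t_1\le\dots\le t_n\le t}\tau^{(1)}\cdots\tau^{(n)}\,A^{(n)}(t,T_{n:1},z)\,e^{\frac i\varepsilon\Theta^{(n)}(t,T_{n:1},z,x)}\,dT_{n:1},$$ where $$\Theta^{(n)}=S^{(n)}+P^{(n)}\cdot(x-Q^{(n)})+\tfrac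 i2|x-Q^{(n)}|^2,\qquad A^{(n)}=a^{(n)}\int_{\mathbb R^m}u_0(y)\,e^{\frac i\varepsilon(-p\cdot(y-q)+\frac i2|y-q|^2)}\,dy .$$ **Assumptions.** (A) The second derivatives of $E^\delta_k$ are bounded on $\mathbb R^m$, uniformly in $\delta>0$. (B) $E^\delta_k,d^\delta_{kl},D^\delta_{kl}$ and their derivatives of every order are bounded, uniformly in $\delta>0$, on the set of positions visited up to time $t$ by the hopping trajectories (of the same $\delta$) that start in $K$, for all initial surfaces, numbers of hops and hopping times. **Theorem.** Under (A) and (B) there are constants $C,C_t\ge0$, independent of $\varepsilon$, $\delta$, $n$, $l$ and $u_0$, such that for all $\varepsilon>0$, $\delta>0$, $l\in\{0,1\}$, $u_0\in L^2(\mathbb R^m)$ and $n\in\mathbb N$ the integrand of $u_l^{(n)}(t,x)$ is integrable over $K\times\{0\le t_1\le\dots\le t_n\le t\}$ for every $x$, the function $u_l^{(n)}(t,\cdot)$ is differentiable, and $$\|u_l^{(n)}(t)\|_{L^2(\mathbb R^m)}\le C\,\frac{C_t^{\,n}}{n!}\,\|u_0\|_{L^2},\qquad \|\varepsilon\nabla_xu_l^{(n)}(t)\|_{L^2(\mathbb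 R^m)}\le C\,\frac{C_t^{\,n}}{n!}\,\|u_0\|_{L^2}.$$ In particular, for all initial data in $L^2(\mathbb R^m)$ on the two surfaces, with contributions $u_0^{(n)},u_1^{(n)}$, the surface hopping series $\sum_n U^{(n)}(t)$, where $U^{(n)}=(u_0^{(n)},u_1^{(n)})$ for even $n$ and $U^{(n)}=(u_1^{(n)},u_0^{(n)})$ for odd $n$, converges absolutely in $L^2(\mathbb R^m;\mathbb C^2)$. -/

import Mathlib

open MeasureTheory
open scoped ContDiff NNReal ENNReal Nat

noncomputable section

namespace FGASH

/-- Configuration space `ℝ^m` with the Euclidean norm. -/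
abbrev Pos (m : ℕ) : Type := EuclideanSpace ℝ (Fin m)

/-- Phase space `ℝ^{2m}`; a point is `z = (q, p)`. -/
abbrev Phase (m : ℕ) : Type := Pos m × Pos m

/-- The coefficients of a two-state matrix Schrödinger equation on `ℝ^m`: the energy surfaces
`E k`, the first order couplings `d k l` and the second order couplings `D k l`. -/
structure Coeffs (m : ℕ) where
  E : Fin 2 → Pos m → ℝ
  d : Fin 2 → Fin 2 → Pos m → EuclideanSpace ℂ (Fin m)
  D : Fin 2 → Fin 2 → Pos m → ℂ

variable {m : ℕ}

/-- The standard basis vector `e_j` of `ℝ^m`. -/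
def basisVec (j : Fin m) : Pos m := EuclideanSpace.single j 1

/-- The vector field `(q, p) ↦ (p, -∇E(q))` of the Hamiltonian `h(q, p) = |p|²/2 + E(q)`. -/
def hamField (E : Pos m → ℝ) (z : Phase m) : Phase m := (z.2, -gradient E z.1)

/-- `γ` is a global solution of Hamilton's equations `Q' = P`, `P' = -∇E(Q)` with `γ 0 = z`. -/
def IsHamCurve (E : Pos m → ℝ) (z : Phase m) (γ : ℝ → Phase m) : Prop :=
  γ 0 = z ∧ ∀ s : ℝ, HasDerivAt γ (hamField E (γ s)) s

open Classical in
/-- The Hamiltonian flow of `|p|²/2 + E(q)` for the time `s` (its value is immaterial if there is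
no global solution, which does not happen when the Hessian of `E` is bounded). -/
def hamFlow (E : Pos m → ℝ) (s : ℝ) (z : Phase m) : Phase m :=
  if h : ∃ γ : ℝ → Phase m, IsHamCurve E z γ then h.choose s else z

/-- The surface on which a trajectory moves after `n` hops, starting on surface `l`: every hop
exchanges the surfaces `0` and `1`. -/
def surf (l : Fin 2) (n : ℕ) : Fin 2 := if Even n then l else 1 - l

/-- The set of ordered hopping times `0 ≤ t₁ ≤ ⋯ ≤ tₙ ≤ t`; the time `t_k` is `T (k - 1)`. -/
def hopSimplex (n : ℕ) (t : ℝ) : Set (Fin n → ℝ) :=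
  {T | Monotone T ∧ ∀ i, 0 ≤ T i ∧ T i ≤ t}

/-- `(Q⁽ⁿ⁾, P⁽ⁿ⁾)(s, T_{n:1}, z)`: start at `z` at time `0`, move along the flow of surface `l`
until `t₁`, along that of the other surface until `t₂`, and so on, with the last piece, on surface
`surf l n`, from `tₙ` to `s`. The trajectory is continuous at the hops. -/
def traj (c : Coeffs m) (l : Fin 2) : (n : ℕ) → (Fin n → ℝ) → ℝ → Phase m → Phase m
  | 0, _, s, z => hamFlow (c.E l) s z
  | n + 1, T, s, z =>
      hamFlow (c.E (surf l (n + 1))) (s - T (Fin.last n))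
        (traj c l n (Fin.init T) (T (Fin.last n)) z)

/-- The Lagrangian `|P⁽ⁿ⁾|²/2 - E_j(Q⁽ⁿ⁾)` on the current surface `j = surf l n`. -/
def lagrangian (c : Coeffs m) (l : Fin 2) (n : ℕ) (T : Fin n → ℝ) (s : ℝ) (z : Phase m) : ℝ :=
  ‖(traj c l n T s z).2‖ ^ 2 / 2 - c.E (surf l n) (traj c l n T s z).1

/-- The action `S⁽ⁿ⁾(s, T_{n:1}, z)`: `dS⁽ⁿ⁾/ds = |P⁽ⁿ⁾|²/2 - E_j(Q⁽ⁿ⁾)`, `S⁽⁰⁾ = 0` at time `0`,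
continuous at the hops. -/
def action (c : Coeffs m) (l : Fin 2) : (n : ℕ) → (Fin n → ℝ) → ℝ → Phase m → ℝ
  | 0, T, s, z => ∫ r in (0 : ℝ)..s, lagrangian c l 0 T r z
  | n + 1, T, s, z =>
      action c l n (Fin.init T) (T (Fin.last n)) z
        + ∫ r in (T (Fin.last n))..s, lagrangian c l (n + 1) T r z

/-- The matrix `∂_z Q⁽ⁿ⁾`, `∂_z = ∂_q - i ∂_p`, with entries `∂_{z_j} Q_k` in row `j`, column
`k`; the derivatives are with respect to the initial point, at fixed times. -/
def dzQ (c : Coeffs m) (l : Fin 2) (n : ℕ) (T : Fin n → ℝ) (s : ℝ) (z : Phase m) :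
    Matrix (Fin m) (Fin m) ℂ :=
  Matrix.of fun j k =>
    (((fderiv ℝ (traj c l n T s) z (basisVec j, 0)).1 k : ℝ) : ℂ)
      - Complex.I * (((fderiv ℝ (traj c l n T s) z (0, basisVec j)).1 k : ℝ) : ℂ)

/-- The matrix `∂_z P⁽ⁿ⁾`, with entries `∂_{z_j} P_k`. -/
def dzP (c : Coeffs m) (l : Fin 2) (n : ℕ) (T : Fin n → ℝ) (s : ℝ) (z : Phase m) :
    Matrix (Fin m) (Fin m) ℂ :=
  Matrix.of fun j k =>
    (((fderiv ℝ (traj c l n T s) z (basisVec j, 0)).2 k : ℝ) : ℂ)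
      - Complex.I * (((fderiv ℝ (traj c l n T s) z (0, basisVec j)).2 k : ℝ) : ℂ)

/-- `Z⁽ⁿ⁾ = ∂_z (Q⁽ⁿ⁾ + i P⁽ⁿ⁾)`. -/
def Zmat (c : Coeffs m) (l : Fin 2) (n : ℕ) (T : Fin n → ℝ) (s : ℝ) (z : Phase m) :
    Matrix (Fin m) (Fin m) ℂ :=
  dzQ c l n T s z + Complex.I • dzP c l n T s z

/-- The Hessian matrix `∇²E(q)`. -/
def hess (E : Pos m → ℝ) (q : Pos m) : Matrix (Fin m) (Fin m) ℂ :=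
  Matrix.of fun j k => ((iteratedFDeriv ℝ 2 E q ![basisVec j, basisVec k] : ℝ) : ℂ)

/-- The bilinear product `∑ⱼ vⱼ pⱼ` of a complex vector and a real one. -/
def cdot (v : EuclideanSpace ℂ (Fin m)) (p : Pos m) : ℂ := ∑ j, v j * ((p j : ℝ) : ℂ)

/-- The logarithmic derivative of the amplitude,
`½ tr(Z⁻¹(∂_z P - i ∂_z Q ∇²E_j(Q))) - d_jj(Q)·P`, on the current surface `j = surf l n`. -/
def ampRate (c : Coeffs m) (l : Fin 2) (n : ℕ) (T : Fin n → ℝ) (s : ℝ) (z : Phase m) : ℂ :=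
  (1 / 2 : ℂ) * Matrix.trace ((Zmat c l n T s z)⁻¹ *
      (dzP c l n T s z
        - Complex.I • (dzQ c l n T s z * hess (c.E (surf l n)) (traj c l n T s z).1)))
    - cdot (c.d (surf l n) (surf l n) (traj c l n T s z).1) (traj c l n T s z).2

/-- The amplitude `a⁽ⁿ⁾(s, T_{n:1}, z)`: the solution of the scalar linear equation
`da⁽ⁿ⁾/ds = ampRate · a⁽ⁿ⁾`, with `a⁽⁰⁾ = 2^{m/2}` at time `0`, continuous at the hops. -/
def amp (c : Coeffs m) (l : Fin 2) : (n : ℕ) → (Fin n → ℝ) → ℝ → Phase m → ℂ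
  | 0, T, s, z =>
      (((2 : ℝ) ^ ((m : ℝ) / 2) : ℝ) : ℂ) * Complex.exp (∫ r in (0 : ℝ)..s, ampRate c l 0 T r z)
  | n + 1, T, s, z =>
      amp c l n (Fin.init T) (T (Fin.last n)) z
        * Complex.exp (∫ r in (T (Fin.last n))..s, ampRate c l (n + 1) T r z)

/-- The hopping coefficient `τ⁽ᵏ⁾(T_{k:1}, z) = -P⁽ᵏ⁾ · d_ba(Q⁽ᵏ⁾)` at the hopping time `t_k`, for
`k = n + 1`, where the `k`-th hop goes from the surface `a` to the surface `b`; for trajectories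
that start on surface `0`, `d_ba` is `d₁₀` for odd `k` and `d₀₁` for even `k`. -/
def hopCoeff (c : Coeffs m) (l : Fin 2) (n : ℕ) (T : Fin (n + 1) → ℝ) (z : Phase m) : ℂ :=
  -(cdot (c.d (surf l (n + 1)) (surf l n) (traj c l (n + 1) T (T (Fin.last n)) z).1)
      (traj c l (n + 1) T (T (Fin.last n)) z).2)

/-- The product `τ⁽¹⁾(T_{1:1}, z) ⋯ τ⁽ⁿ⁾(T_{n:1}, z)`. -/
def hopProd (c : Coeffs m) (l : Fin 2) (n : ℕ) (T : Fin n → ℝ) (z : Phase m) : ℂ :=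
  ∏ k : Fin n, hopCoeff c l k (fun i => T (Fin.castLE k.2 i)) z

/-- `∫ u₀(y) exp((i/ε)(-p·(y - q) + (i/2)|y - q|²)) dy`, for `z = (q, p)`. -/
def overlap (ε : ℝ) (u₀ : Pos m → ℂ) (z : Phase m) : ℂ :=
  ∫ y : Pos m, u₀ y * Complex.exp (Complex.I / ε *
    (-((inner ℝ z.2 (y - z.1) : ℝ) : ℂ) + Complex.I / 2 * ((‖y - z.1‖ ^ 2 : ℝ) : ℂ)))

/-- The phase `Θ⁽ⁿ⁾ = S⁽ⁿ⁾ + P⁽ⁿ⁾·(x - Q⁽ⁿ⁾) + (i/2)|x - Q⁽ⁿ⁾|²`. -/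
def theta (c : Coeffs m) (l : Fin 2) (n : ℕ) (t : ℝ) (T : Fin n → ℝ) (z : Phase m)
    (x : Pos m) : ℂ :=
  ((action c l n T t z + inner ℝ (traj c l n T t z).2 (x - (traj c l n T t z).1) : ℝ) : ℂ)
    + Complex.I / 2 * ((‖x - (traj c l n T t z).1‖ ^ 2 : ℝ) : ℂ)

/-- The integrand `τ⁽¹⁾ ⋯ τ⁽ⁿ⁾ A⁽ⁿ⁾ exp(i Θ⁽ⁿ⁾/ε)`, with
`A⁽ⁿ⁾ = a⁽ⁿ⁾ · overlap`. -/
def integrand (c : Coeffs m) (l : Fin 2) (ε : ℝ) (u₀ : Pos m → ℂ) (n : ℕ) (t : ℝ) (x : Pos m)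
    (z : Phase m) (T : Fin n → ℝ) : ℂ :=
  hopProd c l n T z * (amp c l n T t z * overlap ε u₀ z)
    * Complex.exp (Complex.I / ε * theta c l n t T z x)

/-- The `n`-hop contribution `u_l⁽ⁿ⁾(t, x)` of the initial datum `u₀` on surface `l`, with initial
points restricted to `K`. It is a wave function on the surface `surf l n`. -/
def hopTerm (c : Coeffs m) (l : Fin 2) (ε : ℝ) (K : Set (Phase m)) (u₀ : Pos m → ℂ) (n : ℕ)
    (t : ℝ) (x : Pos m) : ℂ :=
  ((1 / (2 * Real.pi * ε) ^ (3 * (m : ℝ) / 2) : ℝ) : ℂ)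
    * ∫ z in K, ∫ T in hopSimplex n t, integrand c l ε u₀ n t x z T

/-- The `n`-th term of the surface hopping series for the two-component wave function, for
initial data `u₀ 0`, `u₀ 1` on the two surfaces: it is `(u_0⁽ⁿ⁾, u_1⁽ⁿ⁾)` for even `n` and
`(u_1⁽ⁿ⁾, u_0⁽ⁿ⁾)` for odd `n`. -/
def ansatzTerm (c : Coeffs m) (ε : ℝ) (K : Set (Phase m)) (u₀ : Fin 2 → Pos m → ℂ) (n : ℕ)
    (t : ℝ) (x : Pos m) : EuclideanSpace ℂ (Fin 2) :=
  WithLp.toLp 2 fun j => hopTerm c (surf j n) ε K (u₀ (surf j n)) n t x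

/-- The gradient `(∂₁f, …, ∂ₘf)` of a complex-valued function on `ℝ^m`. -/
def cgrad (f : Pos m → ℂ) (x : Pos m) : EuclideanSpace ℂ (Fin m) :=
  WithLp.toLp 2 fun j => fderiv ℝ f x (basisVec j)

/-- All phase space points visited up to time `t` by the hopping trajectories that start in `K`,
for all initial surfaces, numbers of hops and hopping times. -/
def visited (c : Coeffs m) (K : Set (Phase m)) (t : ℝ) : Set (Phase m) :=
  {w | ∃ (l : Fin 2) (n : ℕ) (s : ℝ) (T : Fin n → ℝ) (z : Phase m),
    0 ≤ s ∧ s ≤ t ∧ T ∈ hopSimplex n s ∧ z ∈ K ∧ w = traj c l n T s z}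

/-- The energy surfaces of the family `δ ↦ c δ`, `δ > 0`, are smooth, with second derivatives
bounded on `ℝ^m` uniformly in `δ` (subquadratic growth). -/
structure Subquadratic (c : ℝ → Coeffs m) : Prop where
  smooth : ∀ δ > 0, ∀ k, ContDiff ℝ ∞ ((c δ).E k)
  bound : ∃ C_E : ℝ, ∀ δ > 0, ∀ (k : Fin 2) (q : Pos m),
    ‖iteratedFDeriv ℝ 2 ((c δ).E k) q‖ ≤ C_E

/-- The couplings are smooth, and `E`, `d`, `D` and their derivatives of every order are bounded,
uniformly in `δ`, on the region visited by the trajectories from `K` up to time `t`. -/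
structure UniformlyBounded (c : ℝ → Coeffs m) (K : Set (Phase m)) (t : ℝ) : Prop where
  smooth_d : ∀ δ > 0, ∀ k l, ContDiff ℝ ∞ ((c δ).d k l)
  smooth_D : ∀ δ > 0, ∀ k l, ContDiff ℝ ∞ ((c δ).D k l)
  bound : ∀ j : ℕ, ∃ B : ℝ, ∀ δ > 0, ∀ w ∈ visited (c δ) K t, ∀ k l : Fin 2,
    ‖iteratedFDeriv ℝ j ((c δ).E k) w.1‖ ≤ B ∧
    ‖iteratedFDeriv ℝ j ((c δ).d k l) w.1‖ ≤ B ∧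
    ‖iteratedFDeriv ℝ j ((c δ).D k l) w.1‖ ≤ B

end FGASH

end

/-!
The `n`-hop contribution is a superposition of Gaussian wave packets, centred at the end points
`κ(z, T)` of the hopping trajectories and weighted by the FBI transform of the initial datum at `z`
times the factor `τ⁽¹⁾ ⋯ τ⁽ⁿ⁾ a⁽ⁿ⁾ exp(i S⁽ⁿ⁾/ε)`. Its `L²` norm is estimated by duality. Pairing it
with a test function `f` gives an integral over `K` and over the simplex of hopping times of the
FBI transform of `u₀` at `z` times the conjugate of the windowed transform of `f` at `κ(z, T)`.
Windowed Fourier transforms are multiples of isometries `L²(ℝ^m) → L²(ℝ^{2m})`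
(`lintegral_windowed_sq`), and for fixed `T` the map `z ↦ κ(z, T)` is injective and symplectic,
hence preserves volume (`lintegral_comp_traj_le`). By the Cauchy–Schwarz inequality in `z`
(`lintegral_windowed_mul_le`) the pairing is at most the supremum of the factor times the volume of
the simplex times `‖u₀‖ ‖f‖`, and the normalization `(2πε)^{-3m/2}` cancels all powers of `ε`. The
volume of the simplex is `tⁿ/n!` (`volume_hopSimplex_le`).

The supremum of the factor has to be bounded uniformly in the hopping times
(`Controlled.norm_amp_le`, `Controlled.norm_hopProd_le`). Along a trajectory from `K` the force is
bounded, so that the momentum, and with it each hopping coefficient, is bounded. For the amplitude,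
the derivative `F` of the hopping flow is symplectic and bounded by `exp((1 + L) t)`, independently
of the number of hops. The symplectic identity gives `Z Z* ≥ 2` for `Z = ∂_z(Q + iP)`
(`IsSymp.two_mul_le_vecMul`), so `Z` is invertible and the entries of `Z⁻¹` are bounded by `1`.
The logarithmic derivative of the amplitude is therefore bounded.

The operator `ε∂_j` replaces the weight by `i P_j` times itself and subtracts the superposition of
packets with the Hermite window `y_j exp(-|y|²/(2ε))`
(`IsSuperposition.fderiv_superpose`); both are of the same form. The Hermite window costs a factor
`√ε`, which is harmless for `ε ≤ 1`. For `ε ≥ 1` the pointwise bound of the windowed transforms and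
the finite volume of `K` gain `(2πε)^{-m}`, which compensates `√ε` as `m ≥ 1` when there is a
derivative to take (`ansatzScale_mul_superposeBound_hermiteWin_le`).

The regularity needed on the way (existence, joint continuity and differentiability of the
Hamiltonian flow) comes from a global Picard–Lindelöf theorem for fields of linear growth and from
the variational equation (`exists_fderiv_flow`).
-/

/-! ### Flows of vector fields of linear growth -/

namespace FGASH

section Flow

open Set Metric Filter Topology

variable {X : Type*} [NormedAddCommGroup X] [NormedSpace ℝ X]

/-- A two-sided Grönwall inequality. -/
theorem norm_le_gronwallBound_abs {r r' : ℝ → X} {K ε τ : ℝ}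
    (hr : ∀ s, HasDerivAt r (r' s) s) (bound : ∀ s, |s| ≤ τ → ‖r' s‖ ≤ K * ‖r s‖ + ε)
    {s : ℝ} (hs : |s| ≤ τ) : ‖r s‖ ≤ gronwallBound ‖r 0‖ K ε |s| := by
  rcases le_total 0 s with h | h
  · have := norm_le_gronwallBound_of_norm_deriv_right_le (f := r) (f' := r') (a := 0) (b := s)
      (δ := ‖r 0‖) (K := K) (ε := ε)
      (fun x _ => (hr x).continuousAt.continuousWithinAt)
      (fun x _ => (hr x).hasDerivWithinAt) le_rfl
      (fun x hx => bound x (by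
        rw [abs_of_nonneg hx.1]; rw [abs_of_nonneg h] at hs; exact hx.2.le.trans hs))
      s ⟨h, le_rfl⟩
    simpa [abs_of_nonneg h] using this
  · have hd : ∀ x, HasDerivAt (fun y => r (-y)) (-(r' (-x))) x := fun x => by
      simpa [Function.comp_def] using (hr (-x)).scomp x (hasDerivAt_neg x)
    have := norm_le_gronwallBound_of_norm_deriv_right_le (f := fun y => r (-y))
      (f' := fun x => -(r' (-x))) (a := 0) (b := -s) (δ := ‖r 0‖) (K := K) (ε := ε)
      (fun x _ => (hd x).continuousAt.continuousWithinAt)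
      (fun x _ => (hd x).hasDerivWithinAt) (by simp)
      (fun x hx => by
        rw [norm_neg]
        refine bound (-x) ?_
        rw [abs_neg, abs_of_nonneg hx.1]; rw [abs_of_nonpos h] at hs; exact hx.2.le.trans hs)
      (-s) ⟨by linarith, le_rfl⟩
    simpa [abs_of_nonpos h] using this

/-- Two integral curves in a region where the field is `K`-Lipschitz separate at most
exponentially. -/
theorem dist_integralCurve_le {f : X → X} {S : Set X} {K : ℝ≥0} (hf : LipschitzOnWith K f S)
    {γ₁ γ₂ : ℝ → X} (h₁ : ∀ s, HasDerivAt γ₁ (f (γ₁ s)) s)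
    (h₂ : ∀ s, HasDerivAt γ₂ (f (γ₂ s)) s) {τ : ℝ} (hS₁ : ∀ s, |s| ≤ τ → γ₁ s ∈ S)
    (hS₂ : ∀ s, |s| ≤ τ → γ₂ s ∈ S) {s : ℝ} (hs : |s| ≤ τ) :
    dist (γ₁ s) (γ₂ s) ≤ dist (γ₁ 0) (γ₂ 0) * Real.exp (K * |s|) := by
  have := norm_le_gronwallBound_abs (r := fun s => γ₁ s - γ₂ s) (K := K) (ε := 0)
    (fun s => (h₁ s).sub (h₂ s))
    (fun s hs => by
      simpa [dist_eq_norm] using hf.dist_le_mul _ (hS₁ s hs) _ (hS₂ s hs)) hs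
  simpa [gronwallBound_ε0, dist_eq_norm] using this

/-- Integral curves of a field of linear growth grow at most exponentially. -/
theorem norm_integralCurve_le {f : X → X} {A : ℝ} (hA : 0 < A)
    (hlin : ∀ x, ‖f x‖ ≤ A * (1 + ‖x‖)) {γ : ℝ → X} (h : ∀ s, HasDerivAt γ (f (γ s)) s) (s : ℝ) :
    ‖γ s‖ ≤ (1 + ‖γ 0‖) * Real.exp (A * |s|) := by
  have := norm_le_gronwallBound_abs (K := A) (ε := A) h
    (fun s _ => by linarith [hlin (γ s)]) (le_refl |s|)
  rw [gronwallBound_of_K_ne_0 hA.ne', div_self hA.ne'] at this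
  linarith

/-- The quadratic Taylor remainder of a field whose derivative is Lipschitz on a convex set. -/
theorem norm_sub_sub_fderiv_le {f : X → X} (hf : Differentiable ℝ f) {S : Set X}
    (hS : Convex ℝ S) {M : ℝ≥0} (hM : LipschitzOnWith M (fderiv ℝ f) S) {y y' : X} (hy : y ∈ S)
    (hy' : y' ∈ S) : ‖f y' - f y - fderiv ℝ f y (y' - y)‖ ≤ M * ‖y' - y‖ ^ 2 := by
  have : ‖f y' - f y - fderiv ℝ f y (y' - y)‖ ≤ M * ‖y' - y‖ * ‖y' - y‖ :=
    (convex_segment (𝕜 := ℝ) y y').norm_image_sub_le_of_norm_hasFDerivWithin_le'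
    (f := f) (f' := fderiv ℝ f) (C := M * ‖y' - y‖)
    (fun x _ => (hf x).hasFDerivAt.hasFDerivWithinAt)
    (fun x hx => by
      have h1 := hM.dist_le_mul x (hS.segment_subset hy hy' hx) y hy
      rw [dist_eq_norm, dist_eq_norm] at h1
      refine h1.trans ?_
      gcongr
      obtain ⟨θ, ⟨hθ0, hθ1⟩, rfl⟩ := (segment_eq_image' ℝ y y').subset hx
      simp only [add_sub_cancel_left, norm_smul, Real.norm_eq_abs, abs_of_nonneg hθ0]
      nlinarith [norm_nonneg (y' - y)])
    (left_mem_segment ℝ y y') (right_mem_segment ℝ y y')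
  calc _ ≤ M * ‖y' - y‖ * ‖y' - y‖ := this
    _ = _ := by ring

variable [FiniteDimensional ℝ X]

/-- A `C¹` field of linear growth has global integral curves: near `x` it is bounded by a multiple
of the radius of a ball proportional to `1 + ‖x‖`, so that local solutions exist for a time that
does not depend on `x`. -/
theorem exists_global_integralCurve {f : X → X} (hf : ContDiff ℝ 1 f) {A : ℝ} (hA : 0 < A)
    (hlin : ∀ x, ‖f x‖ ≤ A * (1 + ‖x‖)) (x : X) :
    ∃ γ : ℝ → X, γ 0 = x ∧ ∀ s, HasDerivAt γ (f (γ s)) s := by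
  have : CompleteSpace X := FiniteDimensional.complete ℝ X
  have : ProperSpace X := FiniteDimensional.proper_real X
  set e : ℝ := 1 / (2 * A) with he
  have he0 : 0 < e := by positivity
  have hloc : ∀ x : X, ∃ γ : ℝ → X, γ 0 = x ∧
      IsMIntegralCurveOn (I := modelWithCornersSelf ℝ X) γ (fun x => f x) (Ioo (-e) e) := by
    intro x
    obtain ⟨K, hK⟩ := hf.contDiffOn.exists_lipschitzOnWith (s := closedBall x (1 + ‖x‖))
      one_ne_zero (convex_closedBall _ _) (isCompact_closedBall _ _)
    have h0 : (0 : ℝ) ∈ Icc (-e) e := ⟨by linarith, he0.le⟩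
    have hPL : IsPicardLindelof (fun _ => f) (⟨0, h0⟩ : Icc (-e) e) x
        ⟨1 + ‖x‖, by positivity⟩ 0 ⟨2 * A * (1 + ‖x‖), by positivity⟩ K := by
      refine IsPicardLindelof.of_time_independent (fun y hy => ?_) hK ?_
      · have h1 : ‖y‖ ≤ ‖x‖ + (1 + ‖x‖) := by
          have := mem_closedBall_iff_norm.1 hy
          have h2 := norm_le_norm_add_norm_sub' y x
          exact h2.trans (by gcongr; exact this)
        refine (hlin y).trans ?_
        change A * (1 + ‖y‖) ≤ 2 * A * (1 + ‖x‖)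
        nlinarith
      · change 2 * A * (1 + ‖x‖) * max (e - 0) (0 - -e) ≤ 1 + ‖x‖ - 0
        rw [sub_zero, zero_sub, neg_neg, max_self, he, sub_zero]
        apply le_of_eq
        field_simp
    obtain ⟨γ, hγ0, hγ⟩ := hPL.exists_eq_forall_mem_Icc_hasDerivWithinAt₀
    refine ⟨γ, hγ0, fun s hs => ?_⟩
    have := ((hγ s (Ioo_subset_Icc_self hs)).hasDerivAt (Icc_mem_nhds hs.1 hs.2)).hasFDerivAt
    exact this.hasMFDerivAt.hasMFDerivWithinAt
  have hv : ContMDiff (modelWithCornersSelf ℝ X) (modelWithCornersSelf ℝ X).tangent 1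
      (fun x ↦ (⟨x, f x⟩ : TangentBundle (modelWithCornersSelf ℝ X) X)) := by
    intro y
    exact (contMDiffWithinAt_vectorSpace_iff_contDiffWithinAt (s := univ)).2
      hf.contDiffAt.contDiffWithinAt
  obtain ⟨γ, hγ0, hγ⟩ := exists_isMIntegralCurve_of_isMIntegralCurveOn hv he0 hloc x
  refine ⟨γ, hγ0, fun s => ?_⟩
  have h : HasFDerivAt γ ((1 : ℝ →L[ℝ] ℝ).smulRight (f (γ s))) s := (hγ s).hasFDerivAt
  simpa using h.hasDerivAt

/-- Global integral curves of a `C¹` field of linear growth are unique. -/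
theorem integralCurve_unique {f : X → X} (hf : ContDiff ℝ 1 f) {A : ℝ} (hA : 0 < A)
    (hlin : ∀ x, ‖f x‖ ≤ A * (1 + ‖x‖)) {γ₁ γ₂ : ℝ → X} (h₁ : ∀ s, HasDerivAt γ₁ (f (γ₁ s)) s)
    (h₂ : ∀ s, HasDerivAt γ₂ (f (γ₂ s)) s) {s₀ : ℝ} (h₀ : γ₁ s₀ = γ₂ s₀) : γ₁ = γ₂ := by
  have : ProperSpace X := FiniteDimensional.proper_real X
  -- after a translation in time, the curves agree at time `0`
  suffices H : ∀ γ₁ γ₂ : ℝ → X, (∀ s, HasDerivAt γ₁ (f (γ₁ s)) s) →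
      (∀ s, HasDerivAt γ₂ (f (γ₂ s)) s) → γ₁ 0 = γ₂ 0 → γ₁ = γ₂ by
    have := H (fun s => γ₁ (s + s₀)) (fun s => γ₂ (s + s₀))
      (fun s => (h₁ (s + s₀)).comp_add_const s s₀) (fun s => (h₂ (s + s₀)).comp_add_const s s₀)
      (by simpa using h₀)
    funext s
    simpa using congrFun this (s - s₀)
  intro γ₁ γ₂ h₁ h₂ h₀
  funext s
  obtain ⟨K, hK⟩ := hf.contDiffOn.exists_lipschitzOnWith
    (s := closedBall (0 : X) ((1 + ‖γ₁ 0‖) * Real.exp (A * |s|)))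
    one_ne_zero (convex_closedBall _ _) (isCompact_closedBall _ _)
  have hmem : ∀ γ : ℝ → X, (∀ s, HasDerivAt γ (f (γ s)) s) → γ 0 = γ₁ 0 → ∀ r, |r| ≤ |s| →
      γ r ∈ closedBall (0 : X) ((1 + ‖γ₁ 0‖) * Real.exp (A * |s|)) := by
    intro γ hγ h0 r hr
    rw [mem_closedBall_zero_iff, ← h0]
    exact (norm_integralCurve_le hA hlin hγ r).trans (by gcongr)
  have := dist_integralCurve_le hK h₁ h₂ (hmem γ₁ h₁ rfl) (hmem γ₂ h₂ h₀.symm) (le_refl |s|)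
  rw [h₀, dist_self, zero_mul] at this
  exact dist_le_zero.1 this

/-- The flow of a `C¹` field of linear growth is jointly continuous in time and initial point. -/
theorem continuous_flow {f : X → X} (hf : ContDiff ℝ 1 f) {A : ℝ} (hA : 0 < A)
    (hlin : ∀ x, ‖f x‖ ≤ A * (1 + ‖x‖)) {Φ : ℝ → X → X} (h0 : ∀ x, Φ 0 x = x)
    (hΦ : ∀ x s, HasDerivAt (fun s => Φ s x) (f (Φ s x)) s) :
    Continuous fun p : ℝ × X => Φ p.1 p.2 := by
  have : ProperSpace X := FiniteDimensional.proper_real X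
  rw [continuous_iff_continuousAt]
  rintro ⟨s₀, x₀⟩
  set R := (1 + (‖x₀‖ + 1)) * Real.exp (A * (|s₀| + 1))
  obtain ⟨K, hK⟩ := hf.contDiffOn.exists_lipschitzOnWith (s := closedBall (0 : X) R)
    one_ne_zero (convex_closedBall _ _) (isCompact_closedBall _ _)
  have hmem : ∀ x, ‖x‖ ≤ ‖x₀‖ + 1 → ∀ r, |r| ≤ |s₀| + 1 → Φ r x ∈ closedBall (0 : X) R := by
    intro x hx r hr
    rw [mem_closedBall_zero_iff]
    refine (norm_integralCurve_le hA hlin (hΦ x) r).trans ?_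
    have hR : 0 ≤ 1 + ‖x‖ := by positivity
    rw [h0]
    change _ ≤ (1 + (‖x₀‖ + 1)) * Real.exp (A * (|s₀| + 1))
    gcongr
  have key : ∀ᶠ p : ℝ × X in 𝓝 (s₀, x₀), dist (Φ p.1 p.2) (Φ s₀ x₀) ≤
      dist p.2 x₀ * Real.exp (K * (|s₀| + 1)) + dist (Φ p.1 x₀) (Φ s₀ x₀) := by
    have h1 : ∀ᶠ p : ℝ × X in 𝓝 (s₀, x₀), |p.1| ≤ |s₀| + 1 := by
      have : Continuous fun p : ℝ × X => |p.1| := by fun_prop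
      exact (this.tendsto (s₀, x₀)).eventually_le_const (by simp)
    have h2 : ∀ᶠ p : ℝ × X in 𝓝 (s₀, x₀), ‖p.2‖ ≤ ‖x₀‖ + 1 := by
      have : Continuous fun p : ℝ × X => ‖p.2‖ := by fun_prop
      exact (this.tendsto (s₀, x₀)).eventually_le_const (by simp)
    filter_upwards [h1, h2] with p hp1 hp2
    refine (dist_triangle _ (Φ p.1 x₀) _).trans ?_
    gcongr
    refine (dist_integralCurve_le hK (hΦ p.2) (hΦ x₀) (hmem _ hp2)
      (hmem _ (by linarith)) hp1).trans ?_
    rw [h0, h0]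
    gcongr
  rw [ContinuousAt, tendsto_iff_dist_tendsto_zero]
  refine squeeze_zero' (Eventually.of_forall fun _ => dist_nonneg) key ?_
  have hc : Continuous fun s => Φ s x₀ :=
    continuous_iff_continuousAt.2 fun s => (hΦ x₀ s).continuousAt
  have : Continuous fun p : ℝ × X =>
      dist p.2 x₀ * Real.exp (K * (|s₀| + 1)) + dist (Φ p.1 x₀) (Φ s₀ x₀) := by fun_prop
  simpa using this.tendsto (s₀, x₀)

/-- The flow of a `C²` field with bounded derivative is differentiable in the initial point. The
derivative `V` is jointly continuous and solves the variational equation. It is built as the second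
component of the flow of `(x, W) ↦ (f x, Df(x) ∘ W)`, and the difference quotient is compared with
it by Grönwall's inequality. -/
theorem exists_fderiv_flow {f : X → X} (hf : ContDiff ℝ 2 f) {L : ℝ≥0}
    (hL : ∀ x, ‖fderiv ℝ f x‖ ≤ L) {Φ : ℝ → X → X} (h0 : ∀ x, Φ 0 x = x)
    (hΦ : ∀ x s, HasDerivAt (fun s => Φ s x) (f (Φ s x)) s) :
    ∃ V : ℝ → X → X →L[ℝ] X, (Continuous fun p : ℝ × X => V p.1 p.2) ∧
      (∀ x, V 0 x = ContinuousLinearMap.id ℝ X) ∧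
      (∀ x s, HasDerivAt (fun s => V s x) ((fderiv ℝ f (Φ s x)).comp (V s x)) s) ∧
      ∀ s x, HasFDerivAt (Φ s) (V s x) x := by
  have : ProperSpace X := FiniteDimensional.proper_real X
  have hf1 : ContDiff ℝ 1 f := hf.of_le (by norm_num)
  have hLip : LipschitzWith L f :=
    lipschitzWith_of_nnnorm_fderiv_le (hf1.differentiable one_ne_zero) hL
  set A : ℝ := ‖f 0‖ + L + 1 with hAdef
  have hA : 0 < A := by positivity
  have hfnorm : ∀ x, ‖f x‖ ≤ ‖f 0‖ + L * ‖x‖ := fun x => by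
    have h1 := hLip.dist_le_mul x 0
    rw [dist_eq_norm, dist_zero_right] at h1
    linarith [norm_le_norm_add_norm_sub' (f x) (f 0)]
  have hlin : ∀ x, ‖f x‖ ≤ A * (1 + ‖x‖) := fun x => by
    nlinarith [hfnorm x, norm_nonneg x, norm_nonneg (f 0), L.2,
      mul_nonneg (norm_nonneg (f 0)) (norm_nonneg x)]
  let F : X × (X →L[ℝ] X) → X × (X →L[ℝ] X) := fun p => (f p.1, (fderiv ℝ f p.1).comp p.2)
  have hF : ContDiff ℝ 1 F := by
    refine (hf1.comp contDiff_fst).prodMk (ContDiff.clm_comp ?_ contDiff_snd)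
    exact (hf.fderiv_right (m := 1) (by norm_num)).comp contDiff_fst
  have hFlin : ∀ p, ‖F p‖ ≤ A * (1 + ‖p‖) := fun p => by
    have hp1 := norm_fst_le p
    have hp2 := norm_snd_le p
    refine max_le ((hlin p.1).trans (by gcongr)) ?_
    refine (ContinuousLinearMap.opNorm_comp_le _ _).trans ?_
    calc ‖fderiv ℝ f p.1‖ * ‖p.2‖ ≤ L * ‖p‖ := by gcongr; exact hL _
      _ ≤ A * (1 + ‖p‖) := by
        gcongr
        · linarith [norm_nonneg (f 0)]
        · linarith
  choose Γ hΓ0 hΓ using exists_global_integralCurve hF hA hFlin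
  have hΓ1 : ∀ p s, (Γ p s).1 = Φ s p.1 := by
    intro p s
    have := integralCurve_unique hf1 hA hlin (γ₁ := fun s => (Γ p s).1) (γ₂ := fun s => Φ s p.1)
      (fun s => ((hasFDerivAt_fst (𝕜 := ℝ) (p := Γ p s)).comp_hasDerivAt s (hΓ p s)))
      (hΦ p.1) (s₀ := 0) (by simp [hΓ0, h0])
    exact congrFun this s
  have hΓc := continuous_flow hF hA hFlin (Φ := fun s p => Γ p s) hΓ0 (fun p s => hΓ p s)
  set V : ℝ → X → X →L[ℝ] X := fun s x => (Γ (x, ContinuousLinearMap.id ℝ X) s).2 with hV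
  have hVd : ∀ x s, HasDerivAt (fun s => V s x) ((fderiv ℝ f (Φ s x)).comp (V s x)) s := by
    intro x s
    have := (hasFDerivAt_snd (𝕜 := ℝ) (p := Γ (x, ContinuousLinearMap.id ℝ X) s)).comp_hasDerivAt s
      (hΓ (x, ContinuousLinearMap.id ℝ X) s)
    rw [← hΓ1 (x, ContinuousLinearMap.id ℝ X) s]
    exact this
  have hV0 : ∀ x, V 0 x = ContinuousLinearMap.id ℝ X := fun x => by simp [hV, hΓ0]
  have hVc : Continuous fun p : ℝ × X => V p.1 p.2 := by
    have : Continuous fun p : ℝ × X => (p.1, (p.2, ContinuousLinearMap.id ℝ X)) := by fun_prop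
    exact continuous_snd.comp (hΓc.comp this)
  refine ⟨V, hVc, hV0, hVd, fun s x => ?_⟩
  -- on a ball that contains all relevant trajectories, `Df` is `M`-Lipschitz
  set R := (1 + (‖x‖ + 1)) * Real.exp (A * |s|)
  obtain ⟨M, hM⟩ := (hf.fderiv_right (m := 1) (by norm_num)).contDiffOn.exists_lipschitzOnWith
    (s := closedBall (0 : X) R) one_ne_zero (convex_closedBall _ _) (isCompact_closedBall _ _)
  have hmem : ∀ y, ‖y‖ ≤ ‖x‖ + 1 → ∀ r, |r| ≤ |s| → Φ r y ∈ closedBall (0 : X) R := by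
    intro y hy r hr
    rw [mem_closedBall_zero_iff]
    refine (norm_integralCurve_le hA hlin (hΦ y) r).trans ?_
    rw [h0]
    change _ ≤ (1 + (‖x‖ + 1)) * Real.exp (A * |s|)
    gcongr
  set C : ℝ := gronwallBound 0 (L + 1) (M * Real.exp (L * |s|) ^ 2) |s| with hC
  have hscale : ∀ c : ℝ, gronwallBound 0 (L + 1) (M * Real.exp (L * |s|) ^ 2 * c) |s| = C * c := by
    intro c
    have hne : (L + 1 : ℝ) ≠ 0 := by positivity
    rw [hC, gronwallBound_of_K_ne_0 hne, gronwallBound_of_K_ne_0 hne]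
    ring
  have key : ∀ y, ‖y - x‖ ≤ 1 → ‖Φ s y - Φ s x - V s x (y - x)‖ ≤ C * ‖y - x‖ ^ 2 := by
    intro y hy
    have hy' : ‖y‖ ≤ ‖x‖ + 1 := by linarith [norm_le_norm_add_norm_sub' y x]
    have hd : ∀ r, HasDerivAt (fun r => Φ r y - Φ r x - V r x (y - x))
        (f (Φ r y) - f (Φ r x) - fderiv ℝ f (Φ r x) (V r x (y - x))) r := by
      intro r
      refine ((hΦ y r).sub (hΦ x r)).sub ?_
      have := (hVd x r).clm_apply (hasDerivAt_const r (y - x))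
      simpa using this
    have := norm_le_gronwallBound_abs (K := L + 1)
      (ε := M * Real.exp (L * |s|) ^ 2 * ‖y - x‖ ^ 2) (τ := |s|) hd ?_ le_rfl
    · have h00 : Φ 0 y - Φ 0 x - V 0 x (y - x) = 0 := by simp [h0, hV0]
      rwa [h00, norm_zero, hscale] at this
    · intro r hr
      have h1 := norm_sub_sub_fderiv_le (hf1.differentiable one_ne_zero) (convex_closedBall _ _) hM
        (hmem x (by linarith) r hr) (hmem y hy' r hr)
      have h2 := dist_integralCurve_le (S := univ) (hLip.lipschitzOnWith) (hΦ y) (hΦ x)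
        (τ := |s|) (fun _ _ => mem_univ _) (fun _ _ => mem_univ _) hr
      rw [h0, h0, dist_eq_norm, dist_eq_norm] at h2
      have h3 : ‖Φ r y - Φ r x‖ ^ 2 ≤ (‖y - x‖ * Real.exp (L * |s|)) ^ 2 := by
        gcongr
        exact h2.trans (by gcongr)
      have h4 : f (Φ r y) - f (Φ r x) - fderiv ℝ f (Φ r x) (V r x (y - x)) =
          (f (Φ r y) - f (Φ r x) - fderiv ℝ f (Φ r x) (Φ r y - Φ r x)) +
          fderiv ℝ f (Φ r x) (Φ r y - Φ r x - V r x (y - x)) := by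
        simp only [map_sub]; abel
      rw [h4]
      refine (norm_add_le _ _).trans ?_
      have h5 := (fderiv ℝ f (Φ r x)).le_of_opNorm_le (hL (Φ r x)) (Φ r y - Φ r x - V r x (y - x))
      have h6 := mul_le_mul_of_nonneg_left h3 M.2
      have h7 := norm_nonneg (Φ r y - Φ r x - V r x (y - x))
      calc _ ≤ M * ‖Φ r y - Φ r x‖ ^ 2 + L * ‖Φ r y - Φ r x - V r x (y - x)‖ := add_le_add h1 h5
        _ ≤ M * (‖y - x‖ * Real.exp (L * |s|)) ^ 2
            + (L + 1) * ‖Φ r y - Φ r x - V r x (y - x)‖ := by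
          refine add_le_add h6 ?_
          gcongr; linarith
        _ = _ := by ring
  refine HasFDerivAt.of_isLittleO ?_
  have hbig : (fun y => Φ s y - Φ s x - V s x (y - x)) =O[𝓝 x] fun y => ‖y - x‖ ^ 2 := by
    refine Asymptotics.IsBigO.of_bound C ?_
    filter_upwards [closedBall_mem_nhds x one_pos] with y hy
    simpa using key y (mem_closedBall_iff_norm.1 hy)
  refine hbig.trans_isLittleO ?_
  have hlim : Tendsto (fun y => y - x) (𝓝 x) (𝓝 0) := by
    exact Continuous.tendsto' (by fun_prop) x 0 (by simp)
  simpa [Function.comp_def] using (Asymptotics.isLittleO_norm_pow_id one_lt_two).comp_tendsto hlim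

end Flow

end FGASH

/-! ### The Hamiltonian flow -/

namespace FGASH

section HamFlow

open Set

variable {m : ℕ}

/-- The standard symplectic form `ω((q, p), (q', p')) = q·p' - p·q'` on phase space. -/
noncomputable def symp (u v : Phase m) : ℝ := inner ℝ u.1 v.2 - inner ℝ u.2 v.1

/-- A linear map of phase space is symplectic if it preserves `ω`. -/
def IsSymp (F : Phase m →L[ℝ] Phase m) : Prop := ∀ u v, symp (F u) (F v) = symp u v

/-- A smooth potential whose second derivative is bounded by `L`. -/
structure GoodPotential (E : Pos m → ℝ) (L : ℝ≥0) : Prop where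
  smooth : ContDiff ℝ ∞ E
  bound : ∀ q, ‖iteratedFDeriv ℝ 2 E q‖ ≤ L

variable {E : Pos m → ℝ} {L : ℝ≥0}

theorem inner_gradient (E : Pos m → ℝ) (q v : Pos m) :
    inner ℝ (gradient E q) v = fderiv ℝ E q v := by
  simp [gradient]

theorem GoodPotential.contDiff_gradient (hE : GoodPotential E L) :
    ContDiff ℝ ∞ (gradient E) := by
  rw [contDiff_euclidean]
  intro i
  have h1 : (fun q => gradient E q i) = fun q => fderiv ℝ E q (basisVec i) := by
    funext q
    rw [← inner_gradient E, basisVec, EuclideanSpace.inner_single_right]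
    simp
  rw [h1]
  exact (hE.smooth.fderiv_right (m := ∞) (by simp)).clm_apply contDiff_const

theorem GoodPotential.inner_fderiv_gradient (hE : GoodPotential E L) (q u v : Pos m) :
    inner ℝ (fderiv ℝ (gradient E) q u) v = fderiv ℝ (fderiv ℝ E) q u v := by
  have h1 : HasFDerivAt (gradient E) (fderiv ℝ (gradient E) q) q :=
    (hE.contDiff_gradient.differentiable (by simp) q).hasFDerivAt
  have h2 : HasFDerivAt (fderiv ℝ E) (fderiv ℝ (fderiv ℝ E) q) q :=
    (((hE.smooth.fderiv_right (m := ∞) (by simp)).differentiable (by simp)) q).hasFDerivAt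
  have h3 := h1.inner ℝ (hasFDerivAt_const v q)
  have h4 := h2.clm_apply (hasFDerivAt_const v q)
  have h5 : (fun q => inner ℝ (gradient E q) v) = fun q => fderiv ℝ E q v :=
    funext fun q => inner_gradient E q v
  rw [h5] at h3
  have := congrArg (fun T => T u) (h3.unique h4)
  simpa using this

theorem GoodPotential.norm_fderiv_gradient_le (hE : GoodPotential E L) (q : Pos m) :
    ‖fderiv ℝ (gradient E) q‖ ≤ L := by
  refine ContinuousLinearMap.opNorm_le_bound _ L.2 fun u => ?_
  have h1 : ‖fderiv ℝ (fderiv ℝ E) q‖ ≤ L := by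
    have := norm_iteratedFDeriv_fderiv (𝕜 := ℝ) (f := E) (n := 1) (x := q)
    rw [norm_iteratedFDeriv_one] at this
    rw [this]
    exact hE.bound q
  set w := fderiv ℝ (gradient E) q u with hw
  have h2 : ‖w‖ * ‖w‖ ≤ (L * ‖u‖) * ‖w‖ := by
    rw [← real_inner_self_eq_norm_mul_norm]
    conv_lhs => rw [hw, hE.inner_fderiv_gradient, ← hw]
    refine (Real.le_norm_self _).trans ?_
    refine (ContinuousLinearMap.le_opNorm _ _).trans ?_
    gcongr
    exact (fderiv ℝ (fderiv ℝ E) q).le_of_opNorm_le h1 u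
  rcases (norm_nonneg w).eq_or_lt with h | h
  · change ‖w‖ ≤ L * ‖u‖
    rw [← h]; positivity
  · exact le_of_mul_le_mul_right h2 h

/-- The second derivative is symmetric. -/
theorem GoodPotential.fderiv_gradient_symm (hE : GoodPotential E L) (q u v : Pos m) :
    inner ℝ (fderiv ℝ (gradient E) q u) v = inner ℝ u (fderiv ℝ (gradient E) q v) := by
  rw [← real_inner_comm u, hE.inner_fderiv_gradient, hE.inner_fderiv_gradient]
  exact (hE.smooth.contDiffAt.isSymmSndFDerivAt (by simpa using ENat.LEInfty.out)).eq u v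

theorem GoodPotential.contDiff_hamField (hE : GoodPotential E L) :
    ContDiff ℝ 2 (hamField E) :=
  contDiff_snd.prodMk
    ((hE.contDiff_gradient.of_le (ENat.LEInfty.out)).neg.comp contDiff_fst)

theorem GoodPotential.fderiv_hamField (hE : GoodPotential E L) (z w : Phase m) :
    fderiv ℝ (hamField E) z w = (w.2, -fderiv ℝ (gradient E) z.1 w.1) := by
  have h1 : HasFDerivAt (gradient E) (fderiv ℝ (gradient E) z.1) z.1 :=
    (hE.contDiff_gradient.differentiable (by simp) z.1).hasFDerivAt
  have h2 : HasFDerivAt (hamField E) _ z :=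
    (hasFDerivAt_snd (𝕜 := ℝ) (p := z)).prodMk
      ((h1.comp z (hasFDerivAt_fst (𝕜 := ℝ) (p := z))).neg)
  rw [h2.fderiv]
  simp

theorem GoodPotential.norm_fderiv_hamField_le (hE : GoodPotential E L) (z : Phase m) :
    ‖fderiv ℝ (hamField E) z‖ ≤ (1 + L : ℝ≥0) := by
  refine ContinuousLinearMap.opNorm_le_bound _ (NNReal.coe_nonneg _) fun w => ?_
  rw [hE.fderiv_hamField]
  have h1 := norm_fst_le w
  have h2 := norm_snd_le w
  have h3 := (fderiv ℝ (gradient E) z.1).le_of_opNorm_le (hE.norm_fderiv_gradient_le z.1) w.1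
  have h4 := norm_nonneg w
  have h5 : (L : ℝ) * ‖w.1‖ ≤ L * ‖w‖ := by gcongr
  have h6 : (0 : ℝ) ≤ L * ‖w‖ := by positivity
  rw [NNReal.coe_add, NNReal.coe_one]
  refine max_le ?_ ?_
  · change ‖w.2‖ ≤ _
    linarith
  · change ‖-fderiv ℝ (gradient E) z.1 w.1‖ ≤ _
    rw [norm_neg]
    linarith

theorem GoodPotential.lipschitzWith_hamField (hE : GoodPotential E L) :
    LipschitzWith (1 + L) (hamField E) :=
  lipschitzWith_of_nnnorm_fderiv_le (hE.contDiff_hamField.differentiable (by simp))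
    hE.norm_fderiv_hamField_le

theorem GoodPotential.norm_hamField_le (hE : GoodPotential E L) (z : Phase m) :
    ‖hamField E z‖ ≤ (‖hamField E 0‖ + (1 + L)) * (1 + ‖z‖) := by
  have h1 := hE.lipschitzWith_hamField.dist_le_mul z 0
  rw [dist_eq_norm, dist_zero_right, NNReal.coe_add, NNReal.coe_one] at h1
  have h2 := norm_le_norm_add_norm_sub' (hamField E z) (hamField E 0)
  have h3 : (0 : ℝ) ≤ ‖hamField E 0‖ * ‖z‖ := by positivity
  have h4 : (0 : ℝ) ≤ L := L.2
  nlinarith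

theorem GoodPotential.exists_isHamCurve (hE : GoodPotential E L) (z : Phase m) :
    ∃ γ, IsHamCurve E z γ :=
  exists_global_integralCurve (hE.contDiff_hamField.of_le (by norm_num))
    (A := ‖hamField E 0‖ + (1 + L)) (by positivity) hE.norm_hamField_le z

theorem GoodPotential.isHamCurve_hamFlow (hE : GoodPotential E L) (z : Phase m) :
    IsHamCurve E z (fun s => hamFlow E s z) := by
  have h := hE.exists_isHamCurve z
  have : (fun s => hamFlow E s z) = h.choose := by
    funext s
    simp only [hamFlow, dif_pos h]
  rw [this]
  exact h.choose_spec

theorem GoodPotential.hamFlow_zero (hE : GoodPotential E L) (z : Phase m) : hamFlow E 0 z = z :=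
  (hE.isHamCurve_hamFlow z).1

theorem GoodPotential.hasDerivAt_hamFlow (hE : GoodPotential E L) (z : Phase m) (s : ℝ) :
    HasDerivAt (fun s => hamFlow E s z) (hamField E (hamFlow E s z)) s :=
  (hE.isHamCurve_hamFlow z).2 s

theorem GoodPotential.continuous_hamFlow (hE : GoodPotential E L) :
    Continuous fun p : ℝ × Phase m => hamFlow E p.1 p.2 :=
  continuous_flow (hE.contDiff_hamField.of_le (by norm_num))
    (A := ‖hamField E 0‖ + (1 + L)) (by positivity) hE.norm_hamField_le
    hE.hamFlow_zero hE.hasDerivAt_hamFlow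

theorem GoodPotential.injective_hamFlow (hE : GoodPotential E L) (s : ℝ) :
    Function.Injective (hamFlow E s) := by
  intro z w h
  have := integralCurve_unique (hE.contDiff_hamField.of_le (by norm_num))
    (A := ‖hamField E 0‖ + (1 + L)) (by positivity) hE.norm_hamField_le
    (hE.hasDerivAt_hamFlow z) (hE.hasDerivAt_hamFlow w) h
  simpa [hE.hamFlow_zero] using congrFun this 0

theorem GoodPotential.lipschitzWith_hamFlow (hE : GoodPotential E L) (s : ℝ) :
    LipschitzWith (Real.exp ((1 + L) * |s|)).toNNReal (hamFlow E s) := by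
  refine LipschitzWith.of_dist_le_mul fun z w => ?_
  have := dist_integralCurve_le (S := univ) (hE.lipschitzWith_hamField.lipschitzOnWith)
    (hE.hasDerivAt_hamFlow z) (hE.hasDerivAt_hamFlow w) (τ := |s|) (fun _ _ => mem_univ _)
    (fun _ _ => mem_univ _) (le_refl |s|)
  rw [hE.hamFlow_zero, hE.hamFlow_zero, mul_comm] at this
  simpa [Real.coe_toNNReal _ (Real.exp_pos _).le] using this

/-- The Hamiltonian flow is differentiable in the initial point, with a jointly continuous and
symplectic derivative: along the variational equation the derivative of `ω(V u, V v)` vanishes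
since `∇²E` is symmetric. -/
theorem GoodPotential.exists_fderiv_hamFlow (hE : GoodPotential E L) :
    ∃ V : ℝ → Phase m → Phase m →L[ℝ] Phase m, (Continuous fun p : ℝ × Phase m => V p.1 p.2) ∧
      (∀ s z, IsSymp (V s z)) ∧ ∀ s z, HasFDerivAt (hamFlow E s) (V s z) z := by
  obtain ⟨V, hVc, hV0, hVd, hV⟩ := exists_fderiv_flow hE.contDiff_hamField
    hE.norm_fderiv_hamField_le hE.hamFlow_zero hE.hasDerivAt_hamFlow
  refine ⟨V, hVc, fun s z u v => ?_, hV⟩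
  have hd : ∀ w s, HasDerivAt (fun s => V s z w)
      ((V s z w).2, -fderiv ℝ (gradient E) (hamFlow E s z).1 (V s z w).1) s := by
    intro w s
    have h1 := (hVd z s).clm_apply (hasDerivAt_const s w)
    simpa [hE.fderiv_hamField] using h1
  have hd1 : ∀ w s, HasDerivAt (fun s => (V s z w).1) ((V s z w).2) s := fun w s => by
    simpa using (hd w s).hasFDerivAt.fst.hasDerivAt
  have hd2 : ∀ w s, HasDerivAt (fun s => (V s z w).2)
      (-fderiv ℝ (gradient E) (hamFlow E s z).1 (V s z w).1) s := fun w s => by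
    simpa using (hd w s).hasFDerivAt.snd.hasDerivAt
  have hconst : ∀ s, HasDerivAt (fun s => symp (V s z u) (V s z v)) 0 s := by
    intro s
    have := ((hd1 u s).inner ℝ (hd2 v s)).sub ((hd2 u s).inner ℝ (hd1 v s))
    refine this.congr_deriv ?_
    rw [inner_neg_right, inner_neg_left, hE.fderiv_gradient_symm]
    ring
  have := is_const_of_deriv_eq_zero (fun s => (hconst s).differentiableAt)
    (fun s => (hconst s).deriv) s 0
  simpa [hV0] using this

theorem IsSymp.comp {F G : Phase m →L[ℝ] Phase m} (hF : IsSymp F) (hG : IsSymp G) :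
    IsSymp (F.comp G) := fun u v => by
  rw [ContinuousLinearMap.comp_apply, ContinuousLinearMap.comp_apply, hF, hG]

end HamFlow

end FGASH

/-! ### Symplectic linear maps -/

namespace FGASH

section Symplectic

variable {m : ℕ}

/-- The symplectic form as a bilinear form. -/
noncomputable def sympForm (m : ℕ) : LinearMap.BilinForm ℝ (Phase m) :=
  LinearMap.mk₂ ℝ symp
    (fun u v w => by simp only [symp, Prod.fst_add, Prod.snd_add, inner_add_left]; ring)
    (fun a u v => by
      simp only [symp, Prod.smul_fst, Prod.smul_snd, real_inner_smul_left, smul_eq_mul]; ring)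
    (fun u v w => by simp only [symp, Prod.fst_add, Prod.snd_add, inner_add_right]; ring)
    (fun a u v => by
      simp only [symp, Prod.smul_fst, Prod.smul_snd, real_inner_smul_right, smul_eq_mul]; ring)

theorem sympForm_apply (u v : Phase m) : sympForm m u v = symp u v := rfl

theorem sympForm_nondegenerate : (sympForm m).Nondegenerate := by
  refine LinearMap.BilinForm.Nondegenerate.ofSeparatingLeft fun u hu => ?_
  have h := hu (-u.2, u.1)
  simp only [sympForm_apply, symp, inner_neg_right, sub_neg_eq_add, real_inner_self_eq_norm_sq] at h
  have h1 : ‖u.1‖ ^ 2 = 0 := by nlinarith [sq_nonneg ‖u.1‖, sq_nonneg ‖u.2‖]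
  have h2 : ‖u.2‖ ^ 2 = 0 := by nlinarith [sq_nonneg ‖u.1‖, sq_nonneg ‖u.2‖]
  exact Prod.ext (by simpa using h1) (by simpa using h2)

/-- Symplectic maps preserve volume. -/
theorem IsSymp.abs_det_eq_one {F : Phase m →L[ℝ] Phase m} (hF : IsSymp F) : |F.det| = 1 := by
  set b := Module.finBasis ℝ (Phase m)
  set f : Phase m →ₗ[ℝ] Phase m := (F : Phase m →ₗ[ℝ] Phase m) with hf
  have hcomp : (sympForm m).comp f f = sympForm m :=
    LinearMap.ext fun u => LinearMap.ext fun v => hF u v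
  have h1 := LinearMap.BilinForm.toMatrix_comp b b (sympForm m) f f
  rw [hcomp] at h1
  have h2 := congrArg Matrix.det h1
  rw [Matrix.det_mul, Matrix.det_mul, Matrix.det_transpose, LinearMap.det_toMatrix] at h2
  have h3 := (LinearMap.BilinForm.nondegenerate_iff_det_ne_zero b).1
    (sympForm_nondegenerate (m := m))
  have h4 : LinearMap.det f * LinearMap.det f = 1 := by
    apply mul_left_cancel₀ h3
    linarith
  change |LinearMap.det f| = 1
  rcases mul_self_eq_one_iff.1 h4 with h | h <;> simp [h]

/-- The matrix `∂_z (Q + i P)` of a real linear map `(Q, P)` of phase space. -/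
noncomputable def complexDeriv (F : Phase m →L[ℝ] Phase m) : Matrix (Fin m) (Fin m) ℂ :=
  Matrix.of fun j k =>
    ((((F (basisVec j, 0)).1 k : ℝ) : ℂ) - Complex.I * (((F (0, basisVec j)).1 k : ℝ) : ℂ))
    + Complex.I *
      ((((F (basisVec j, 0)).2 k : ℝ) : ℂ) - Complex.I * (((F (0, basisVec j)).2 k : ℝ) : ℂ))

theorem map_eq_sum (F : Phase m →L[ℝ] Phase m) (α β : Pos m) :
    F (α, β) = ∑ j, (α j • F (basisVec j, 0) + β j • F (0, basisVec j)) := by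
  have h : ∀ α : Pos m, α = ∑ j, α j • basisVec j := fun α => by
    ext k
    simp [basisVec, Finset.sum_apply, Pi.single_apply]
  have hs : (α, β) =
      ∑ j, (α j • ((basisVec j, 0) : Phase m) + β j • ((0, basisVec j) : Phase m)) := by
    refine Prod.ext ?_ ?_
    · simpa [Prod.fst_sum] using h α
    · simpa [Prod.snd_sum] using h β
  conv_lhs => rw [hs]
  simp only [map_sum, map_add, map_smul]

theorem vecMul_complexDeriv (F : Phase m →L[ℝ] Phase m) (α β : Pos m) (k : Fin m) :
    Matrix.vecMul (fun j => ((α j : ℝ) : ℂ) + Complex.I * ((β j : ℝ) : ℂ)) (complexDeriv F) k =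
      (((F (α, β)).1 k - (F (β, -α)).2 k : ℝ) : ℂ)
        + Complex.I * (((F (β, -α)).1 k + (F (α, β)).2 k : ℝ) : ℂ) := by
  rw [map_eq_sum F α β, map_eq_sum F β (-α)]
  simp only [Matrix.vecMul, dotProduct, complexDeriv, Matrix.of_apply, Prod.fst_sum, Prod.snd_sum,
    Prod.fst_add, Prod.snd_add, Prod.smul_fst, Prod.smul_snd, WithLp.ofLp_sum, Finset.sum_apply,
    PiLp.add_apply, PiLp.smul_apply, PiLp.neg_apply, smul_eq_mul]
  push_cast
  rw [← Finset.sum_sub_distrib, ← Finset.sum_add_distrib, Finset.mul_sum, ← Finset.sum_add_distrib]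
  refine Finset.sum_congr rfl fun j _ => ?_
  linear_combination (-(α j : ℂ) * ((F (0, basisVec j)).2 k : ℂ)
    - (β j : ℂ) * ((F (0, basisVec j)).1 k : ℂ) + (β j : ℂ) * ((F (basisVec j, 0)).2 k : ℂ)
    - Complex.I * (β j : ℂ) * ((F (0, basisVec j)).2 k : ℂ)) * Complex.I_sq

/-- If `F` is symplectic then `Z Z* ≥ 2`, where `Z = ∂_z (Q + i P)`: expanding `‖w Z‖²` gives a sum
of squares and `-2 ω(F ξ, F η) = -2 ω(ξ, η) = 2 ‖w‖²`. -/
theorem IsSymp.two_mul_le_vecMul {F : Phase m →L[ℝ] Phase m} (hF : IsSymp F) (w : Fin m → ℂ) :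
    2 * ∑ j, ‖w j‖ ^ 2 ≤ ∑ k, ‖Matrix.vecMul w (complexDeriv F) k‖ ^ 2 := by
  set α : Pos m := WithLp.toLp 2 fun j => (w j).re with hα
  set β : Pos m := WithLp.toLp 2 fun j => (w j).im with hβ
  have hw : w = fun j => ((α j : ℝ) : ℂ) + Complex.I * ((β j : ℝ) : ℂ) := by
    funext j
    simp [hα, hβ, mul_comm Complex.I, Complex.re_add_im]
  have hnorm : ∀ a b : ℝ, ‖(a : ℂ) + Complex.I * (b : ℂ)‖ ^ 2 = a ^ 2 + b ^ 2 := by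
    intro a b
    rw [← Complex.normSq_eq_norm_sq, mul_comm Complex.I, Complex.normSq_add_mul_I]
  have hsymp := hF (α, β) (β, -α)
  set x := F (α, β)
  set y := F (β, -α)
  have hsum : ∀ u v : Pos m, ∑ k, u k * v k = inner ℝ u v := fun u v => by
    simp [PiLp.inner_apply, mul_comm]
  have hL : ∑ j, ‖w j‖ ^ 2 = ‖α‖ ^ 2 + ‖β‖ ^ 2 := by
    conv_lhs => rw [hw]
    simp only [hnorm, Finset.sum_add_distrib, pow_two, hsum, ← real_inner_self_eq_norm_mul_norm]
  have hR : ∑ k, ‖Matrix.vecMul w (complexDeriv F) k‖ ^ 2 =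
      ‖x.1 - y.2‖ ^ 2 + ‖y.1 + x.2‖ ^ 2 := by
    conv_lhs => rw [hw]
    simp only [vecMul_complexDeriv, hnorm]
    rw [EuclideanSpace.real_norm_sq_eq, EuclideanSpace.real_norm_sq_eq, ← Finset.sum_add_distrib]
    rfl
  rw [hL, hR, @norm_sub_sq_real, @norm_add_sq_real]
  simp only [symp, inner_neg_right, real_inner_self_eq_norm_sq] at hsymp
  rw [real_inner_comm x.2 y.1] at *
  nlinarith [sq_nonneg ‖x.1‖, sq_nonneg ‖x.2‖, sq_nonneg ‖y.1‖, sq_nonneg ‖y.2‖]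

theorem IsSymp.det_complexDeriv_ne_zero {F : Phase m →L[ℝ] Phase m} (hF : IsSymp F) :
    (complexDeriv F).det ≠ 0 := by
  intro h
  obtain ⟨w, hw0, hw⟩ := Matrix.exists_vecMul_eq_zero_iff.2 h
  have := hF.two_mul_le_vecMul w
  rw [hw] at this
  simp only [Pi.zero_apply, norm_zero, ne_eq, OfNat.ofNat_ne_zero, not_false_eq_true, zero_pow,
    Finset.sum_const_zero] at this
  apply hw0
  funext j
  have h1 : ‖w j‖ ^ 2 ≤ ∑ j, ‖w j‖ ^ 2 :=
    Finset.single_le_sum (f := fun j => ‖w j‖ ^ 2) (fun _ _ => sq_nonneg _) (Finset.mem_univ j)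
  have h2 : ‖w j‖ ^ 2 = 0 := le_antisymm (by linarith) (sq_nonneg _)
  simpa using h2

/-- Apply `Z Z* ≥ 2` to the rows of `Z⁻¹`. -/
theorem IsSymp.norm_inv_complexDeriv_le {F : Phase m →L[ℝ] Phase m} (hF : IsSymp F)
    (j k : Fin m) : ‖(complexDeriv F)⁻¹ j k‖ ≤ 1 := by
  have h := hF.two_mul_le_vecMul ((complexDeriv F)⁻¹ j)
  have h1 : Matrix.vecMul ((complexDeriv F)⁻¹ j) (complexDeriv F) =
      (1 : Matrix (Fin m) (Fin m) ℂ) j := by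
    rw [← Matrix.nonsing_inv_mul _ (isUnit_iff_ne_zero.2 hF.det_complexDeriv_ne_zero)]
    rfl
  have h2 : ∑ k, ‖(1 : Matrix (Fin m) (Fin m) ℂ) j k‖ ^ 2 = 1 := by
    rw [Finset.sum_eq_single j]
    · simp
    · intro b _ hb
      simp [Matrix.one_apply_ne hb.symm]
    · simp
  rw [h1, h2] at h
  have h3 : ‖(complexDeriv F)⁻¹ j k‖ ^ 2 ≤ ∑ k, ‖(complexDeriv F)⁻¹ j k‖ ^ 2 :=
    Finset.single_le_sum (f := fun k => ‖(complexDeriv F)⁻¹ j k‖ ^ 2) (fun _ _ => sq_nonneg _)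
      (Finset.mem_univ k)
  nlinarith [norm_nonneg ((complexDeriv F)⁻¹ j k)]

end Symplectic

end FGASH

/-! ### Hopping trajectories: regularity -/

namespace FGASH

section Traj

open Set

variable {m : ℕ} {c : Coeffs m} {L : ℝ≥0}

theorem surf_zero (l : Fin 2) : surf l 0 = l := by simp [surf]

/-- Dropping the last hopping time is continuous. -/
theorem continuous_init (n : ℕ) :
    Continuous fun T : Fin (n + 1) → ℝ => (Fin.init T : Fin n → ℝ) :=
  continuous_pi fun i => continuous_apply (Fin.castSucc i)

/-- From the data of `n + 1` hops to the data of the first `n` hops, up to the last hopping time. -/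
theorem continuous_initData (n : ℕ) :
    Continuous fun p : (Fin (n + 1) → ℝ) × ℝ × Phase m =>
      ((Fin.init p.1 : Fin n → ℝ), p.1 (Fin.last n), p.2.2) :=
  ((continuous_init n).comp continuous_fst).prodMk
    (((continuous_apply (Fin.last n)).comp continuous_fst).prodMk
      (continuous_snd.comp continuous_snd))

theorem continuous_traj (hc : ∀ k, GoodPotential (c.E k) L) (l : Fin 2) (n : ℕ) :
    Continuous fun p : (Fin n → ℝ) × ℝ × Phase m => traj c l n p.1 p.2.1 p.2.2 := by
  induction n with
  | zero =>
    exact (hc l).continuous_hamFlow.comp continuous_snd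
  | succ n ih =>
    have h1 : Continuous fun p : (Fin (n + 1) → ℝ) × ℝ × Phase m => p.2.1 - p.1 (Fin.last n) := by
      fun_prop
    exact (hc _).continuous_hamFlow.comp (h1.prodMk (ih.comp (continuous_initData n)))

theorem exists_fderiv_traj (hc : ∀ k, GoodPotential (c.E k) L) (l : Fin 2) (n : ℕ) :
    ∃ W : (Fin n → ℝ) → ℝ → Phase m → Phase m →L[ℝ] Phase m,
      (Continuous fun p : (Fin n → ℝ) × ℝ × Phase m => W p.1 p.2.1 p.2.2) ∧
      (∀ T s z, IsSymp (W T s z)) ∧ ∀ T s z, HasFDerivAt (traj c l n T s) (W T s z) z := by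
  induction n with
  | zero =>
    obtain ⟨V, hVc, hVs, hV⟩ := (hc l).exists_fderiv_hamFlow
    exact ⟨fun _ s z => V s z, hVc.comp continuous_snd, fun _ => hVs, fun _ => hV⟩
  | succ n ih =>
    obtain ⟨W, hWc, hWs, hW⟩ := ih
    obtain ⟨V, hVc, hVs, hV⟩ := (hc (surf l (n + 1))).exists_fderiv_hamFlow
    refine ⟨fun T s z => (V (s - T (Fin.last n)) (traj c l n (Fin.init T) (T (Fin.last n)) z)).comp
      (W (Fin.init T) (T (Fin.last n)) z), ?_, fun T s z => (hVs _ _).comp (hWs _ _ _),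
      fun T s z => (hV _ _).comp z (hW _ _ _)⟩
    have h1 : Continuous fun p : (Fin (n + 1) → ℝ) × ℝ × Phase m => p.2.1 - p.1 (Fin.last n) := by
      fun_prop
    exact (hVc.comp (h1.prodMk ((continuous_traj hc l n).comp (continuous_initData n)))).clm_comp
      (hWc.comp (continuous_initData n))

theorem hasFDerivAt_traj (hc : ∀ k, GoodPotential (c.E k) L) (l : Fin 2) (n : ℕ)
    (T : Fin n → ℝ) (s : ℝ) (z : Phase m) :
    HasFDerivAt (traj c l n T s) (fderiv ℝ (traj c l n T s) z) z := by
  obtain ⟨W, -, -, hW⟩ := exists_fderiv_traj hc l n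
  exact (hW T s z).differentiableAt.hasFDerivAt

theorem continuous_fderiv_traj (hc : ∀ k, GoodPotential (c.E k) L) (l : Fin 2) (n : ℕ) :
    Continuous fun p : (Fin n → ℝ) × ℝ × Phase m => fderiv ℝ (traj c l n p.1 p.2.1) p.2.2 := by
  obtain ⟨W, hWc, -, hW⟩ := exists_fderiv_traj hc l n
  exact hWc.congr fun p => (hW _ _ _).fderiv.symm

theorem isSymp_fderiv_traj (hc : ∀ k, GoodPotential (c.E k) L) (l : Fin 2) (n : ℕ)
    (T : Fin n → ℝ) (s : ℝ) (z : Phase m) : IsSymp (fderiv ℝ (traj c l n T s) z) := by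
  obtain ⟨W, -, hWs, hW⟩ := exists_fderiv_traj hc l n
  rw [(hW T s z).fderiv]
  exact hWs T s z

theorem injective_traj (hc : ∀ k, GoodPotential (c.E k) L) (l : Fin 2) (n : ℕ)
    (T : Fin n → ℝ) (s : ℝ) : Function.Injective (traj c l n T s) := by
  induction n generalizing s with
  | zero => exact (hc l).injective_hamFlow s
  | succ n ih => exact ((hc _).injective_hamFlow _).comp (ih _ _)

theorem hasDerivAt_traj (hc : ∀ k, GoodPotential (c.E k) L) (l : Fin 2) (n : ℕ)
    (T : Fin n → ℝ) (s : ℝ) (z : Phase m) :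
    HasDerivAt (fun s => traj c l n T s z) (hamField (c.E (surf l n)) (traj c l n T s z)) s := by
  cases n with
  | zero => rw [surf_zero]; exact (hc l).hasDerivAt_hamFlow z s
  | succ n =>
    exact ((hc _).hasDerivAt_hamFlow _ (s - T (Fin.last n))).comp_sub_const s (T (Fin.last n))

theorem traj_zero (hc : ∀ k, GoodPotential (c.E k) L) (l : Fin 2) (T : Fin 0 → ℝ) (z : Phase m) :
    traj c l 0 T 0 z = z := (hc l).hamFlow_zero z

theorem traj_succ_last (hc : ∀ k, GoodPotential (c.E k) L) (l : Fin 2) (n : ℕ)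
    (T : Fin (n + 1) → ℝ) (z : Phase m) :
    traj c l (n + 1) T (T (Fin.last n)) z = traj c l n (Fin.init T) (T (Fin.last n)) z := by
  simp only [traj, sub_self]
  exact (hc _).hamFlow_zero _

/-- An integral over a moving interval of a jointly continuous integrand is continuous. -/
theorem continuous_intervalIntegral_moving {Y F : Type*} [TopologicalSpace Y]
    [NormedAddCommGroup F] [NormedSpace ℝ F] {f : Y → ℝ → F}
    (hf : Continuous (Function.uncurry f)) {a b : Y → ℝ} (ha : Continuous a) (hb : Continuous b) :
    Continuous fun y => ∫ r in a y..b y, f y r := by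
  have h : ∀ y, ∫ r in a y..b y, f y r =
      (∫ r in (0 : ℝ)..b y, f y r) - ∫ r in (0 : ℝ)..a y, f y r := by
    intro y
    have hfy : Continuous (f y) := hf.comp (Continuous.prodMk_right y)
    exact (intervalIntegral.integral_interval_sub_left (hfy.intervalIntegrable _ _)
      (hfy.intervalIntegrable _ _)).symm
  simp only [h]
  exact (intervalIntegral.continuous_parametric_intervalIntegral_of_continuous hf hb).sub
    (intervalIntegral.continuous_parametric_intervalIntegral_of_continuous hf ha)

/-- The data at an intermediate time `r`. -/
theorem continuous_atTime (n : ℕ) :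
    Continuous fun p : ((Fin n → ℝ) × ℝ × Phase m) × ℝ => (p.1.1, p.2, p.1.2.2) := by
  fun_prop

theorem continuous_lagrangian (hc : ∀ k, GoodPotential (c.E k) L) (l : Fin 2) (n : ℕ) :
    Continuous fun p : (Fin n → ℝ) × ℝ × Phase m => lagrangian c l n p.1 p.2.1 p.2.2 := by
  have h := continuous_traj hc l n
  have hE := (hc (surf l n)).smooth.continuous
  unfold lagrangian
  exact (((continuous_snd.comp h).norm.pow 2).div_const 2).sub (hE.comp (continuous_fst.comp h))

theorem continuous_lagrangian_atTime (hc : ∀ k, GoodPotential (c.E k) L) (l : Fin 2) (n : ℕ) :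
    Continuous (Function.uncurry fun (p : (Fin n → ℝ) × ℝ × Phase m) (r : ℝ) =>
      lagrangian c l n p.1 r p.2.2) := by
  have h := (continuous_lagrangian hc l n).comp (continuous_atTime (m := m) n)
  exact h

theorem continuous_action (hc : ∀ k, GoodPotential (c.E k) L) (l : Fin 2) (n : ℕ) :
    Continuous fun p : (Fin n → ℝ) × ℝ × Phase m => action c l n p.1 p.2.1 p.2.2 := by
  induction n with
  | zero =>
    simp only [action]
    exact continuous_intervalIntegral_moving (continuous_lagrangian_atTime hc l 0)
      continuous_const
      (continuous_fst.comp continuous_snd)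
  | succ n ih =>
    simp only [action]
    refine Continuous.add (ih.comp (continuous_initData n)) ?_
    exact continuous_intervalIntegral_moving (continuous_lagrangian_atTime hc l (n + 1))
      ((continuous_apply (Fin.last n)).comp continuous_fst) (continuous_fst.comp continuous_snd)

theorem Zmat_eq (l : Fin 2) (n : ℕ) (T : Fin n → ℝ) (s : ℝ) (z : Phase m) :
    Zmat c l n T s z = complexDeriv (fderiv ℝ (traj c l n T s) z) := by
  ext j k
  simp [Zmat, dzQ, dzP, complexDeriv]

theorem continuous_entry_fst (k : Fin m) : Continuous fun z : Phase m => ((z.1 k : ℝ) : ℂ) := by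
  fun_prop

theorem continuous_entry_snd (k : Fin m) : Continuous fun z : Phase m => ((z.2 k : ℝ) : ℂ) := by
  fun_prop

theorem continuous_dzQ (hc : ∀ k, GoodPotential (c.E k) L) (l : Fin 2) (n : ℕ) :
    Continuous fun p : (Fin n → ℝ) × ℝ × Phase m => dzQ c l n p.1 p.2.1 p.2.2 := by
  have h := continuous_fderiv_traj hc l n
  refine continuous_matrix fun j k => ?_
  exact ((continuous_entry_fst k).comp (h.clm_apply continuous_const)).sub
    (continuous_const.mul ((continuous_entry_fst k).comp (h.clm_apply continuous_const)))

theorem continuous_dzP (hc : ∀ k, GoodPotential (c.E k) L) (l : Fin 2) (n : ℕ) :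
    Continuous fun p : (Fin n → ℝ) × ℝ × Phase m => dzP c l n p.1 p.2.1 p.2.2 := by
  have h := continuous_fderiv_traj hc l n
  refine continuous_matrix fun j k => ?_
  exact ((continuous_entry_snd k).comp (h.clm_apply continuous_const)).sub
    (continuous_const.mul ((continuous_entry_snd k).comp (h.clm_apply continuous_const)))

theorem continuous_Zmat_inv (hc : ∀ k, GoodPotential (c.E k) L) (l : Fin 2) (n : ℕ) :
    Continuous fun p : (Fin n → ℝ) × ℝ × Phase m => (Zmat c l n p.1 p.2.1 p.2.2)⁻¹ := by
  have h : Continuous fun p : (Fin n → ℝ) × ℝ × Phase m => Zmat c l n p.1 p.2.1 p.2.2 := by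
    have h1 := continuous_dzQ hc l n
    have h2 := continuous_dzP hc l n
    unfold Zmat
    exact h1.add (h2.const_smul Complex.I)
  rw [continuous_iff_continuousAt]
  intro p
  have hdet : (Zmat c l n p.1 p.2.1 p.2.2).det ≠ 0 := by
    rw [Zmat_eq]
    exact (isSymp_fderiv_traj hc l n p.1 p.2.1 p.2.2).det_complexDeriv_ne_zero
  refine ContinuousAt.comp (g := fun A : Matrix (Fin m) (Fin m) ℂ => A⁻¹)
    (continuousAt_matrix_inv _ ?_) h.continuousAt
  rw [Ring.inverse_eq_inv']
  exact continuousAt_inv₀ hdet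

theorem GoodPotential.continuous_hess {E : Pos m → ℝ} (hE : GoodPotential E L) :
    Continuous (hess E) := by
  refine continuous_matrix fun j k => ?_
  have h : Continuous fun q => iteratedFDeriv ℝ 2 E q :=
    hE.smooth.continuous_iteratedFDeriv ENat.LEInfty.out
  exact Complex.continuous_ofReal.comp (h.eval_const ![basisVec j, basisVec k])

theorem continuous_cdot : Continuous fun p : EuclideanSpace ℂ (Fin m) × Pos m => cdot p.1 p.2 := by
  unfold cdot
  fun_prop

theorem continuous_ampRate (hc : ∀ k, GoodPotential (c.E k) L)
    (hd : ∀ k l, Continuous (c.d k l)) (l : Fin 2) (n : ℕ) :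
    Continuous fun p : (Fin n → ℝ) × ℝ × Phase m => ampRate c l n p.1 p.2.1 p.2.2 := by
  have h0 := continuous_traj hc l n
  have h1 := continuous_dzQ hc l n
  have h2 := continuous_dzP hc l n
  have h3 := continuous_Zmat_inv hc l n
  have h4 := (hc (surf l n)).continuous_hess.comp (continuous_fst.comp h0)
  have h5 := (hd (surf l n) (surf l n)).comp (continuous_fst.comp h0)
  unfold ampRate
  refine (continuous_const.mul (Continuous.matrix_trace ?_)).sub
    (continuous_cdot.comp (h5.prodMk (continuous_snd.comp h0)))
  exact h3.matrix_mul (h2.sub ((h1.matrix_mul h4).const_smul Complex.I))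

theorem continuous_ampRate_atTime (hc : ∀ k, GoodPotential (c.E k) L)
    (hd : ∀ k l, Continuous (c.d k l)) (l : Fin 2) (n : ℕ) :
    Continuous (Function.uncurry fun (p : (Fin n → ℝ) × ℝ × Phase m) (r : ℝ) =>
      ampRate c l n p.1 r p.2.2) := by
  have h := (continuous_ampRate hc hd l n).comp (continuous_atTime (m := m) n)
  exact h

theorem continuous_amp (hc : ∀ k, GoodPotential (c.E k) L)
    (hd : ∀ k l, Continuous (c.d k l)) (l : Fin 2) (n : ℕ) :
    Continuous fun p : (Fin n → ℝ) × ℝ × Phase m => amp c l n p.1 p.2.1 p.2.2 := by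
  induction n with
  | zero =>
    simp only [amp]
    refine Continuous.mul continuous_const (Complex.continuous_exp.comp ?_)
    exact continuous_intervalIntegral_moving (continuous_ampRate_atTime hc hd l 0)
      continuous_const
      (continuous_fst.comp continuous_snd)
  | succ n ih =>
    simp only [amp]
    refine Continuous.mul (ih.comp (continuous_initData n)) (Complex.continuous_exp.comp ?_)
    exact continuous_intervalIntegral_moving (continuous_ampRate_atTime hc hd l (n + 1))
      ((continuous_apply (Fin.last n)).comp continuous_fst) (continuous_fst.comp continuous_snd)

theorem continuous_hopCoeff (hc : ∀ k, GoodPotential (c.E k) L)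
    (hd : ∀ k l, Continuous (c.d k l)) (l : Fin 2) (n : ℕ) :
    Continuous fun p : (Fin (n + 1) → ℝ) × Phase m => hopCoeff c l n p.1 p.2 := by
  have h1 : Continuous fun p : (Fin (n + 1) → ℝ) × Phase m => (p.1, p.1 (Fin.last n), p.2) := by
    fun_prop
  have h0 := (continuous_traj hc l (n + 1)).comp h1
  unfold hopCoeff
  exact (continuous_cdot.comp (((hd _ _).comp (continuous_fst.comp h0)).prodMk
    (continuous_snd.comp h0))).neg

theorem continuous_hopProd (hc : ∀ k, GoodPotential (c.E k) L)
    (hd : ∀ k l, Continuous (c.d k l)) (l : Fin 2) (n : ℕ) :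
    Continuous fun p : (Fin n → ℝ) × Phase m => hopProd c l n p.1 p.2 := by
  have h : ∀ k : Fin n, Continuous fun p : (Fin n → ℝ) × Phase m =>
      hopCoeff c l k (fun i => p.1 (Fin.castLE k.2 i)) p.2 := by
    intro k
    have h1 : Continuous fun p : (Fin n → ℝ) × Phase m =>
        ((fun i : Fin (k + 1) => p.1 (Fin.castLE k.2 i)), p.2) := by
      fun_prop
    have h2 := (continuous_hopCoeff hc hd l (k : ℕ)).comp h1
    exact h2
  unfold hopProd
  exact continuous_finsetProd _ fun k _ => h k

end Traj

end FGASH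

/-! ### Hopping trajectories: bounds uniform in the hopping times -/

namespace FGASH

section Bounds

open Set

variable {m : ℕ} {c : Coeffs m} {L B R : ℝ≥0} {K : Set (Phase m)} {t : ℝ}

/-- The quantitative form of the assumptions for a single value of `δ`: `L` bounds the Hessians
everywhere, `B` bounds the forces and the first order couplings on the visited region, and `R`
bounds the initial momenta. -/
structure Controlled (c : Coeffs m) (K : Set (Phase m)) (t : ℝ) (L B R : ℝ≥0) : Prop where
  good : ∀ k, GoodPotential (c.E k) L
  continuous_d : ∀ k l, Continuous (c.d k l)
  force : ∀ w ∈ visited c K t, ∀ k, ‖gradient (c.E k) w.1‖ ≤ B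
  coupling : ∀ w ∈ visited c K t, ∀ k l, ‖c.d k l w.1‖ ≤ B
  momentum : ∀ z ∈ K, ‖z.2‖ ≤ R

theorem hopSimplex_zero (T : Fin 0 → ℝ) (s : ℝ) : T ∈ hopSimplex 0 s :=
  ⟨fun i _ _ => i.elim0, fun i => i.elim0⟩

theorem hopSimplex_mono {n : ℕ} {T : Fin n → ℝ} {s s' : ℝ} (hT : T ∈ hopSimplex n s)
    (h : s ≤ s') : T ∈ hopSimplex n s' :=
  ⟨hT.1, fun i => ⟨(hT.2 i).1, (hT.2 i).2.trans h⟩⟩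

theorem mem_hopSimplex_last {n : ℕ} {T : Fin (n + 1) → ℝ} {s : ℝ} (hT : T ∈ hopSimplex (n + 1) s) :
    T ∈ hopSimplex (n + 1) (T (Fin.last n)) :=
  ⟨hT.1, fun i => ⟨(hT.2 i).1, hT.1 (Fin.le_last i)⟩⟩

theorem init_mem_hopSimplex {n : ℕ} {T : Fin (n + 1) → ℝ} {s : ℝ}
    (hT : T ∈ hopSimplex (n + 1) s) : (Fin.init T : Fin n → ℝ) ∈ hopSimplex n (T (Fin.last n)) :=
  ⟨fun _ _ h => hT.1 (Fin.castSucc_le_castSucc_iff.2 h),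
    fun _ => ⟨(hT.2 _).1, hT.1 (Fin.le_last _)⟩⟩

theorem traj_mem_visited {l : Fin 2} {n : ℕ} {T : Fin n → ℝ} {s : ℝ} {z : Phase m} (hs : 0 ≤ s)
    (hst : s ≤ t) (hT : T ∈ hopSimplex n s) (hz : z ∈ K) : traj c l n T s z ∈ visited c K t :=
  ⟨l, n, s, T, z, hs, hst, hT, hz, rfl⟩

/-- The time of the last hop (or the initial time if there are none). -/
def lastTime : (n : ℕ) → (Fin n → ℝ) → ℝ
  | 0, _ => 0
  | n + 1, T => T (Fin.last n)

theorem lastTime_nonneg {n : ℕ} {T : Fin n → ℝ} {s : ℝ} (hT : T ∈ hopSimplex n s) :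
    0 ≤ lastTime n T := by
  cases n with
  | zero => exact le_rfl
  | succ n => exact (hT.2 _).1

theorem lastTime_le {n : ℕ} {T : Fin n → ℝ} {s : ℝ} (hs : 0 ≤ s) (hT : T ∈ hopSimplex n s) :
    lastTime n T ≤ s := by
  cases n with
  | zero => exact hs
  | succ n => exact (hT.2 _).2

theorem mem_hopSimplex_of_lastTime_le {n : ℕ} {T : Fin n → ℝ} {s r : ℝ}
    (hT : T ∈ hopSimplex n s) (hr : lastTime n T ≤ r) : T ∈ hopSimplex n r := by
  cases n with
  | zero => exact hopSimplex_zero T r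
  | succ n => exact hopSimplex_mono (mem_hopSimplex_last hT) hr

/-- After the last hop the momentum varies at most linearly, since the force is bounded along
trajectories. -/
theorem Controlled.norm_momentum_sub_le (hc : Controlled c K t L B R) (l : Fin 2) (n : ℕ)
    (T : Fin n → ℝ) {s : ℝ} {z : Phase m} (hs : 0 ≤ s) (hst : s ≤ t) (hT : T ∈ hopSimplex n s)
    (hz : z ∈ K) : ‖(traj c l n T s z).2 - (traj c l n T (lastTime n T) z).2‖ ≤
      B * (s - lastTime n T) := by
  refine norm_image_sub_le_of_norm_deriv_le_segment' (f := fun r => (traj c l n T r z).2)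
    (f' := fun r => -gradient (c.E (surf l n)) (traj c l n T r z).1) (a := lastTime n T) (b := s)
    (fun r _ => ?_) (fun r hr => ?_) s ⟨lastTime_le hs hT, le_rfl⟩
  · have := (hasDerivAt_traj hc.good l n T r z).hasFDerivAt.snd.hasDerivAt
    exact HasDerivAt.hasDerivWithinAt (by simpa [hamField] using this)
  · rw [norm_neg]
    exact hc.force _ (traj_mem_visited ((lastTime_nonneg hT).trans hr.1) (hr.2.le.trans hst)
      (mem_hopSimplex_of_lastTime_le hT hr.1) hz) _

theorem Controlled.norm_momentum_le (hc : Controlled c K t L B R) (l : Fin 2) (n : ℕ)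
    (T : Fin n → ℝ) {s : ℝ} {z : Phase m} (hs : 0 ≤ s) (hst : s ≤ t) (hT : T ∈ hopSimplex n s)
    (hz : z ∈ K) : ‖(traj c l n T s z).2‖ ≤ R + B * s := by
  have step := hc.norm_momentum_sub_le l n T hs hst hT hz
  induction n generalizing s with
  | zero =>
    simp only [lastTime, traj_zero hc.good, sub_zero] at step
    linarith [norm_le_norm_add_norm_sub' (traj c l 0 T s z).2 z.2, hc.momentum z hz]
  | succ n ih =>
    have h1 := (hT.2 (Fin.last n)).2
    have h0 := (hT.2 (Fin.last n)).1
    have hT' := init_mem_hopSimplex hT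
    simp only [lastTime, traj_succ_last hc.good] at step
    have h2 := ih (Fin.init T) h0 (h1.trans hst) hT'
      (hc.norm_momentum_sub_le l n (Fin.init T) h0 (h1.trans hst) hT' hz)
    linarith [norm_le_norm_add_norm_sub' (traj c l (n + 1) T s z).2
      (traj c l n (Fin.init T) (T (Fin.last n)) z).2]

/-- For ordered hopping times the trajectory is Lipschitz in its initial point, with a constant
that depends on the final time only. -/
theorem lipschitzWith_traj (hc : ∀ k, GoodPotential (c.E k) L) (l : Fin 2) (n : ℕ)
    (T : Fin n → ℝ) {s : ℝ} (hs : 0 ≤ s) (hT : T ∈ hopSimplex n s) :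
    LipschitzWith (Real.exp ((1 + L) * s)).toNNReal (traj c l n T s) := by
  induction n generalizing s with
  | zero =>
    have := (hc l).lipschitzWith_hamFlow s
    rwa [abs_of_nonneg hs] at this
  | succ n ih =>
    have h1 := (hT.2 (Fin.last n)).2
    have h0 := (hT.2 (Fin.last n)).1
    have := ((hc (surf l (n + 1))).lipschitzWith_hamFlow (s - T (Fin.last n))).comp
      (ih (Fin.init T) h0 (init_mem_hopSimplex hT))
    rw [abs_of_nonneg (sub_nonneg.2 h1), ← Real.toNNReal_mul (Real.exp_pos _).le,
      ← Real.exp_add] at this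
    convert! this using 3
    ring

theorem norm_fderiv_traj_le (hc : ∀ k, GoodPotential (c.E k) L) (l : Fin 2) (n : ℕ)
    (T : Fin n → ℝ) {s : ℝ} (hs : 0 ≤ s) (hst : s ≤ t) (hT : T ∈ hopSimplex n s) (z : Phase m) :
    ‖fderiv ℝ (traj c l n T s) z‖ ≤ Real.exp ((1 + L) * t) := by
  have := norm_fderiv_le_of_lipschitz ℝ (x₀ := z) (lipschitzWith_traj hc l n T hs hT)
  rw [Real.coe_toNNReal _ (Real.exp_pos _).le] at this
  exact this.trans (by gcongr)

theorem norm_basisVec (j : Fin m) : ‖basisVec j‖ = 1 := by simp [basisVec]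

theorem norm_dz_entry_le {F : Phase m →L[ℝ] Phase m} {Λ : ℝ} (hF : ‖F‖ ≤ Λ) (π : Phase m → ℝ)
    (hπ : ∀ w, |π w| ≤ ‖w‖) (j : Fin m) :
    ‖((π (F (basisVec j, 0)) : ℝ) : ℂ) - Complex.I * ((π (F (0, basisVec j)) : ℝ) : ℂ)‖
      ≤ 2 * Λ := by
  have h : ∀ w : Phase m, ‖w‖ = 1 → |π (F w)| ≤ Λ := fun w hw =>
    (hπ _).trans (by simpa [hw] using F.le_of_opNorm_le hF w)
  refine (norm_sub_le _ _).trans ?_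
  rw [norm_mul, Complex.norm_I, one_mul, Complex.norm_real, Complex.norm_real, two_mul]
  exact add_le_add (h _ (by simp [Prod.norm_def, norm_basisVec]))
    (h _ (by simp [Prod.norm_def, norm_basisVec]))

theorem GoodPotential.norm_hess_le {E : Pos m → ℝ} (hE : GoodPotential E L) (q : Pos m)
    (j k : Fin m) : ‖hess E q j k‖ ≤ L := by
  simp only [hess, Matrix.of_apply, Complex.norm_real]
  refine ((iteratedFDeriv ℝ 2 E q).le_opNorm _).trans ?_
  simpa [Fin.prod_univ_two, norm_basisVec] using hE.bound q

theorem norm_cdot_le (v : EuclideanSpace ℂ (Fin m)) (p : Pos m) :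
    ‖cdot v p‖ ≤ m * (‖v‖ * ‖p‖) := by
  refine (norm_sum_le _ _).trans ?_
  refine (Finset.sum_le_card_nsmul _ _ (‖v‖ * ‖p‖) fun j _ => ?_).trans (by simp)
  rw [norm_mul, Complex.norm_real]
  gcongr
  · exact PiLp.norm_apply_le v j
  · exact PiLp.norm_apply_le p j

/-- A bound for the logarithmic derivative of the amplitude. -/
noncomputable def ampBound (m : ℕ) (t : ℝ) (L B R : ℝ≥0) : ℝ :=
  1 / 2 * (m * (m * (2 * Real.exp ((1 + L) * t) + m * (2 * Real.exp ((1 + L) * t) * L))))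
    + m * (B * (R + B * t))

/-- A bound for the hopping coefficients. -/
noncomputable def hopBound (m : ℕ) (t : ℝ) (B R : ℝ≥0) : ℝ := m * (B * (R + B * t))

theorem norm_trace_mul_le (M N : Matrix (Fin m) (Fin m) ℂ) {b : ℝ} (hM : ∀ j k, ‖M j k‖ ≤ 1)
    (hN : ∀ j k, ‖N j k‖ ≤ b) : ‖Matrix.trace (M * N)‖ ≤ m * (m * b) := by
  simp only [Matrix.trace, Matrix.diag_apply, Matrix.mul_apply]
  refine (norm_sum_le _ _).trans ?_
  refine (Finset.sum_le_card_nsmul _ _ (m * b) fun j _ => ?_).trans (by simp)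
  refine (norm_sum_le _ _).trans ?_
  refine (Finset.sum_le_card_nsmul _ _ b fun k _ => ?_).trans (by simp)
  rw [norm_mul]
  calc ‖M j k‖ * ‖N k j‖ ≤ 1 * ‖N k j‖ := by gcongr; exact hM j k
    _ ≤ b := by rw [one_mul]; exact hN k j

theorem Controlled.norm_ampRate_le (hc : Controlled c K t L B R) (l : Fin 2) (n : ℕ)
    (T : Fin n → ℝ) {s : ℝ} {z : Phase m} (hs : 0 ≤ s) (hst : s ≤ t) (hT : T ∈ hopSimplex n s)
    (hz : z ∈ K) : ‖ampRate c l n T s z‖ ≤ ampBound m t L B R := by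
  set Λ := Real.exp ((1 + L) * t) with hΛ
  have hF := norm_fderiv_traj_le hc.good l n T hs hst hT z
  have hQ : ∀ j k, ‖dzQ c l n T s z j k‖ ≤ 2 * Λ := fun j k =>
    norm_dz_entry_le hF (fun w => w.1 k)
      (fun w => (PiLp.norm_apply_le w.1 k).trans (norm_fst_le w)) j
  have hP : ∀ j k, ‖dzP c l n T s z j k‖ ≤ 2 * Λ := fun j k =>
    norm_dz_entry_le hF (fun w => w.2 k)
      (fun w => (PiLp.norm_apply_le w.2 k).trans (norm_snd_le w)) j
  have hH := (hc.good (surf l n)).norm_hess_le (traj c l n T s z).1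
  unfold ampRate ampBound
  refine (norm_sub_le _ _).trans (add_le_add ?_ ?_)
  · rw [norm_mul]
    have : ‖(1 / 2 : ℂ)‖ = 1 / 2 := by norm_num
    rw [this]
    gcongr
    refine norm_trace_mul_le _ _ (fun j k => ?_) (fun j k => ?_)
    · rw [Zmat_eq]
      exact (isSymp_fderiv_traj hc.good l n T s z).norm_inv_complexDeriv_le j k
    · rw [Matrix.sub_apply, Matrix.smul_apply, Matrix.mul_apply]
      refine (norm_sub_le _ _).trans (add_le_add (hP j k) ?_)
      rw [smul_eq_mul, norm_mul, Complex.norm_I, one_mul]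
      refine (norm_sum_le _ _).trans ?_
      refine (Finset.sum_le_card_nsmul _ _ (2 * Λ * L) fun i _ => ?_).trans (by simp [hΛ])
      rw [norm_mul]
      exact mul_le_mul (hQ j i) (hH i k) (norm_nonneg _) (by positivity)
  · refine (norm_cdot_le _ _).trans ?_
    have ht : (0 : ℝ) ≤ R + B * t := by have := hs.trans hst; positivity
    gcongr
    · exact hc.coupling _ (traj_mem_visited hs hst hT hz) _ _
    · exact (hc.norm_momentum_le l n T hs hst hT hz).trans (by gcongr)

/-- Between two hops the amplitude changes at most by an exponential factor. -/
theorem norm_exp_integral_le {f : ℝ → ℂ} {a b A : ℝ} (hab : a ≤ b)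
    (h : ∀ r, a ≤ r → r ≤ b → ‖f r‖ ≤ A) :
    ‖Complex.exp (∫ r in a..b, f r)‖ ≤ Real.exp (A * (b - a)) := by
  refine (Complex.norm_exp_le_exp_norm _).trans (Real.exp_le_exp.2 ?_)
  have := intervalIntegral.norm_integral_le_of_norm_le_const (a := a) (b := b) (f := f) (C := A)
    (fun r hr => by rw [uIoc_of_le hab] at hr; exact h r hr.1.le hr.2)
  rwa [abs_of_nonneg (sub_nonneg.2 hab)] at this

theorem Controlled.norm_amp_le (hc : Controlled c K t L B R) (l : Fin 2) (n : ℕ)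
    (T : Fin n → ℝ) {s : ℝ} {z : Phase m} (hs : 0 ≤ s) (hst : s ≤ t) (hT : T ∈ hopSimplex n s)
    (hz : z ∈ K) :
    ‖amp c l n T s z‖ ≤ 2 ^ ((m : ℝ) / 2) * Real.exp (ampBound m t L B R * s) := by
  induction n generalizing s with
  | zero =>
    simp only [amp]
    rw [norm_mul, Complex.norm_real, Real.norm_of_nonneg (by positivity)]
    gcongr
    have := norm_exp_integral_le hs (fun r hr0 hrs => hc.norm_ampRate_le l 0 T hr0
      (hrs.trans hst) (hopSimplex_zero T r) hz)
    rwa [sub_zero] at this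
  | succ n ih =>
    have h1 := (hT.2 (Fin.last n)).2
    have h0 := (hT.2 (Fin.last n)).1
    have h2 := ih (Fin.init T) h0 (h1.trans hst) (init_mem_hopSimplex hT)
    have h3 := norm_exp_integral_le h1 (fun r hr0 hrs => hc.norm_ampRate_le l (n + 1) T
      (h0.trans hr0) (hrs.trans hst) (hopSimplex_mono (mem_hopSimplex_last hT) hr0) hz)
    simp only [amp]
    rw [norm_mul]
    refine (mul_le_mul h2 h3 (norm_nonneg _) (by positivity)).trans (le_of_eq ?_)
    rw [mul_assoc, ← Real.exp_add]
    ring_nf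

theorem Controlled.norm_hopCoeff_le (hc : Controlled c K t L B R) (l : Fin 2) (n : ℕ)
    {T : Fin (n + 1) → ℝ} {z : Phase m} (hT : T ∈ hopSimplex (n + 1) t) (hz : z ∈ K) :
    ‖hopCoeff c l n T z‖ ≤ hopBound m t B R := by
  have h1 := (hT.2 (Fin.last n)).2
  have h0 := (hT.2 (Fin.last n)).1
  have ht := h0.trans h1
  have hT' := mem_hopSimplex_last hT
  unfold hopCoeff hopBound
  rw [norm_neg]
  refine (norm_cdot_le _ _).trans ?_
  gcongr
  · exact hc.coupling _ (traj_mem_visited h0 h1 hT' hz) _ _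
  · exact (hc.norm_momentum_le l (n + 1) T h0 h1 hT' hz).trans (by gcongr)

theorem Controlled.norm_hopProd_le (hc : Controlled c K t L B R) (l : Fin 2) (n : ℕ)
    {T : Fin n → ℝ} {z : Phase m} (hT : T ∈ hopSimplex n t) (hz : z ∈ K) :
    ‖hopProd c l n T z‖ ≤ hopBound m t B R ^ n := by
  unfold hopProd
  rw [norm_prod]
  refine (Finset.prod_le_prod (fun _ _ => norm_nonneg _)
    (g := fun _ => hopBound m t B R) fun k _ => ?_).trans (by simp)
  exact hc.norm_hopCoeff_le l k ⟨fun i j hij => hT.1 (by simpa using hij), fun i => hT.2 _⟩ hz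

end Bounds

end FGASH

/-! ### The windowed Fourier transform -/

namespace FGASH

section Plancherel

open scoped FourierTransform SchwartzMap

variable {V : Type*} [NormedAddCommGroup V] [InnerProductSpace ℝ V] [FiniteDimensional ℝ V]
  [MeasurableSpace V] [BorelSpace V]

theorem eLpNorm_two_sq {α F : Type*} [MeasurableSpace α] {μ : Measure α} [NormedAddCommGroup F]
    (f : α → F) : eLpNorm f 2 μ ^ 2 = ∫⁻ x, ‖f x‖ₑ ^ 2 ∂μ := by
  have := eLpNorm_nnreal_pow_eq_lintegral (f := f) (μ := μ) (p := 2) two_ne_zero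
  simpa using this

/-- Cauchy–Schwarz for lower integrals. -/
theorem lintegral_mul_le_sqrt {α : Type*} [MeasurableSpace α] {μ : Measure α} {f g : α → ℝ≥0∞}
    (hf : AEMeasurable f μ) (hg : AEMeasurable g μ) {a b : ℝ≥0∞} (ha : ∫⁻ x, f x ^ 2 ∂μ ≤ a ^ 2)
    (hb : ∫⁻ x, g x ^ 2 ∂μ ≤ b ^ 2) : ∫⁻ x, f x * g x ∂μ ≤ a * b := by
  have h := ENNReal.lintegral_mul_le_Lp_mul_Lq μ Real.HolderConjugate.two_two hf hg
  have key : ∀ {I c : ℝ≥0∞}, I ≤ c ^ 2 → I ^ (1 / (2 : ℝ)) ≤ c := by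
    intro I c hI
    calc I ^ (1 / (2 : ℝ)) ≤ (c ^ 2) ^ (1 / (2 : ℝ)) := by gcongr
      _ = c := by
        rw [← ENNReal.rpow_natCast, ← ENNReal.rpow_mul]
        norm_num
  refine h.trans (mul_le_mul' (key ?_) (key ?_))
  · simpa using ha
  · simpa using hb

/-- Plancherel's identity on `L¹ ∩ L²`: the Fourier integral of `f` and the Fourier transform of
its `L²` class define the same tempered distribution. -/
theorem eLpNorm_fourier_eq {f : V → ℂ} (hf1 : Integrable f) (hf2 : MemLp f 2) :
    eLpNorm (𝓕 f) 2 (volume : Measure V) = eLpNorm f 2 (volume : Measure V) := by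
  set F₂ : Lp (α := V) ℂ 2 volume := 𝓕 (hf2.toLp f) with hF₂
  have hcont : Continuous (𝓕 f) :=
    VectorFourier.fourierIntegral_continuous Real.continuous_fourierChar
      (L := innerₗ V) continuous_inner hf1
  have hae : 𝓕 f =ᵐ[volume] F₂ := by
    refine ae_eq_of_integral_contDiff_smul_eq hcont.locallyIntegrable
      ((Lp.memLp F₂).locallyIntegrable (by norm_num)) fun g hg hgc => ?_
    have hg₁ : HasCompactSupport (Complex.ofRealCLM ∘ g) := hgc.comp_left rfl
    have hg₂ : ContDiff ℝ ∞ (Complex.ofRealCLM ∘ g) := by fun_prop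
    set Ψ : 𝓢(V, ℂ) := hg₁.toSchwartzMap hg₂ with hΨ
    have hΨg : ∀ x, Ψ x = (g x : ℂ) := fun x => by simp [hΨ]
    have h1 := congrArg (fun D => D Ψ) (Lp.fourier_toTemperedDistribution_eq (hf2.toLp f))
    simp only [TemperedDistribution.fourier_apply, Lp.toTemperedDistribution_apply] at h1
    have h2 : ∫ x, (𝓕 Ψ) x • (hf2.toLp f) x = ∫ x, f x • 𝓕 (Ψ : V → ℂ) x := by
      refine integral_congr_ae ?_
      filter_upwards [hf2.coeFn_toLp] with x hx
      rw [hx, smul_eq_mul, smul_eq_mul, mul_comm, SchwartzMap.fourier_coe]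
    have h3 : ∫ x, 𝓕 f x • Ψ x = ∫ x, f x • 𝓕 (Ψ : V → ℂ) x := by
      simpa using! (VectorFourier.integral_fourierIntegral_smul_eq_flip (L := innerₗ V)
        Real.continuous_fourierChar continuous_inner hf1 Ψ.integrable)
    rw [h2, ← h3] at h1
    calc ∫ x, g x • 𝓕 f x = ∫ x, 𝓕 f x • Ψ x := by
          refine integral_congr_ae (Filter.Eventually.of_forall fun x => ?_)
          simp only [hΨg, smul_eq_mul, Complex.real_smul]
          ring
      _ = ∫ x, Ψ x • F₂ x := h1
      _ = ∫ x, g x • F₂ x := by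
          refine integral_congr_ae (Filter.Eventually.of_forall fun x => ?_)
          simp only [hΨg, smul_eq_mul, Complex.real_smul]
  rw [eLpNorm_congr_ae hae, ← Lp.enorm_def, hF₂]
  have h4 : ‖(𝓕 (hf2.toLp f) : Lp (α := V) ℂ 2 volume)‖ₑ = ‖hf2.toLp f‖ₑ := by
    rw [← ofReal_norm, ← ofReal_norm, Lp.norm_fourier_eq]
  rw [h4, Lp.enorm_def, eLpNorm_congr_ae hf2.coeFn_toLp]

end Plancherel

section Window

open scoped FourierTransform

variable {m : ℕ}

/-- The windowed Fourier transform
`(q, p) ↦ ∫ f(y) G(y - q) exp(-(i/ε) p·(y - q)) dy` with the real window `G`. For the Gaussian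
window it is the FBI transform. -/
noncomputable def windowed (ε : ℝ) (G : Pos m → ℝ) (f : Pos m → ℂ) (z : Phase m) : ℂ :=
  ∫ y : Pos m, f y * ((G (y - z.1) : ℂ) *
    Complex.exp (-(Complex.I / ε * ((inner ℝ z.2 (y - z.1) : ℝ) : ℂ))))

/-- The class of windows used: continuous, bounded and square integrable. -/
structure IsWindow (G : Pos m → ℝ) : Prop where
  continuous : Continuous G
  bounded : ∃ b, ∀ y, |G y| ≤ b
  memLp : MemLp G 2

variable {ε : ℝ} {G : Pos m → ℝ} {f g : Pos m → ℂ}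

theorem norm_exp_phase (a b : ℝ) : ‖Complex.exp (-(Complex.I / a * (b : ℂ)))‖ = 1 := by
  have : -(Complex.I / a * (b : ℂ)) = ((-(b / a) : ℝ) : ℂ) * Complex.I := by
    push_cast; ring
  rw [this, Complex.norm_exp_ofReal_mul_I]

theorem windowed_congr (h : f =ᵐ[volume] g) (z : Phase m) :
    windowed ε G f z = windowed ε G g z :=
  integral_congr_ae (h.mono fun y hy => by simp only [hy])

theorem measurable_windowed (hG : IsWindow G) (hf : AEStronglyMeasurable f) :
    Measurable (windowed ε G f) := by
  have h : windowed ε G f = windowed ε G (hf.mk f) :=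
    funext fun z => windowed_congr hf.ae_eq_mk z
  rw [h]
  have hm := hf.stronglyMeasurable_mk
  refine StronglyMeasurable.measurable ?_
  refine StronglyMeasurable.integral_prod_right (f := fun (z : Phase m) (y : Pos m) =>
    hf.mk f y * ((G (y - z.1) : ℂ) *
    Complex.exp (-(Complex.I / ε * ((inner ℝ z.2 (y - z.1) : ℝ) : ℂ))))) ?_
  refine StronglyMeasurable.mul (hm.comp_measurable measurable_snd) ?_
  refine Continuous.stronglyMeasurable ?_
  have hc := hG.continuous
  have hGm := hc.measurable
  fun_prop

theorem lintegral_window_translate (G : Pos m → ℝ) (q : Pos m) :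
    ∫⁻ y, ‖G (y - q)‖ₑ ^ 2 = eLpNorm G 2 ^ 2 := by
  rw [eLpNorm_two_sq, lintegral_sub_right_eq_self (fun y => ‖G y‖ₑ ^ 2) q]

theorem enorm_windowed_le (hG : IsWindow G) (hf : AEStronglyMeasurable f) (z : Phase m) :
    ‖windowed ε G f z‖ₑ ≤ eLpNorm G 2 * eLpNorm f 2 := by
  refine (enorm_integral_le_lintegral_enorm _).trans ?_
  have h : ∀ y, ‖f y * ((G (y - z.1) : ℂ) *
      Complex.exp (-(Complex.I / ε * ((inner ℝ z.2 (y - z.1) : ℝ) : ℂ))))‖ₑ =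
      ‖G (y - z.1)‖ₑ * ‖f y‖ₑ := fun y => by
    rw [← ofReal_norm, norm_mul, norm_mul, norm_exp_phase, mul_one, Complex.norm_real, mul_comm,
      ENNReal.ofReal_mul (norm_nonneg _), ofReal_norm, ofReal_norm]
  simp only [h]
  have hc := hG.continuous
  have hGm := hc.measurable
  refine lintegral_mul_le_sqrt ?_ hf.enorm (lintegral_window_translate G z.1).le
    (eLpNorm_two_sq f).ge
  exact Measurable.aemeasurable (by fun_prop)

/-- The windowed Fourier transform is, up to normalization, an isometry from `L²(ℝ^m)` to
`L²(ℝ^{2m})`: apply Plancherel's identity in `p` for fixed `q`, and integrate over `q`. -/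
theorem lintegral_windowed_sq (hε : 0 < ε) (hG : IsWindow G) (hf : MemLp f 2) :
    ∫⁻ z : Phase m, ‖windowed ε G f z‖ₑ ^ 2 =
      ENNReal.ofReal ((2 * Real.pi * ε) ^ m) * (eLpNorm G 2 ^ 2 * eLpNorm f 2 ^ 2) := by
  have hc := hG.continuous
  have hGm := hc.measurable
  obtain ⟨b, hb⟩ := hG.bounded
  have hmeas := measurable_windowed (ε := ε) hG hf.1
  set a : ℝ := 2 * Real.pi * ε with ha
  have ha0 : 0 < a := by positivity
  have hslice : ∀ q : Pos m, ∫⁻ p : Pos m, ‖windowed ε G f (q, p)‖ₑ ^ 2 =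
      ENNReal.ofReal (a ^ m) * ∫⁻ y, ‖f y‖ₑ ^ 2 * ‖G (y - q)‖ₑ ^ 2 := by
    intro q
    set w : Pos m → ℂ := fun y => f y * (G (y - q) : ℂ) with hw
    have hGq : MemLp (fun y => (G (y - q) : ℂ)) 2 := by
      have := hG.memLp.ofReal (K := ℂ)
      exact this.comp_measurePreserving (measurePreserving_sub_right volume q)
    have hw1 : Integrable w := hf.integrable_mul hGq
    have hw2 : MemLp w 2 := by
      refine hf.of_le_mul (c := b) hw1.1 (Filter.Eventually.of_forall fun y => ?_)
      rw [hw, norm_mul, Complex.norm_real, mul_comm]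
      gcongr
      exact hb _
    have hphase : ∀ p : Pos m, ‖windowed ε G f (q, p)‖ₑ = ‖𝓕 w (a⁻¹ • p)‖ₑ := by
      intro p
      have : windowed ε G f (q, p) =
          Complex.exp (-(Complex.I / ε * ((-inner ℝ p q : ℝ) : ℂ))) * 𝓕 w (a⁻¹ • p) := by
        rw [Real.fourier_eq', windowed, ← integral_const_mul]
        refine integral_congr_ae (Filter.Eventually.of_forall fun y => ?_)
        simp only [hw, smul_eq_mul]
        have hexp : Complex.exp (-(Complex.I / ε * ((inner ℝ p (y - q) : ℝ) : ℂ))) =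
            Complex.exp (-(Complex.I / ε * ((-inner ℝ p q : ℝ) : ℂ))) *
            Complex.exp ((↑(-2 * Real.pi * inner ℝ y (a⁻¹ • p)) * Complex.I)) := by
          rw [← Complex.exp_add]
          congr 1
          rw [inner_sub_right, real_inner_smul_right, real_inner_comm p y, ha]
          have h1 : (ε : ℂ) ≠ 0 := by exact_mod_cast hε.ne'
          have h2 : (Real.pi : ℂ) ≠ 0 := by exact_mod_cast Real.pi_ne_zero
          push_cast
          field_simp
          ring
        rw [hexp]
        ring
      rw [this, ← ofReal_norm, norm_mul, norm_exp_phase, one_mul, ofReal_norm]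
    simp only [hphase]
    have hFc : Continuous (𝓕 w) :=
      VectorFourier.fourierIntegral_continuous Real.continuous_fourierChar
        (L := innerₗ (Pos m)) continuous_inner hw1
    have hscale := Measure.map_addHaar_smul (volume : Measure (Pos m)) (inv_ne_zero ha0.ne')
    have h1 : ∫⁻ p : Pos m, ‖𝓕 w (a⁻¹ • p)‖ₑ ^ 2 =
        ∫⁻ ξ, ‖𝓕 w ξ‖ₑ ^ 2 ∂(Measure.map (a⁻¹ • ·) volume) := by
      rw [lintegral_map (hFc.measurable.enorm.pow_const 2) (by fun_prop)]
    rw [h1, hscale, lintegral_smul_measure, ← eLpNorm_two_sq, eLpNorm_fourier_eq hw1 hw2,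
      eLpNorm_two_sq]
    congr 1
    · rw [finrank_euclideanSpace_fin, inv_pow, inv_inv, abs_of_pos (by positivity)]
    · refine lintegral_congr fun y => ?_
      rw [hw, ← mul_pow, ← ofReal_norm, norm_mul, ENNReal.ofReal_mul (norm_nonneg _), ofReal_norm,
        Complex.norm_real, ofReal_norm]
  have hfm : AEMeasurable (fun y => ‖f y‖ₑ ^ 2) := hf.1.enorm.pow_const 2
  calc ∫⁻ z : Phase m, ‖windowed ε G f z‖ₑ ^ 2
      = ∫⁻ q : Pos m, ∫⁻ p : Pos m, ‖windowed ε G f (q, p)‖ₑ ^ 2 :=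
        lintegral_prod _ (hmeas.enorm.pow_const 2).aemeasurable
    _ = ∫⁻ q : Pos m, ENNReal.ofReal (a ^ m) * ∫⁻ y, ‖f y‖ₑ ^ 2 * ‖G (y - q)‖ₑ ^ 2 := by
        simp only [hslice]
    _ = ENNReal.ofReal (a ^ m) * ∫⁻ q : Pos m, ∫⁻ y, ‖f y‖ₑ ^ 2 * ‖G (y - q)‖ₑ ^ 2 :=
        lintegral_const_mul' _ _ ENNReal.ofReal_ne_top
    _ = ENNReal.ofReal (a ^ m) * ∫⁻ y : Pos m, ∫⁻ q, ‖f y‖ₑ ^ 2 * ‖G (y - q)‖ₑ ^ 2 := by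
        congr 1
        refine lintegral_lintegral_swap ?_
        have h2 : Measurable fun p : Pos m × Pos m => ‖G (p.2 - p.1)‖ₑ ^ 2 := by fun_prop
        exact hfm.comp_snd.mul h2.aemeasurable
    _ = ENNReal.ofReal (a ^ m) * ∫⁻ y : Pos m, ‖f y‖ₑ ^ 2 * eLpNorm G 2 ^ 2 := by
        congr 1
        refine lintegral_congr fun y => ?_
        rw [lintegral_const_mul _ (by fun_prop), eLpNorm_two_sq,
          lintegral_sub_left_eq_self (fun y => ‖G y‖ₑ ^ 2) y]
    _ = _ := by
        rw [lintegral_mul_const'' _ hfm, ← eLpNorm_two_sq, mul_comm (eLpNorm f 2 volume ^ 2)]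

end Window

end FGASH

/-! ### Gaussian windows and the bilinear estimate -/

namespace FGASH

section GaussWindow

variable {m : ℕ} {ε : ℝ}

/-- The Gaussian window `exp(-|y|²/(2ε))`. -/
noncomputable def gaussWin (ε : ℝ) (y : Pos m) : ℝ := Real.exp (-(‖y‖ ^ 2 / (2 * ε)))

/-- The first Hermite window `y_j exp(-|y|²/(2ε))`. -/
noncomputable def hermiteWin (ε : ℝ) (j : Fin m) (y : Pos m) : ℝ := y j * gaussWin ε y

theorem continuous_gaussWin : Continuous (gaussWin (m := m) ε) := by
  unfold gaussWin
  fun_prop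

theorem continuous_hermiteWin (j : Fin m) : Continuous (hermiteWin ε j) := by
  unfold hermiteWin
  have := continuous_gaussWin (m := m) (ε := ε)
  fun_prop

theorem gaussWin_pos (y : Pos m) : 0 < gaussWin ε y := Real.exp_pos _

theorem gaussWin_le_one (hε : 0 < ε) (y : Pos m) : gaussWin ε y ≤ 1 := by
  refine Real.exp_le_one_iff.2 ?_
  have : 0 ≤ ‖y‖ ^ 2 / (2 * ε) := by positivity
  linarith

theorem gaussWin_sq_le (hε : 0 < ε) (y : Pos m) : gaussWin ε y ^ 2 ≤ 1 * gaussWin ε y := by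
  rw [pow_two]
  exact mul_le_mul_of_nonneg_right (gaussWin_le_one hε y) (gaussWin_pos y).le

/-- Half of the Gaussian decay absorbs a quadratic weight. -/
theorem norm_mul_gaussWin_sq_le (hε : 0 < ε) (y : Pos m) :
    (‖y‖ * gaussWin ε y) ^ 2 ≤ ε * gaussWin ε y := by
  set x := ‖y‖ ^ 2 / (2 * ε) with hx
  have hx0 : 0 ≤ x := by positivity
  have hy : ‖y‖ ^ 2 = ε * (2 * x) := by rw [hx]; field_simp
  have h1 : 2 * x ≤ Real.exp x := by
    have := Real.quadratic_le_exp_of_nonneg hx0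
    nlinarith [sq_nonneg (x - 1)]
  have h2 : 2 * x * Real.exp (-x) ≤ 1 := by
    rw [Real.exp_neg, ← div_eq_mul_inv, div_le_one (Real.exp_pos _)]
    exact h1
  have h3 : gaussWin ε y = Real.exp (-x) := rfl
  rw [mul_pow, hy, h3]
  have h4 := mul_le_mul_of_nonneg_right h2 (Real.exp_pos (-x)).le
  nlinarith

theorem hermiteWin_sq_le (hε : 0 < ε) (j : Fin m) (y : Pos m) :
    hermiteWin ε j y ^ 2 ≤ ε * gaussWin ε y := by
  refine le_trans ?_ (norm_mul_gaussWin_sq_le hε y)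
  rw [hermiteWin, mul_pow, mul_pow]
  gcongr ?_ * _
  rw [← sq_abs (y j)]
  gcongr
  exact PiLp.norm_apply_le y j

theorem lintegral_gaussWin (hε : 0 < ε) :
    ∫⁻ y : Pos m, ENNReal.ofReal (gaussWin ε y) =
      ENNReal.ofReal ((2 * Real.pi * ε) ^ ((m : ℝ) / 2)) := by
  have h := GaussianFourier.integral_rexp_neg_mul_sq_norm (V := Pos m) (b := 1 / (2 * ε))
    (by positivity)
  have he : (fun y : Pos m => Real.exp (-(1 / (2 * ε)) * ‖y‖ ^ 2)) = gaussWin ε := by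
    funext y
    rw [gaussWin]
    ring_nf
  rw [he, finrank_euclideanSpace_fin, div_div_eq_mul_div, div_one, ← mul_assoc,
    mul_comm Real.pi 2] at h
  rw [← h, ofReal_integral_eq_lintegral_ofReal]
  · -- the integral does not vanish, so the integrand is integrable
    refine not_imp_comm.1 integral_undef ?_
    rw [h]
    positivity
  · exact Filter.Eventually.of_forall fun y => (gaussWin_pos y).le

theorem eLpNorm_le_of_sq_le {G : Pos m → ℝ} {b : ℝ} (hε : 0 < ε) (hb : 0 ≤ b)
    (h : ∀ y, G y ^ 2 ≤ b * gaussWin ε y) :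
    eLpNorm G 2 ≤ ENNReal.ofReal (√b * (2 * Real.pi * ε) ^ ((m : ℝ) / 4)) := by
  have h1 : eLpNorm G 2 ^ 2 ≤ ENNReal.ofReal (√b * (2 * Real.pi * ε) ^ ((m : ℝ) / 4)) ^ 2 := by
    rw [eLpNorm_two_sq]
    calc ∫⁻ y, ‖G y‖ₑ ^ 2 ≤ ∫⁻ y, ENNReal.ofReal b * ENNReal.ofReal (gaussWin ε y) := by
          refine lintegral_mono fun y => ?_
          rw [← ENNReal.ofReal_mul hb, ← ofReal_norm, ← ENNReal.ofReal_pow (norm_nonneg _),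
            Real.norm_eq_abs, sq_abs]
          exact ENNReal.ofReal_le_ofReal (h y)
      _ = ENNReal.ofReal b * ENNReal.ofReal ((2 * Real.pi * ε) ^ ((m : ℝ) / 2)) := by
          rw [lintegral_const_mul' _ _ ENNReal.ofReal_ne_top, lintegral_gaussWin hε]
      _ = _ := by
          rw [← ENNReal.ofReal_mul hb, ← ENNReal.ofReal_pow (by positivity), mul_pow,
            Real.sq_sqrt hb, ← Real.rpow_natCast, ← Real.rpow_mul (by positivity)]
          congr 3
          push_cast
          ring
  exact le_of_not_gt fun h2 => h1.not_gt (by gcongr)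

theorem isWindow_of_sq_le {G : Pos m → ℝ} {b : ℝ} (hε : 0 < ε) (hb : 0 ≤ b) (hG : Continuous G)
    (h : ∀ y, G y ^ 2 ≤ b * gaussWin ε y) : IsWindow G where
  continuous := hG
  bounded := ⟨√b, fun y => by
    refine Real.abs_le_sqrt ((h y).trans ?_)
    exact mul_le_of_le_one_right hb (gaussWin_le_one hε y)⟩
  memLp := ⟨hG.aestronglyMeasurable, (eLpNorm_le_of_sq_le hε hb h).trans_lt ENNReal.ofReal_lt_top⟩

theorem isWindow_gaussWin (hε : 0 < ε) : IsWindow (gaussWin (m := m) ε) :=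
  isWindow_of_sq_le hε zero_le_one continuous_gaussWin (gaussWin_sq_le hε)

theorem isWindow_hermiteWin (hε : 0 < ε) (j : Fin m) : IsWindow (hermiteWin ε j) :=
  isWindow_of_sq_le hε hε.le (continuous_hermiteWin j) (hermiteWin_sq_le hε j)

theorem eLpNorm_gaussWin_le (hε : 0 < ε) :
    eLpNorm (gaussWin (m := m) ε) 2 ≤ ENNReal.ofReal ((2 * Real.pi * ε) ^ ((m : ℝ) / 4)) := by
  simpa using eLpNorm_le_of_sq_le hε zero_le_one (gaussWin_sq_le (m := m) hε)

theorem eLpNorm_hermiteWin_le (hε : 0 < ε) (j : Fin m) :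
    eLpNorm (hermiteWin ε j) 2 ≤ ENNReal.ofReal (√ε * (2 * Real.pi * ε) ^ ((m : ℝ) / 4)) :=
  eLpNorm_le_of_sq_le hε hε.le (hermiteWin_sq_le hε j)

/-- The bilinear estimate behind the bound for the `n`-hop contribution. The first bound of the
minimum uses the `L²` isometry and is uniform for small `ε`; the second one uses the pointwise
bound and the finite volume of `K`, and is better for large `ε`. -/
theorem lintegral_windowed_mul_le {G G' : Pos m → ℝ} {u h : Pos m → ℂ} {K : Set (Phase m)}
    {κ : Phase m → Phase m} (hε : 0 < ε) (hG : IsWindow G) (hG' : IsWindow G') (hu : MemLp u 2)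
    (hh : MemLp h 2) (hκ : Measurable κ)
    (hκK : ∀ ψ : Phase m → ℝ≥0∞, Measurable ψ → ∫⁻ z in K, ψ (κ z) ≤ ∫⁻ z, ψ z) :
    ∫⁻ z in K, ‖windowed ε G u z‖ₑ * ‖windowed ε G' h (κ z)‖ₑ ≤
      min (ENNReal.ofReal ((2 * Real.pi * ε) ^ m)) (volume K) *
        (eLpNorm G 2 * eLpNorm G' 2) * (eLpNorm u 2 * eLpNorm h 2) := by
  rw [min_mul_of_nonneg _ _ zero_le, min_mul_of_nonneg _ _ zero_le]
  have hmu := measurable_windowed (ε := ε) hG hu.1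
  have hmh := measurable_windowed (ε := ε) hG' hh.1
  refine le_min ?_ ?_
  · set a := ENNReal.ofReal (√((2 * Real.pi * ε) ^ m)) with ha
    have ha2 : a ^ 2 = ENNReal.ofReal ((2 * Real.pi * ε) ^ m) := by
      rw [ha, ← ENNReal.ofReal_pow (Real.sqrt_nonneg _), Real.sq_sqrt (by positivity)]
    have h1 := lintegral_mul_le_sqrt (μ := volume.restrict K)
      (f := fun z => ‖windowed ε G u z‖ₑ) (g := fun z => ‖windowed ε G' h (κ z)‖ₑ)
      (a := a * (eLpNorm G 2 * eLpNorm u 2)) (b := a * (eLpNorm G' 2 * eLpNorm h 2))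
      hmu.enorm.aemeasurable (hmh.comp hκ).enorm.aemeasurable ?_ ?_
    · refine h1.trans (le_of_eq ?_)
      rw [← ha2]
      ring
    · refine (setLIntegral_le_lintegral _ _).trans ?_
      rw [lintegral_windowed_sq hε hG hu, ← ha2, ← mul_pow, ← mul_pow]
    · refine (hκK (fun z => ‖windowed ε G' h z‖ₑ ^ 2) (hmh.enorm.pow_const 2)).trans ?_
      rw [lintegral_windowed_sq hε hG' hh, ← ha2, ← mul_pow, ← mul_pow]
  · have hpt : ∀ z, ‖windowed ε G u z‖ₑ * ‖windowed ε G' h (κ z)‖ₑ ≤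
        (eLpNorm G 2 * eLpNorm u 2) * (eLpNorm G' 2 * eLpNorm h 2) := fun z =>
      mul_le_mul' (enorm_windowed_le hG hu.1 z) (enorm_windowed_le hG' hh.1 _)
    refine (lintegral_mono hpt).trans (le_of_eq ?_)
    rw [setLIntegral_const]
    ring

end GaussWindow

section Volume

open Set

variable {m : ℕ} {c : Coeffs m} {L : ℝ≥0}

/-- Hopping trajectories transport volume without increasing it: for fixed hopping times the map
from the initial to the final point is injective with Jacobian `±1`. -/
theorem lintegral_comp_traj_le (hc : ∀ k, GoodPotential (c.E k) L) (l : Fin 2) (n : ℕ)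
    (T : Fin n → ℝ) (t : ℝ) {K : Set (Phase m)} (hK : MeasurableSet K) (ψ : Phase m → ℝ≥0∞) :
    ∫⁻ z in K, ψ (traj c l n T t z) ≤ ∫⁻ z, ψ z := by
  have : (volume : Measure (Phase m)).IsAddHaarMeasure :=
    inferInstanceAs ((volume : Measure (Pos m)).prod volume).IsAddHaarMeasure
  have h := lintegral_image_eq_lintegral_abs_det_fderiv_mul volume hK
    (fun z _ => (hasFDerivAt_traj hc l n T t z).hasFDerivWithinAt)
    (injective_traj hc l n T t).injOn ψ
  simp only [(isSymp_fderiv_traj hc l n T t _).abs_det_eq_one, ENNReal.ofReal_one, one_mul] at h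
  rw [← h]
  exact setLIntegral_le_lintegral _ _

theorem isClosed_hopSimplex (n : ℕ) (t : ℝ) : IsClosed (hopSimplex n t) := by
  have h : hopSimplex n t = {T | Monotone T} ∩ Icc (fun _ => 0) (fun _ => t) := by
    ext T
    simp only [hopSimplex, mem_ofPred_eq, mem_inter_iff, mem_Icc, Pi.le_def, forall_and]
  rw [h]
  exact isClosed_monotone.inter isClosed_Icc

theorem isCompact_hopSimplex (n : ℕ) (t : ℝ) : IsCompact (hopSimplex n t) :=
  (isCompact_Icc (a := fun _ : Fin n => (0 : ℝ)) (b := fun _ => t)).of_isClosed_subset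
    (isClosed_hopSimplex n t) fun _ hT => ⟨fun i => (hT.2 i).1, fun i => (hT.2 i).2⟩

/-- The simplex of ordered hopping times has volume at most `tⁿ/n!`: slice it by the last time. -/
theorem volume_hopSimplex_le (n : ℕ) {t : ℝ} (ht : 0 ≤ t) :
    volume (hopSimplex n t) ≤ ENNReal.ofReal (t ^ n / n !) := by
  induction n generalizing t with
  | zero =>
    refine (measure_mono (subset_univ _)).trans ?_
    simp [volume_pi]
  | succ n ih =>
    set A : Set (ℝ × (Fin n → ℝ)) := {p | p.1 ∈ Icc 0 t ∧ p.2 ∈ hopSimplex n p.1} with hA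
    have hAc : IsClosed A := by
      have h : A = {p | p.1 ∈ Icc 0 t} ∩
          ({p | Monotone p.2} ∩ ⋂ i, ({p | 0 ≤ p.2 i} ∩ {p | p.2 i ≤ p.1})) := by
        ext p
        simp [hA, hopSimplex, forall_and]
      rw [h]
      refine (isClosed_Icc.preimage continuous_fst).inter
        ((isClosed_monotone.preimage continuous_snd).inter (isClosed_iInter fun i => ?_))
      exact (isClosed_le (by fun_prop) (by fun_prop)).inter
        (isClosed_le (by fun_prop) (by fun_prop))
    have hsub : hopSimplex (n + 1) t ⊆
        (MeasurableEquiv.piFinSuccAbove (fun _ => ℝ) (Fin.last n)) ⁻¹' A := by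
      intro T hT
      refine ⟨hT.2 (Fin.last n), ?_⟩
      have := init_mem_hopSimplex hT
      rwa [← Fin.removeNth_last] at this
    calc volume (hopSimplex (n + 1) t) ≤ volume A := by
          refine (measure_mono hsub).trans (le_of_eq ?_)
          exact (volume_preserving_piFinSuccAbove (fun _ : Fin (n + 1) => ℝ)
            (Fin.last n)).measure_preimage hAc.measurableSet.nullMeasurableSet
      _ = ∫⁻ s, volume (Prod.mk s ⁻¹' A) := Measure.prod_apply hAc.measurableSet
      _ ≤ ∫⁻ s, (Icc 0 t).indicator (fun s => ENNReal.ofReal (s ^ n / n !)) s := by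
          refine lintegral_mono fun s => ?_
          by_cases hs : s ∈ Icc 0 t
          · rw [indicator_of_mem hs]
            exact (measure_mono fun T hT => hT.2).trans (ih hs.1)
          · rw [indicator_of_notMem hs]
            refine le_of_eq (measure_mono_null (t := ∅) (fun T hT => hs hT.1) measure_empty)
      _ = ∫⁻ s in Icc 0 t, ENNReal.ofReal (s ^ n / n !) := lintegral_indicator measurableSet_Icc _
      _ = ENNReal.ofReal (∫ s in Icc 0 t, s ^ n / n !) := by
          rw [ofReal_integral_eq_lintegral_ofReal]
          · exact (Continuous.continuousOn (by fun_prop)).integrableOn_Icc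
          · exact (ae_restrict_iff' measurableSet_Icc).2
              (Filter.Eventually.of_forall fun s hs => by
                have := hs.1
                change 0 ≤ s ^ n / (n ! : ℝ)
                positivity)
      _ = ENNReal.ofReal (t ^ (n + 1) / (n + 1)!) := by
          rw [integral_Icc_eq_integral_Ioc, ← intervalIntegral.integral_of_le ht,
            intervalIntegral.integral_div, integral_pow, Nat.factorial_succ]
          congr 1
          push_cast
          field_simp
          simp

end Volume

end FGASH

/-! ### Superpositions of wave packets -/

namespace FGASH

section Superposition

open Set

variable {m : ℕ} {Y : Type*} [MeasureSpace Y] {ε : ℝ} {G : Pos m → ℝ} {u : Pos m → ℂ}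
  {K : Set (Phase m)} {S : Set Y} {a : Phase m × Y → ℂ} {κ : Phase m × Y → Phase m} {M : ℝ≥0}

/-- The wave packet with window `G` centred at `z = (q, p)`, i.e.
`G(x - q) exp((i/ε) p·(x - q))`. -/
noncomputable def packet (ε : ℝ) (G : Pos m → ℝ) (z : Phase m) (x : Pos m) : ℂ :=
  (G (x - z.1) : ℂ) * Complex.exp (Complex.I / ε * ((inner ℝ z.2 (x - z.1) : ℝ) : ℂ))

/-- The superposition of the wave packets at the points `κ(z, T)`, `(z, T) ∈ K × S`, with weights
`a(z, T)` times the Gaussian windowed Fourier transform of `u` at `z`. -/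
noncomputable def superpose (ε : ℝ) (G : Pos m → ℝ) (u : Pos m → ℂ) (K : Set (Phase m))
    (S : Set Y) (a : Phase m × Y → ℂ) (κ : Phase m × Y → Phase m) (x : Pos m) : ℂ :=
  ∫ w in K ×ˢ S, a w * windowed ε (gaussWin ε) u w.1 * packet ε G (κ w) x

/-- The assumptions on weights and centres: they are measurable, on sets of finite measure, the
weights are bounded by `M`, and for fixed `T` the map `z ↦ κ(z, T)` does not increase volume. -/
structure IsSuperposition (K : Set (Phase m)) (S : Set Y) (a : Phase m × Y → ℂ)
    (κ : Phase m × Y → Phase m) (M : ℝ≥0) : Prop where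
  measurable_weight : Measurable a
  measurable_center : Measurable κ
  measurableSet_fst : MeasurableSet K
  measurableSet_snd : MeasurableSet S
  volume_fst : volume K ≠ ⊤
  volume_snd : volume S ≠ ⊤
  bound : ∀ w ∈ K ×ˢ S, ‖a w‖ ≤ M
  transport : ∀ T ∈ S, ∀ ψ : Phase m → ℝ≥0∞, Measurable ψ →
    ∫⁻ z in K, ψ (κ (z, T)) ≤ ∫⁻ z, ψ z

theorem star_packet (z : Phase m) (x : Pos m) :
    (starRingEnd ℂ) (packet ε G z x) =
      (G (x - z.1) : ℂ) * Complex.exp (-(Complex.I / ε * ((inner ℝ z.2 (x - z.1) : ℝ) : ℂ))) := by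
  rw [packet, map_mul, Complex.conj_ofReal, ← Complex.exp_conj, map_mul, map_div₀, Complex.conj_I,
    Complex.conj_ofReal, Complex.conj_ofReal, neg_div, neg_mul]

theorem norm_packet (z : Phase m) (x : Pos m) : ‖packet ε G z x‖ = |G (x - z.1)| := by
  rw [← RCLike.norm_conj (packet ε G z x), star_packet, norm_mul, norm_exp_phase, mul_one,
    Complex.norm_real, Real.norm_eq_abs]

theorem continuous_packet (hG : Continuous G) :
    Continuous fun p : Phase m × Pos m => packet ε G p.1 p.2 := by
  unfold packet
  fun_prop

/-- The weights including the windowed transform are bounded. -/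
theorem IsSuperposition.norm_weight_le (h : IsSuperposition K S a κ M) (hε : 0 < ε)
    (hu : MemLp u 2) {w : Phase m × Y} (hw : w ∈ K ×ˢ S) :
    ‖a w * windowed ε (gaussWin ε) u w.1‖ ≤
      M * (eLpNorm (gaussWin (m := m) ε) 2 * eLpNorm u 2).toReal := by
  rw [norm_mul]
  refine mul_le_mul (h.bound w hw) ?_ (norm_nonneg _) M.2
  have h1 := enorm_windowed_le (ε := ε) (isWindow_gaussWin hε) hu.1 w.1
  have h2 := ENNReal.toReal_mono
    (ENNReal.mul_ne_top (isWindow_gaussWin (m := m) hε).memLp.2.ne hu.2.ne) h1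
  rwa [toReal_enorm] at h2

theorem IsSuperposition.measurable_weight_mul (h : IsSuperposition K S a κ M) (hε : 0 < ε)
    (hu : MemLp u 2) : Measurable fun w : Phase m × Y => a w * windowed ε (gaussWin ε) u w.1 :=
  h.measurable_weight.mul ((measurable_windowed (isWindow_gaussWin hε) hu.1).comp measurable_fst)

theorem IsSuperposition.measurableSet_prod (h : IsSuperposition K S a κ M) :
    MeasurableSet (K ×ˢ S) := h.measurableSet_fst.prod h.measurableSet_snd

theorem IsSuperposition.measurable_packet (h : IsSuperposition K S a κ M) (hG : Continuous G) :
    Measurable fun p : Pos m × (Phase m × Y) => packet ε G (κ p.2) p.1 :=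
  (continuous_packet hG).measurable.comp
    ((h.measurable_center.comp measurable_snd).prodMk measurable_fst)

variable [SFinite (volume : Measure Y)]

theorem IsSuperposition.volume_ne_top (h : IsSuperposition K S a κ M) :
    volume (K ×ˢ S) ≠ ⊤ := by
  rw [Measure.volume_eq_prod, Measure.prod_prod]
  exact ENNReal.mul_ne_top h.volume_fst h.volume_snd

theorem IsSuperposition.integrableOn_weight (h : IsSuperposition K S a κ M) (hε : 0 < ε)
    (hu : MemLp u 2) :
    IntegrableOn (fun w : Phase m × Y => a w * windowed ε (gaussWin ε) u w.1) (K ×ˢ S) :=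
  Measure.integrableOn_of_bounded h.volume_ne_top
    (h.measurable_weight_mul hε hu).aestronglyMeasurable
    ((ae_restrict_iff' h.measurableSet_prod).2
      (Filter.Eventually.of_forall fun _ hw => h.norm_weight_le hε hu hw))

theorem IsSuperposition.integrableOn (h : IsSuperposition K S a κ M) (hε : 0 < ε)
    (hu : MemLp u 2) (hG : IsWindow G) (x : Pos m) :
    IntegrableOn (fun w : Phase m × Y =>
      a w * windowed ε (gaussWin ε) u w.1 * packet ε G (κ w) x) (K ×ˢ S) := by
  obtain ⟨b, hb⟩ := hG.bounded
  refine (h.integrableOn_weight hε hu).mul_bdd (c := b) ?_ ?_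
  · exact ((h.measurable_packet hG.continuous).comp measurable_prodMk_left).aestronglyMeasurable
  · exact Filter.Eventually.of_forall fun w => by rw [norm_packet]; exact hb _

theorem IsSuperposition.aestronglyMeasurable_superpose (h : IsSuperposition K S a κ M)
    (hε : 0 < ε) (hu : MemLp u 2) (hG : IsWindow G) :
    AEStronglyMeasurable (superpose ε G u K S a κ) := by
  refine Measurable.aestronglyMeasurable ?_
  refine StronglyMeasurable.measurable ?_
  refine StronglyMeasurable.integral_prod_right (ν := volume.restrict (K ×ˢ S))
    (f := fun (x : Pos m) (w : Phase m × Y) =>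
      a w * windowed ε (gaussWin ε) u w.1 * packet ε G (κ w) x) ?_
  refine Measurable.stronglyMeasurable ?_
  exact ((h.measurable_weight_mul hε hu).comp measurable_snd).mul
    (h.measurable_packet hG.continuous)

theorem IsSuperposition.exists_bound (h : IsSuperposition K S a κ M) (hε : 0 < ε)
    (hu : MemLp u 2) (hG : IsWindow G) : ∃ b, ∀ x, ‖superpose ε G u K S a κ x‖ ≤ b := by
  obtain ⟨b, hb⟩ := hG.bounded
  refine ⟨M * (eLpNorm (gaussWin (m := m) ε) 2 * eLpNorm u 2).toReal * b * volume.real (K ×ˢ S),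
    fun x => ?_⟩
  refine norm_setIntegral_le_of_norm_le_const h.volume_ne_top.lt_top fun w hw => ?_
  rw [norm_mul, norm_packet]
  exact mul_le_mul (h.norm_weight_le hε hu hw) (hb _) (abs_nonneg _) (by positivity)

/-- The constant in the `L²` bound for superpositions of wave packets with window `G`. -/
noncomputable def superposeBound (ε : ℝ) (G : Pos m → ℝ) (K : Set (Phase m)) : ℝ≥0∞ :=
  min (ENNReal.ofReal ((2 * Real.pi * ε) ^ m)) (volume K) *
    (eLpNorm (gaussWin (m := m) ε) 2 * eLpNorm G 2)

/-- The `L²` pairing of a superposition with a test function reduces to an integral over phase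
space, to which the bilinear estimate applies. -/
theorem IsSuperposition.enorm_pairing_le (h : IsSuperposition K S a κ M) (hε : 0 < ε)
    (hu : MemLp u 2) (hG : IsWindow G) {f : Pos m → ℂ} (hf1 : Integrable f) (hf2 : MemLp f 2) :
    ‖∫ x, superpose ε G u K S a κ x * (starRingEnd ℂ) (f x)‖ₑ ≤
      M * volume S * superposeBound ε G K * eLpNorm u 2 * eLpNorm f 2 := by
  obtain ⟨b, hb⟩ := hG.bounded
  have hW := h.integrableOn_weight hε hu
  have hfub : ∫ x, superpose ε G u K S a κ x * (starRingEnd ℂ) (f x) =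
      ∫ w in K ×ˢ S, a w * windowed ε (gaussWin ε) u w.1 *
        (starRingEnd ℂ) (windowed ε G f (κ w)) := by
    have hint : Integrable (Function.uncurry fun (x : Pos m) (w : Phase m × Y) =>
        a w * windowed ε (gaussWin ε) u w.1 * packet ε G (κ w) x * (starRingEnd ℂ) (f x))
        (volume.prod (volume.restrict (K ×ˢ S))) := by
      have hfc : Integrable (fun x => (starRingEnd ℂ) (f x)) :=
        (Complex.conjCLE : ℂ →L[ℝ] ℂ).integrable_comp hf1
      have h1 := (hfc.mul_prod hW).mul_bdd (c := b)
        (g := fun p : Pos m × (Phase m × Y) => packet ε G (κ p.2) p.1)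
        (h.measurable_packet hG.continuous).aestronglyMeasurable
        (Filter.Eventually.of_forall fun w => by rw [norm_packet]; exact hb _)
      refine h1.congr (Filter.Eventually.of_forall fun p => ?_)
      simp only [Function.uncurry]
      ring
    calc ∫ x, superpose ε G u K S a κ x * (starRingEnd ℂ) (f x)
        = ∫ x, ∫ w in K ×ˢ S, a w * windowed ε (gaussWin ε) u w.1 * packet ε G (κ w) x *
            (starRingEnd ℂ) (f x) := by
          refine integral_congr_ae (Filter.Eventually.of_forall fun x => ?_)
          exact (integral_mul_const _ _).symm
      _ = ∫ w in K ×ˢ S, ∫ x, a w * windowed ε (gaussWin ε) u w.1 * packet ε G (κ w) x *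
            (starRingEnd ℂ) (f x) := integral_integral_swap hint
      _ = _ := by
          refine integral_congr_ae (Filter.Eventually.of_forall fun w => ?_)
          simp only [windowed.eq_def ε G f]
          rw [← integral_conj, ← integral_const_mul (a w * windowed ε (gaussWin ε) u w.1)]
          refine integral_congr_ae (Filter.Eventually.of_forall fun x => ?_)
          simp only
          rw [map_mul, ← star_packet, Complex.conj_conj]
          ring
  rw [hfub]
  have hmu := (measurable_windowed (ε := ε) (isWindow_gaussWin hε) hu.1).enorm
  have hmf := (measurable_windowed (ε := ε) hG hf2.1).enorm
  calc _ ≤ ∫⁻ w in K ×ˢ S, ‖a w * windowed ε (gaussWin ε) u w.1 *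
        (starRingEnd ℂ) (windowed ε G f (κ w))‖ₑ := enorm_integral_le_lintegral_enorm _
    _ ≤ ∫⁻ w in K ×ˢ S, M * (‖windowed ε (gaussWin ε) u w.1‖ₑ * ‖windowed ε G f (κ w)‖ₑ) := by
        refine setLIntegral_mono' h.measurableSet_prod fun w hw => ?_
        rw [enorm_mul, enorm_mul, RCLike.enorm_conj, mul_assoc]
        gcongr
        rw [← ofReal_norm, ← ENNReal.ofReal_coe_nnreal]
        exact ENNReal.ofReal_le_ofReal (h.bound w hw)
    _ = M * ∫⁻ w in K ×ˢ S, ‖windowed ε (gaussWin ε) u w.1‖ₑ * ‖windowed ε G f (κ w)‖ₑ :=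
        lintegral_const_mul' _ _ ENNReal.coe_ne_top
    _ = M * ∫⁻ T in S, ∫⁻ z in K, ‖windowed ε (gaussWin ε) u z‖ₑ *
          ‖windowed ε G f (κ (z, T))‖ₑ := by
        rw [Measure.volume_eq_prod, ← Measure.prod_restrict, lintegral_prod_symm]
        exact ((hmu.comp measurable_fst).mul (hmf.comp h.measurable_center)).aemeasurable
    _ ≤ M * ∫⁻ _ in S, superposeBound ε G K * (eLpNorm u 2 * eLpNorm f 2) := by
        refine mul_le_mul' le_rfl (setLIntegral_mono' h.measurableSet_snd fun T hT => ?_)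
        exact lintegral_windowed_mul_le hε (isWindow_gaussWin hε) hG hu hf2
          (h.measurable_center.comp measurable_prodMk_right) (h.transport T hT)
    _ = _ := by
        rw [setLIntegral_const]
        ring

/-- The `L²` bound for superpositions. The pairing estimate is applied to the restrictions of the
superposition itself to balls, which are square integrable, and the radius tends to infinity. -/
theorem IsSuperposition.eLpNorm_superpose_le (h : IsSuperposition K S a κ M) (hε : 0 < ε)
    (hu : MemLp u 2) (hG : IsWindow G) :
    eLpNorm (superpose ε G u K S a κ) 2 ≤ M * volume S * superposeBound ε G K * eLpNorm u 2 := by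
  set v := superpose ε G u K S a κ with hv
  set Q := M * volume S * superposeBound ε G K * eLpNorm u 2 with hQ
  obtain ⟨b, hb⟩ := h.exists_bound hε hu hG
  have hvm : AEStronglyMeasurable v := h.aestronglyMeasurable_superpose hε hu hG
  have hball : ∀ r : ℝ, eLpNorm ((Metric.closedBall (0 : Pos m) r).indicator v) 2 ≤ Q := by
    intro r
    set Br := Metric.closedBall (0 : Pos m) r with hBr
    have hBm : MeasurableSet Br := Metric.isClosed_closedBall.measurableSet
    have hBfin : volume Br ≠ ⊤ := (isCompact_closedBall _ _).measure_lt_top.ne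
    have : IsFiniteMeasure (volume.restrict Br) := ⟨by
      rw [Measure.restrict_apply_univ]; exact hBfin.lt_top⟩
    have hmem : ∀ p : ℝ≥0∞, MemLp (Br.indicator v) p := fun p => by
      rw [memLp_indicator_iff_restrict hBm]
      exact MemLp.of_bound hvm.restrict b (Filter.Eventually.of_forall hb)
    have hpair := h.enorm_pairing_le hε hu hG (memLp_one_iff_integrable.1 (hmem 1)) (hmem 2)
    have hsq : ‖∫ x, v x * (starRingEnd ℂ) (Br.indicator v x)‖ₑ =
        eLpNorm (Br.indicator v) 2 ^ 2 := by
      have h1 : ∀ x, v x * (starRingEnd ℂ) (Br.indicator v x) =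
          ((‖Br.indicator v x‖ ^ 2 : ℝ) : ℂ) := by
        intro x
        by_cases hx : x ∈ Br
        · rw [indicator_of_mem hx, Complex.mul_conj, Complex.normSq_eq_norm_sq]
        · simp [indicator_of_notMem hx]
      simp only [h1]
      rw [integral_complex_ofReal, ← ofReal_norm, Complex.norm_real,
        Real.norm_of_nonneg (integral_nonneg fun _ => by positivity),
        ofReal_integral_eq_lintegral_ofReal ((hmem 2).integrable_norm_pow two_ne_zero)
          (Filter.Eventually.of_forall fun _ => by positivity), eLpNorm_two_sq]
      refine lintegral_congr fun x => ?_
      rw [ENNReal.ofReal_pow (norm_nonneg _), ofReal_norm]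
    rw [← hv, hsq, ← hQ, pow_two] at hpair
    rcases eq_or_ne (eLpNorm (Br.indicator v) 2) 0 with h0 | h0
    · rw [h0]; exact zero_le
    · exact (ENNReal.mul_le_mul_iff_left h0 (hmem 2).2.ne).1 hpair
  have hlim := (aecover_closedBall (μ := (volume : Measure (Pos m))) (x := 0)
    tendsto_natCast_atTop_atTop).lintegral_tendsto_of_countably_generated
    (f := fun x => ‖v x‖ₑ ^ 2) (hvm.enorm.pow_const 2)
  have hle : ∫⁻ x, ‖v x‖ₑ ^ 2 ≤ Q ^ 2 := by
    refine le_of_tendsto hlim (Filter.Eventually.of_forall fun N => ?_)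
    have h1 := hball (N : ℝ)
    have hBm : MeasurableSet (Metric.closedBall (0 : Pos m) (N : ℝ)) :=
      Metric.isClosed_closedBall.measurableSet
    rw [eLpNorm_indicator_eq_eLpNorm_restrict hBm] at h1
    rw [← eLpNorm_two_sq]
    gcongr
  rw [← eLpNorm_two_sq] at hle
  exact le_of_not_gt fun h2 => hle.not_gt (by gcongr)

theorem superposeBound_ne_top (hG : IsWindow G) (hε : 0 < ε) : superposeBound ε G K ≠ ⊤ :=
  ENNReal.mul_ne_top ((min_le_left _ _).trans_lt ENNReal.ofReal_lt_top).ne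
    (ENNReal.mul_ne_top (isWindow_gaussWin hε).memLp.2.ne hG.memLp.2.ne)

theorem IsSuperposition.memLp_superpose (h : IsSuperposition K S a κ M) (hε : 0 < ε)
    (hu : MemLp u 2) (hG : IsWindow G) : MemLp (superpose ε G u K S a κ) 2 :=
  ⟨h.aestronglyMeasurable_superpose hε hu hG, (h.eLpNorm_superpose_le hε hu hG).trans_lt
    (ENNReal.mul_lt_top (ENNReal.mul_lt_top (ENNReal.mul_lt_top ENNReal.coe_lt_top
      h.volume_snd.lt_top) (superposeBound_ne_top hG hε).lt_top) hu.2)⟩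

end Superposition

end FGASH

/-! ### The gradient of a superposition of Gaussian wave packets -/

namespace FGASH

section Gradient

open Set

variable {m : ℕ} {Y : Type*} [MeasureSpace Y] {ε : ℝ} {u : Pos m → ℂ}
  {K : Set (Phase m)} {S : Set Y} {a : Phase m × Y → ℂ} {κ : Phase m × Y → Phase m} {M P : ℝ≥0}

/-- The derivative of the Gaussian wave packet centred at `z = (q, p)`: the packet times
`(i p - (x - q)) / ε`. -/
noncomputable def packetDeriv (ε : ℝ) (z : Phase m) (x : Pos m) : Pos m →L[ℝ] ℂ :=
  packet ε (gaussWin ε) z x • ((Complex.I / ε) • Complex.ofRealCLM.comp (innerSL ℝ z.2)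
    - (1 / ε : ℂ) • Complex.ofRealCLM.comp (innerSL ℝ (x - z.1)))

theorem packetDeriv_apply (z : Phase m) (x v : Pos m) :
    packetDeriv ε z x v = packet ε (gaussWin ε) z x *
      (Complex.I / ε * ((inner ℝ z.2 v : ℝ) : ℂ) - 1 / ε * ((inner ℝ (x - z.1) v : ℝ) : ℂ)) := rfl

theorem hasFDerivAt_packet (z : Phase m) (x : Pos m) :
    HasFDerivAt (packet ε (gaussWin ε) z) (packetDeriv ε z x) x := by
  have hsub : HasFDerivAt (fun x : Pos m => x - z.1) (ContinuousLinearMap.id ℝ (Pos m)) x :=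
    (hasFDerivAt_id x).sub_const z.1
  have h1 : HasFDerivAt (fun x : Pos m => ((gaussWin ε (x - z.1) : ℝ) : ℂ)) _ x :=
    Complex.ofRealCLM.hasFDerivAt.comp x ((hsub.norm_sq.mul_const (2 * ε)⁻¹).neg.exp)
  have h2 : HasFDerivAt
      (fun x : Pos m => Complex.exp (Complex.I / ε * ((inner ℝ z.2 (x - z.1) : ℝ) : ℂ))) _ x :=
    ((Complex.ofRealCLM.hasFDerivAt.comp x
      ((innerSL ℝ z.2).hasFDerivAt.comp x hsub)).const_mul (Complex.I / ε)).cexp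
  refine (h1.mul h2).congr_fderiv ?_
  ext v
  rw [packetDeriv_apply, packet]
  simp [gaussWin, inner_sub_left]
  ring_nf

theorem continuous_packetDeriv (x : Pos m) : Continuous fun z : Phase m => packetDeriv ε z x := by
  have h0 := continuous_packet (m := m) (ε := ε) (continuous_gaussWin (ε := ε))
  have h : Continuous fun z : Phase m => packet ε (gaussWin ε) z x :=
    Continuous.comp (f := fun z : Phase m => (z, x)) h0 (by fun_prop)
  unfold packetDeriv
  fun_prop

theorem norm_packetDeriv_le (hε : 0 < ε) (z : Phase m) (x : Pos m) (hz : ‖z.2‖ ≤ P) :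
    ‖packetDeriv ε z x‖ ≤ (P + √ε) / ε := by
  refine ContinuousLinearMap.opNorm_le_bound _ (by positivity) fun v => ?_
  set y := x - z.1 with hy
  have hg : ‖y‖ * gaussWin ε y ≤ √ε := by
    refine Real.le_sqrt_of_sq_le ((norm_mul_gaussWin_sq_le hε y).trans ?_)
    exact mul_le_of_le_one_right hε.le (gaussWin_le_one hε y)
  have h1 : ‖(Complex.I / ε * ((inner ℝ z.2 v : ℝ) : ℂ) - 1 / ε * ((inner ℝ y v : ℝ) : ℂ))‖ ≤
      (P + ‖y‖) / ε * ‖v‖ := by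
    refine (norm_sub_le _ _).trans ?_
    rw [norm_mul, norm_mul, norm_div, norm_div, Complex.norm_I, norm_one, Complex.norm_real,
      Complex.norm_real, Complex.norm_real, Real.norm_of_nonneg hε.le]
    have h2 : ‖(inner ℝ z.2 v : ℝ)‖ ≤ P * ‖v‖ := (norm_inner_le_norm _ _).trans (by gcongr)
    have h3 : ‖(inner ℝ y v : ℝ)‖ ≤ ‖y‖ * ‖v‖ := norm_inner_le_norm _ _
    calc _ ≤ 1 / ε * (P * ‖v‖) + 1 / ε * (‖y‖ * ‖v‖) := by gcongr
      _ = _ := by ring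
  rw [packetDeriv_apply, norm_mul, norm_packet, abs_of_pos (gaussWin_pos _)]
  calc gaussWin ε y * _ ≤ gaussWin ε y * ((P + ‖y‖) / ε * ‖v‖) :=
        mul_le_mul_of_nonneg_left h1 (gaussWin_pos _).le
    _ = (gaussWin ε y * P + ‖y‖ * gaussWin ε y) / ε * ‖v‖ := by ring
    _ ≤ (1 * P + √ε) / ε * ‖v‖ := by
        gcongr
        exact gaussWin_le_one hε y
    _ = _ := by rw [one_mul]

/-- Multiplying the weights by a component of the momenta. -/
theorem IsSuperposition.momentum_mul (h : IsSuperposition K S a κ M)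
    (hP : ∀ w ∈ K ×ˢ S, ‖(κ w).2‖ ≤ P) (j : Fin m) :
    IsSuperposition K S (fun w => (((κ w).2 j : ℝ) : ℂ) * a w) κ (P * M) where
  measurable_weight := by
    have h1 : Continuous fun z : Phase m => ((z.2 j : ℝ) : ℂ) := by fun_prop
    exact (h1.measurable.comp h.measurable_center).mul h.measurable_weight
  measurable_center := h.measurable_center
  measurableSet_fst := h.measurableSet_fst
  measurableSet_snd := h.measurableSet_snd
  volume_fst := h.volume_fst
  volume_snd := h.volume_snd
  bound := fun w hw => by
    rw [norm_mul, Complex.norm_real, NNReal.coe_mul]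
    exact mul_le_mul ((PiLp.norm_apply_le _ j).trans (hP w hw)) (h.bound w hw) (norm_nonneg _) P.2
  transport := h.transport

variable [SFinite (volume : Measure Y)]

theorem IsSuperposition.integrableOn_packetDeriv (h : IsSuperposition K S a κ M) (hε : 0 < ε)
    (hu : MemLp u 2) (hP : ∀ w ∈ K ×ˢ S, ‖(κ w).2‖ ≤ P) (x : Pos m) :
    IntegrableOn (fun w : Phase m × Y =>
      (a w * windowed ε (gaussWin ε) u w.1) • packetDeriv ε (κ w) x) (K ×ˢ S) := by
  refine (h.integrableOn_weight hε hu).smul_bdd (C := (P + √ε) / ε) ?_ ?_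
  · exact ((continuous_packetDeriv x).comp_stronglyMeasurable
      h.measurable_center.stronglyMeasurable).aestronglyMeasurable
  · exact (ae_restrict_iff' h.measurableSet_prod).2
      (Filter.Eventually.of_forall fun w hw => norm_packetDeriv_le hε _ _ (hP w hw))

/-- A superposition of Gaussian packets with bounded momenta can be differentiated under the
integral sign. -/
theorem IsSuperposition.hasFDerivAt_superpose (h : IsSuperposition K S a κ M) (hε : 0 < ε)
    (hu : MemLp u 2) (hP : ∀ w ∈ K ×ˢ S, ‖(κ w).2‖ ≤ P) (x : Pos m) :
    HasFDerivAt (superpose ε (gaussWin ε) u K S a κ)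
      (∫ w in K ×ˢ S, (a w * windowed ε (gaussWin ε) u w.1) • packetDeriv ε (κ w) x) x := by
  have hG := isWindow_gaussWin (m := m) hε
  refine hasFDerivAt_integral_of_dominated_of_fderiv_le (s := univ)
    (F' := fun x w => (a w * windowed ε (gaussWin ε) u w.1) • packetDeriv ε (κ w) x)
    (bound := fun w => ‖a w * windowed ε (gaussWin ε) u w.1‖ * ((P + √ε) / ε))
    Filter.univ_mem (Filter.Eventually.of_forall fun y => (h.integrableOn hε hu hG y).1)
    (h.integrableOn hε hu hG x) (h.integrableOn_packetDeriv hε hu hP x).1 ?_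
    ((h.integrableOn_weight hε hu).norm.mul_const _) ?_
  · refine (ae_restrict_iff' h.measurableSet_prod).2
      (Filter.Eventually.of_forall fun w hw y _ => ?_)
    rw [norm_smul]
    exact mul_le_mul_of_nonneg_left (norm_packetDeriv_le hε _ _ (hP w hw)) (norm_nonneg _)
  · exact Filter.Eventually.of_forall fun w y _ => (hasFDerivAt_packet (κ w) y).const_mul _

/-- The partial derivatives of a superposition of Gaussian packets are again superpositions of
packets, with the momenta as additional weights or with a Hermite window. -/
theorem IsSuperposition.fderiv_superpose (h : IsSuperposition K S a κ M) (hε : 0 < ε)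
    (hu : MemLp u 2) (hP : ∀ w ∈ K ×ˢ S, ‖(κ w).2‖ ≤ P) (j : Fin m) (x : Pos m) :
    (ε : ℂ) * fderiv ℝ (superpose ε (gaussWin ε) u K S a κ) x (basisVec j) =
      Complex.I * superpose ε (gaussWin ε) u K S (fun w => (((κ w).2 j : ℝ) : ℂ) * a w) κ x
        - superpose ε (hermiteWin ε j) u K S a κ x := by
  rw [(h.hasFDerivAt_superpose hε hu hP x).fderiv,
    ContinuousLinearMap.integral_apply (h.integrableOn_packetDeriv hε hu hP x),
    superpose, superpose, ← integral_const_mul, ← integral_const_mul, ← integral_sub]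
  · refine integral_congr_ae (Filter.Eventually.of_forall fun w => ?_)
    have hε' : (ε : ℂ) ≠ 0 := by exact_mod_cast hε.ne'
    simp only [smul_apply, packetDeriv_apply, smul_eq_mul, packet, hermiteWin,
      basisVec, EuclideanSpace.inner_single_right]
    simp
    field_simp
  · exact ((h.momentum_mul hP j).integrableOn hε hu (isWindow_gaussWin hε) x).const_mul _
  · exact h.integrableOn hε hu (isWindow_hermiteWin hε j) x

theorem IsSuperposition.memLp_fderiv (h : IsSuperposition K S a κ M) (hε : 0 < ε)
    (hu : MemLp u 2) (hP : ∀ w ∈ K ×ˢ S, ‖(κ w).2‖ ≤ P) (j : Fin m) :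
    MemLp (fun x => (ε : ℂ) * fderiv ℝ (superpose ε (gaussWin ε) u K S a κ) x (basisVec j)) 2 := by
  simp only [h.fderiv_superpose hε hu hP j]
  exact (((h.momentum_mul hP j).memLp_superpose hε hu (isWindow_gaussWin hε)).const_mul _).sub
    (h.memLp_superpose hε hu (isWindow_hermiteWin hε j))

theorem IsSuperposition.eLpNorm_fderiv_le (h : IsSuperposition K S a κ M) (hε : 0 < ε)
    (hu : MemLp u 2) (hP : ∀ w ∈ K ×ˢ S, ‖(κ w).2‖ ≤ P) (j : Fin m) :
    eLpNorm (fun x => (ε : ℂ) * fderiv ℝ (superpose ε (gaussWin ε) u K S a κ) x (basisVec j)) 2 ≤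
      M * volume S * (P * superposeBound ε (gaussWin (m := m) ε) K
        + superposeBound ε (hermiteWin ε j) K) * eLpNorm u 2 := by
  simp only [h.fderiv_superpose hε hu hP j]
  have h1 := h.momentum_mul hP j
  refine (eLpNorm_sub_le
    ((h1.memLp_superpose hε hu (isWindow_gaussWin hε)).const_mul Complex.I).1
    (h.memLp_superpose hε hu (isWindow_hermiteWin hε j)).1 (by norm_num)).trans ?_
  have h2 := h1.eLpNorm_superpose_le hε hu (isWindow_gaussWin hε)
  have h3 := h.eLpNorm_superpose_le hε hu (isWindow_hermiteWin hε j)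
  have h4 := eLpNorm_const_smul Complex.I (superpose ε (gaussWin ε) u K S
    (fun w => (((κ w).2 j : ℝ) : ℂ) * a w) κ) 2 volume
  rw [← ofReal_norm, Complex.norm_I, ENNReal.ofReal_one, one_mul] at h4
  refine (add_le_add (h4.le.trans h2) h3).trans (le_of_eq ?_)
  push_cast
  ring

end Gradient

section Constants

variable {m : ℕ} {ε : ℝ} {K : Set (Phase m)}

/-- The normalization `(2πε)^{-3m/2}` of the ansatz. -/
noncomputable def ansatzScale (m : ℕ) (ε : ℝ) : ℝ := 1 / (2 * Real.pi * ε) ^ (3 * (m : ℝ) / 2)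

theorem ansatzScale_mul (hε : 0 < ε) :
    ansatzScale m ε * ((2 * Real.pi * ε) ^ m *
      ((2 * Real.pi * ε) ^ ((m : ℝ) / 4) * (2 * Real.pi * ε) ^ ((m : ℝ) / 4))) = 1 := by
  have hA : 0 < 2 * Real.pi * ε := by positivity
  rw [ansatzScale, ← Real.rpow_natCast, ← Real.rpow_add hA, ← Real.rpow_add hA,
    show (m : ℝ) + (m / 4 + m / 4) = 3 * m / 2 by ring]
  exact one_div_mul_cancel (Real.rpow_pos_of_pos hA _).ne'

theorem ansatzScale_mul_superposeBound_gaussWin_le (hε : 0 < ε) :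
    ENNReal.ofReal (ansatzScale m ε) * superposeBound ε (gaussWin (m := m) ε) K ≤ 1 := by
  have hA : 0 < 2 * Real.pi * ε := by positivity
  have hs : 0 ≤ ansatzScale m ε := by unfold ansatzScale; positivity
  calc _ ≤ ENNReal.ofReal (ansatzScale m ε) * (ENNReal.ofReal ((2 * Real.pi * ε) ^ m) *
        (ENNReal.ofReal ((2 * Real.pi * ε) ^ ((m : ℝ) / 4)) *
          ENNReal.ofReal ((2 * Real.pi * ε) ^ ((m : ℝ) / 4)))) := by
        unfold superposeBound
        gcongr
        · exact min_le_left _ _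
        · exact eLpNorm_gaussWin_le hε
        · exact eLpNorm_gaussWin_le hε
    _ = 1 := by
        rw [← ENNReal.ofReal_mul (by positivity), ← ENNReal.ofReal_mul (by positivity),
          ← ENNReal.ofReal_mul hs, ansatzScale_mul hε, ENNReal.ofReal_one]

/-- The bound for the Hermite window is uniform in `ε`: it is of order `√ε` for small `ε`; for
`ε ≥ 1` the finite volume of `K` gives the order `√ε (2πε)^{-m}`. -/
theorem ansatzScale_mul_superposeBound_hermiteWin_le (hε : 0 < ε) (j : Fin m) :
    ENNReal.ofReal (ansatzScale m ε) * superposeBound ε (hermiteWin ε j) K ≤ 1 + volume K := by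
  have hA : 0 < 2 * Real.pi * ε := by positivity
  have hs : 0 ≤ ansatzScale m ε := by unfold ansatzScale; positivity
  set A := 2 * Real.pi * ε with hAdef
  have key : ∀ V : ℝ≥0∞, min (ENNReal.ofReal (A ^ m)) (volume K) ≤ V →
      ENNReal.ofReal (ansatzScale m ε) * superposeBound ε (hermiteWin ε j) K ≤
        V * ENNReal.ofReal (ansatzScale m ε * (A ^ ((m : ℝ) / 4) * A ^ ((m : ℝ) / 4)) * √ε) := by
    intro V hV
    calc _ ≤ ENNReal.ofReal (ansatzScale m ε) * (V *
          (ENNReal.ofReal (A ^ ((m : ℝ) / 4)) * ENNReal.ofReal (√ε * A ^ ((m : ℝ) / 4)))) := by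
          unfold superposeBound
          gcongr
          · exact eLpNorm_gaussWin_le hε
          · exact eLpNorm_hermiteWin_le hε j
      _ = V * ENNReal.ofReal
          (ansatzScale m ε * (A ^ ((m : ℝ) / 4) * (√ε * A ^ ((m : ℝ) / 4)))) := by
          rw [← ENNReal.ofReal_mul (by positivity), ENNReal.ofReal_mul hs]
          ring
      _ = _ := by
          congr 2
          ring
  have hscale := ansatzScale_mul (m := m) hε
  rw [← hAdef] at hscale
  rcases le_total ε 1 with h1 | h1
  · refine (key _ (min_le_left _ _)).trans (le_trans ?_ le_self_add)
    rw [← ENNReal.ofReal_mul (by positivity),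
      show A ^ m * (ansatzScale m ε * (A ^ ((m : ℝ) / 4) * A ^ ((m : ℝ) / 4)) * √ε) =
        ansatzScale m ε * (A ^ m * (A ^ ((m : ℝ) / 4) * A ^ ((m : ℝ) / 4))) * √ε by ring, hscale,
      one_mul, ENNReal.ofReal_le_one]
    exact Real.sqrt_le_one.2 h1
  · refine (key _ (min_le_right _ _)).trans (le_trans ?_ le_add_self)
    refine mul_le_of_le_one_right' ?_
    rw [ENNReal.ofReal_le_one]
    have hA1 : ε ≤ A := by
      have := Real.pi_gt_three
      rw [hAdef]
      nlinarith
    have hsq : √ε ≤ A ^ m := by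
      calc √ε ≤ ε := Real.sqrt_le_self_iff.2 (.inr h1)
        _ ≤ A := hA1
        _ ≤ A ^ m := le_self_pow₀ (h1.trans hA1) (Fin.pos j).ne'
    calc _ ≤ ansatzScale m ε * (A ^ ((m : ℝ) / 4) * A ^ ((m : ℝ) / 4)) * A ^ m := by gcongr
      _ = 1 := by rw [← hscale]; ring

end Constants

end FGASH

/-! ### The hop contributions as superpositions -/

namespace FGASH

section HopTerm

open Set

variable {m : ℕ} {c : Coeffs m} {L B R : ℝ≥0} {K : Set (Phase m)} {t ε : ℝ} {u : Pos m → ℂ}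

/-- The end points of the trajectories, as a function of initial points and hopping times. -/
noncomputable def hopCenter (c : Coeffs m) (l : Fin 2) (n : ℕ) (t : ℝ)
    (w : Phase m × (Fin n → ℝ)) : Phase m :=
  traj c l n w.2 t w.1

/-- The weights of the wave packets in the `n`-hop contribution. -/
noncomputable def hopWeight (c : Coeffs m) (l : Fin 2) (n : ℕ) (t ε : ℝ)
    (w : Phase m × (Fin n → ℝ)) : ℂ :=
  hopProd c l n w.2 w.1 * amp c l n w.2 t w.1 *
    Complex.exp (Complex.I / ε * ((action c l n w.2 t w.1 : ℝ) : ℂ))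

theorem exp_gauss_eq (y : Pos m) :
    Complex.exp (Complex.I / ε * (Complex.I / 2 * ((‖y‖ ^ 2 : ℝ) : ℂ))) =
      ((gaussWin ε y : ℝ) : ℂ) := by
  rw [gaussWin, Complex.ofReal_exp]
  congr 1
  have : Complex.I / ε * (Complex.I / 2 * ((‖y‖ ^ 2 : ℝ) : ℂ)) =
      (Complex.I * Complex.I) * (((‖y‖ ^ 2 : ℝ) : ℂ) / (2 * ε)) := by
    ring
  rw [this, Complex.I_mul_I]
  push_cast
  ring

theorem overlap_eq_windowed (z : Phase m) : overlap ε u z = windowed ε (gaussWin ε) u z := by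
  refine integral_congr_ae (Filter.Eventually.of_forall fun y => ?_)
  simp only
  rw [mul_add, Complex.exp_add, exp_gauss_eq, mul_neg, mul_comm (Complex.exp _)]

theorem integrand_eq (l : Fin 2) (n : ℕ) (x : Pos m) (w : Phase m × (Fin n → ℝ)) :
    integrand c l ε u n t x w.1 w.2 = hopWeight c l n t ε w * windowed ε (gaussWin ε) u w.1 *
      packet ε (gaussWin ε) (hopCenter c l n t w) x := by
  simp only [integrand, theta, hopWeight, hopCenter, packet, overlap_eq_windowed]
  rw [mul_add, Complex.exp_add, exp_gauss_eq, Complex.ofReal_add, mul_add, Complex.exp_add]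
  ring

/-- The bound for the initial amplitude and its growth up to time `t`. -/
noncomputable def ampConst (m : ℕ) (t : ℝ) (L B R : ℝ≥0) : ℝ≥0 :=
  Real.toNNReal (2 ^ ((m : ℝ) / 2) * Real.exp (ampBound m t L B R * t))

/-- The base `C_t` of the bound for the `n`-hop contribution. -/
noncomputable def rateConst (m : ℕ) (t : ℝ) (B R : ℝ≥0) : ℝ≥0 :=
  Real.toNNReal (hopBound m t B R) * t.toNNReal

theorem hopBound_nonneg (ht : 0 ≤ t) : 0 ≤ hopBound m t B R := by
  unfold hopBound
  positivity

theorem Controlled.isSuperposition (hc : Controlled c K t L B R) (hK : IsCompact K) (ht : 0 ≤ t)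
    (l : Fin 2) (n : ℕ) (ε : ℝ) :
    IsSuperposition K (hopSimplex n t) (hopWeight c l n t ε) (hopCenter c l n t)
      (Real.toNNReal (hopBound m t B R) ^ n * ampConst m t L B R) where
  measurable_weight := by
    have h1 := continuous_hopProd hc.good hc.continuous_d l n
    have h2 := continuous_amp hc.good hc.continuous_d l n
    have h3 := continuous_action hc.good l n
    have g1 : Continuous fun w : Phase m × (Fin n → ℝ) => hopProd c l n w.2 w.1 :=
      Continuous.comp (f := fun w : Phase m × (Fin n → ℝ) => (w.2, w.1)) h1 (by fun_prop)
    have g2 : Continuous fun w : Phase m × (Fin n → ℝ) => amp c l n w.2 t w.1 :=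
      Continuous.comp (f := fun w : Phase m × (Fin n → ℝ) => (w.2, t, w.1)) h2 (by fun_prop)
    have g3 : Continuous fun w : Phase m × (Fin n → ℝ) => action c l n w.2 t w.1 :=
      Continuous.comp (f := fun w : Phase m × (Fin n → ℝ) => (w.2, t, w.1)) h3 (by fun_prop)
    have g : Continuous (hopWeight c l n t ε) := by
      unfold hopWeight
      fun_prop
    exact g.measurable
  measurable_center := by
    have h1 := continuous_traj hc.good l n
    have g1 : Continuous (hopCenter c l n t) :=
      Continuous.comp (f := fun w : Phase m × (Fin n → ℝ) => (w.2, t, w.1)) h1 (by fun_prop)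
    exact g1.measurable
  measurableSet_fst := hK.measurableSet
  measurableSet_snd := (isClosed_hopSimplex n t).measurableSet
  volume_fst := hK.measure_lt_top.ne
  volume_snd := (isCompact_hopSimplex n t).measure_lt_top.ne
  bound := fun w hw => by
    have h := norm_exp_phase ε (-(action c l n w.2 t w.1))
    rw [Complex.ofReal_neg, mul_neg, neg_neg] at h
    rw [hopWeight, norm_mul, norm_mul, h, mul_one, NNReal.coe_mul, NNReal.coe_pow,
      Real.coe_toNNReal _ (hopBound_nonneg ht), ampConst, Real.coe_toNNReal _ (by positivity)]
    exact mul_le_mul (hc.norm_hopProd_le l n hw.2 hw.1)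
      (hc.norm_amp_le l n w.2 ht le_rfl hw.2 hw.1) (norm_nonneg _)
      (pow_nonneg (hopBound_nonneg ht) n)
  transport := fun T _ ψ _ => lintegral_comp_traj_le hc.good l n T t hK.measurableSet ψ

theorem Controlled.norm_hopCenter_le (hc : Controlled c K t L B R) (ht : 0 ≤ t) (l : Fin 2)
    (n : ℕ) : ∀ w ∈ K ×ˢ hopSimplex n t,
      ‖(hopCenter c l n t w).2‖ ≤ (R + B * t.toNNReal : ℝ≥0) := by
  intro w hw
  have h := hc.norm_momentum_le l n w.2 ht le_rfl hw.2 hw.1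
  rwa [NNReal.coe_add, NNReal.coe_mul, Real.coe_toNNReal _ ht]

theorem Controlled.hopTerm_eq (hc : Controlled c K t L B R) (hK : IsCompact K) (ht : 0 ≤ t)
    (hε : 0 < ε) (hu : MemLp u 2) (l : Fin 2) (n : ℕ) :
    hopTerm c l ε K u n t = fun x => ((ansatzScale m ε : ℝ) : ℂ) *
      superpose ε (gaussWin ε) u K (hopSimplex n t) (hopWeight c l n t ε)
        (hopCenter c l n t) x := by
  funext x
  have h := (hc.isSuperposition hK ht l n ε).integrableOn hε hu (isWindow_gaussWin hε) x
  have h2 := setIntegral_prod _ h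
  simp only [hopTerm, superpose, ansatzScale]
  refine congrArg _ (Eq.trans ?_ h2.symm)
  have e : ∀ z T, integrand c l ε u n t x z T = _ := fun z T => integrand_eq l n x (z, T)
  simp only [e]

/-- The volume `tⁿ/n!` of the simplex of hopping times is the source of the factorial. -/
theorem weightBound_mul_volume_le (n : ℕ) (ht : 0 ≤ t) (A : ℝ≥0) :
    ((Real.toNNReal (hopBound m t B R) ^ n * A : ℝ≥0) : ℝ≥0∞) * volume (hopSimplex n t) ≤
      ((A * rateConst m t B R ^ n / (n ! : ℝ≥0) : ℝ≥0) : ℝ≥0∞) := by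
  have h : ENNReal.ofReal (t ^ n / n !) = ((t.toNNReal ^ n / (n ! : ℝ≥0) : ℝ≥0) : ℝ≥0∞) := by
    rw [ENNReal.ofReal, Real.toNNReal_div (by positivity), Real.toNNReal_pow ht,
      Real.toNNReal_natCast]
  refine (mul_le_mul' le_rfl (volume_hopSimplex_le n ht)).trans (le_of_eq ?_)
  rw [h, ← ENNReal.coe_mul, rateConst]
  congr 1
  rw [mul_pow]
  ring

/-- Functions with values in a Euclidean space are square integrable if their components are. -/
theorem memLp_toLp {ι α : Type*} [Fintype ι] [MeasurableSpace α] {μ : Measure α}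
    {F : ι → α → ℂ} (hF : ∀ j, MemLp (F j) 2 μ) :
    MemLp (fun x => WithLp.toLp 2 fun j => F j x) 2 μ ∧
      eLpNorm (fun x => (WithLp.toLp 2 fun j => F j x : EuclideanSpace ℂ ι)) 2 μ ≤
        ∑ j, eLpNorm (F j) 2 μ := by
  classical
  have hsum : (fun x => (WithLp.toLp 2 fun j => F j x : EuclideanSpace ℂ ι)) =
      ∑ j, fun x => EuclideanSpace.single j (F j x) := by
    funext x
    ext i
    simp [Finset.sum_apply, Pi.single_apply]
  have hnorm : ∀ j x, ‖(EuclideanSpace.single j (F j x) : EuclideanSpace ℂ ι)‖ = ‖F j x‖ :=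
    fun j x => by simp
  have hmeas : ∀ j, AEStronglyMeasurable
      (fun x => (EuclideanSpace.single j (F j x) : EuclideanSpace ℂ ι)) μ := fun j => by
    have hcont : Continuous fun a : ℂ => (EuclideanSpace.single j a : EuclideanSpace ℂ ι) :=
      (isometry_iff_dist_eq.2 fun a b => by simp).continuous
    exact hcont.comp_aestronglyMeasurable (hF j).1
  have heq : ∀ j, eLpNorm (fun x => (EuclideanSpace.single j (F j x) : EuclideanSpace ℂ ι)) 2 μ =
      eLpNorm (F j) 2 μ := fun j =>
    eLpNorm_congr_norm_ae (Filter.Eventually.of_forall (hnorm j))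
  have hmem : ∀ j, MemLp (fun x => (EuclideanSpace.single j (F j x) : EuclideanSpace ℂ ι)) 2 μ :=
    fun j => ⟨hmeas j, (heq j).trans_lt (hF j).2⟩
  rw [hsum]
  refine ⟨memLp_finsetSum' _ fun j _ => hmem j, ?_⟩
  refine (eLpNorm_sum_le (fun j _ => hmeas j) (by norm_num)).trans (le_of_eq ?_)
  exact Finset.sum_congr rfl fun j _ => heq j

theorem eLpNorm_ofReal_mul {a : ℝ} (ha : 0 ≤ a) (f : Pos m → ℂ) :
    eLpNorm (fun x => (a : ℂ) * f x) 2 = ENNReal.ofReal a * eLpNorm f 2 := by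
  have h := eLpNorm_const_smul (a : ℂ) f 2 volume
  rw [← ofReal_norm, Complex.norm_real, Real.norm_of_nonneg ha] at h
  exact h

theorem ansatzScale_nonneg (hε : 0 < ε) : 0 ≤ ansatzScale m ε := by
  unfold ansatzScale
  positivity

theorem Controlled.memLp_hopTerm (hc : Controlled c K t L B R) (hK : IsCompact K) (ht : 0 ≤ t)
    (hε : 0 < ε) (hu : MemLp u 2) (l : Fin 2) (n : ℕ) : MemLp (hopTerm c l ε K u n t) 2 := by
  rw [hc.hopTerm_eq hK ht hε hu]
  exact ((hc.isSuperposition hK ht l n ε).memLp_superpose hε hu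
    (isWindow_gaussWin hε)).const_mul _

theorem Controlled.eLpNorm_hopTerm_le (hc : Controlled c K t L B R) (hK : IsCompact K)
    (ht : 0 ≤ t) (hε : 0 < ε) (hu : MemLp u 2) (l : Fin 2) (n : ℕ) :
    eLpNorm (hopTerm c l ε K u n t) 2 ≤
      ((ampConst m t L B R * rateConst m t B R ^ n / (n ! : ℝ≥0) : ℝ≥0) : ℝ≥0∞) *
        eLpNorm u 2 := by
  have h := (hc.isSuperposition hK ht l n ε).eLpNorm_superpose_le hε hu (isWindow_gaussWin hε)
  rw [hc.hopTerm_eq hK ht hε hu, eLpNorm_ofReal_mul (ansatzScale_nonneg hε)]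
  refine (mul_le_mul' le_rfl h).trans ?_
  set M := Real.toNNReal (hopBound m t B R) ^ n * ampConst m t L B R
  calc _ = (M * volume (hopSimplex n t)) * (ENNReal.ofReal (ansatzScale m ε) *
        superposeBound ε (gaussWin (m := m) ε) K) * eLpNorm u 2 := by ring
    _ ≤ ((ampConst m t L B R * rateConst m t B R ^ n / (n ! : ℝ≥0) : ℝ≥0) : ℝ≥0∞) * 1 *
        eLpNorm u 2 := by
        gcongr
        · exact weightBound_mul_volume_le n ht _
        · exact ansatzScale_mul_superposeBound_gaussWin_le hε
    _ = _ := by rw [mul_one]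

theorem Controlled.differentiable_superpose (hc : Controlled c K t L B R) (hK : IsCompact K)
    (ht : 0 ≤ t) (hε : 0 < ε) (hu : MemLp u 2) (l : Fin 2) (n : ℕ) :
    Differentiable ℝ (superpose ε (gaussWin ε) u K (hopSimplex n t) (hopWeight c l n t ε)
      (hopCenter c l n t)) := fun x =>
  ((hc.isSuperposition hK ht l n ε).hasFDerivAt_superpose hε hu
    (hc.norm_hopCenter_le ht l n) x).differentiableAt

theorem Controlled.smul_cgrad_hopTerm (hc : Controlled c K t L B R) (hK : IsCompact K)
    (ht : 0 ≤ t) (hε : 0 < ε) (hu : MemLp u 2) (l : Fin 2) (n : ℕ) (x : Pos m) :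
    ε • cgrad (hopTerm c l ε K u n t) x = WithLp.toLp 2 fun j => ((ansatzScale m ε : ℝ) : ℂ) *
      ((ε : ℂ) * fderiv ℝ (superpose ε (gaussWin ε) u K (hopSimplex n t) (hopWeight c l n t ε)
        (hopCenter c l n t)) x (basisVec j)) := by
  have hd := hc.differentiable_superpose hK ht hε hu l n x
  ext j
  rw [hc.hopTerm_eq hK ht hε hu, cgrad, fderiv_const_mul hd]
  simp
  ring

theorem Controlled.memLp_cgrad_hopTerm (hc : Controlled c K t L B R) (hK : IsCompact K)
    (ht : 0 ≤ t) (hε : 0 < ε) (hu : MemLp u 2) (l : Fin 2) (n : ℕ) :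
    MemLp (fun x => ε • cgrad (hopTerm c l ε K u n t) x) 2 := by
  simp only [hc.smul_cgrad_hopTerm hK ht hε hu l n]
  exact (memLp_toLp fun j => ((hc.isSuperposition hK ht l n ε).memLp_fderiv hε hu
    (hc.norm_hopCenter_le ht l n) j).const_mul _).1

theorem Controlled.eLpNorm_cgrad_hopTerm_le (hc : Controlled c K t L B R) (hK : IsCompact K)
    (ht : 0 ≤ t) (hε : 0 < ε) (hu : MemLp u 2) (l : Fin 2) (n : ℕ) :
    eLpNorm (fun x => ε • cgrad (hopTerm c l ε K u n t) x) 2 ≤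
      ((ampConst m t L B R * rateConst m t B R ^ n / (n ! : ℝ≥0) : ℝ≥0) : ℝ≥0∞) *
        (m * ((R + B * t.toNNReal : ℝ≥0) + (1 + volume K))) * eLpNorm u 2 := by
  simp only [hc.smul_cgrad_hopTerm hK ht hε hu l n]
  have hsup := hc.isSuperposition hK ht l n ε
  have hP := hc.norm_hopCenter_le ht l n
  refine (memLp_toLp fun j => (hsup.memLp_fderiv hε hu hP j).const_mul _).2.trans ?_
  set M := Real.toNNReal (hopBound m t B R) ^ n * ampConst m t L B R
  set P := R + B * t.toNNReal
  set D : ℝ≥0∞ := ((ampConst m t L B R * rateConst m t B R ^ n / (n ! : ℝ≥0) : ℝ≥0) : ℝ≥0∞)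
  have hj : ∀ j ∈ (Finset.univ : Finset (Fin m)), eLpNorm (fun x => ((ansatzScale m ε : ℝ) : ℂ) *
      ((ε : ℂ) * fderiv ℝ (superpose ε (gaussWin ε) u K (hopSimplex n t) (hopWeight c l n t ε)
        (hopCenter c l n t)) x (basisVec j))) 2 ≤ D * (P + (1 + volume K)) * eLpNorm u 2 := by
    intro j _
    rw [eLpNorm_ofReal_mul (ansatzScale_nonneg hε)]
    refine (mul_le_mul' le_rfl (hsup.eLpNorm_fderiv_le hε hu hP j)).trans ?_
    calc _ = (M * volume (hopSimplex n t)) * (P * (ENNReal.ofReal (ansatzScale m ε) *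
          superposeBound ε (gaussWin (m := m) ε) K) + ENNReal.ofReal (ansatzScale m ε) *
            superposeBound ε (hermiteWin ε j) K) * eLpNorm u 2 := by ring
      _ ≤ D * (P * 1 + (1 + volume K)) * eLpNorm u 2 := by
          gcongr
          · exact weightBound_mul_volume_le n ht _
          · exact ansatzScale_mul_superposeBound_gaussWin_le hε
          · exact ansatzScale_mul_superposeBound_hermiteWin_le hε j
      _ = _ := by rw [mul_one]
  refine (Finset.sum_le_sum hj).trans (le_of_eq ?_)
  rw [Finset.sum_const, Finset.card_univ, Fintype.card_fin, nsmul_eq_mul]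
  ring

theorem Controlled.eLpNorm_ansatzTerm_le_sum (hc : Controlled c K t L B R) (hK : IsCompact K)
    (ht : 0 ≤ t) (hε : 0 < ε) {u₀ : Fin 2 → Pos m → ℂ} (hu : ∀ l, MemLp (u₀ l) 2) (n : ℕ) :
    eLpNorm (ansatzTerm c ε K u₀ n t) 2 ≤
      ∑ j, eLpNorm (hopTerm c (surf j n) ε K (u₀ (surf j n)) n t) 2 := by
  have hmem : ∀ j : Fin 2, MemLp (hopTerm c (surf j n) ε K (u₀ (surf j n)) n t) 2 := fun j =>
    hc.memLp_hopTerm hK ht hε (hu (surf j n)) (surf j n) n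
  exact (memLp_toLp hmem).2

/-- Both components of a term are bounded by the sum of the norms of the two initial data. -/
theorem Controlled.eLpNorm_ansatzTerm_le (hc : Controlled c K t L B R) (hK : IsCompact K)
    (ht : 0 ≤ t) (hε : 0 < ε) {u₀ : Fin 2 → Pos m → ℂ} (hu : ∀ l, MemLp (u₀ l) 2) (n : ℕ) :
    eLpNorm (ansatzTerm c ε K u₀ n t) 2 ≤
      ((ampConst m t L B R * rateConst m t B R ^ n / (n ! : ℝ≥0) : ℝ≥0) : ℝ≥0∞) *
        (2 * (eLpNorm (u₀ 0) 2 + eLpNorm (u₀ 1) 2)) := by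
  have h1 : ∀ k, eLpNorm (u₀ k) 2 ≤ eLpNorm (u₀ 0) 2 + eLpNorm (u₀ 1) 2 := fun k => by
    fin_cases k
    · exact le_self_add
    · exact le_add_self
  have hj : ∀ j, eLpNorm (hopTerm c (surf j n) ε K (u₀ (surf j n)) n t) 2 ≤
      ((ampConst m t L B R * rateConst m t B R ^ n / (n ! : ℝ≥0) : ℝ≥0) : ℝ≥0∞) *
        (eLpNorm (u₀ 0) 2 + eLpNorm (u₀ 1) 2) := fun j =>
    (hc.eLpNorm_hopTerm_le hK ht hε (hu (surf j n)) (surf j n) n).trans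
      (mul_le_mul' le_rfl (h1 (surf j n)))
  refine (hc.eLpNorm_ansatzTerm_le_sum hK ht hε hu n).trans
    ((Finset.sum_le_sum fun j _ => hj j).trans (le_of_eq ?_))
  rw [Fin.sum_univ_two]
  ring

theorem tsum_pow_div_factorial_ne_top (A r : ℝ≥0) :
    ∑' n : ℕ, ((A * r ^ n / (n ! : ℝ≥0) : ℝ≥0) : ℝ≥0∞) ≠ ⊤ := by
  rw [ENNReal.tsum_coe_ne_top_iff_summable, ← NNReal.summable_coe]
  refine ((Real.summable_pow_div_factorial (r : ℝ)).mul_left (A : ℝ)).congr fun n => ?_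
  push_cast
  ring

theorem Controlled.tsum_ansatzTerm_lt_top (hc : Controlled c K t L B R) (hK : IsCompact K)
    (ht : 0 ≤ t) (hε : 0 < ε) {u₀ : Fin 2 → Pos m → ℂ} (hu : ∀ l, MemLp (u₀ l) 2) :
    ∑' n : ℕ, eLpNorm (ansatzTerm c ε K u₀ n t) 2 < ⊤ := by
  refine (ENNReal.tsum_le_tsum fun n => hc.eLpNorm_ansatzTerm_le hK ht hε hu n).trans_lt ?_
  rw [ENNReal.tsum_mul_right]
  refine ENNReal.mul_lt_top (tsum_pow_div_factorial_ne_top _ _).lt_top ?_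
  exact ENNReal.mul_lt_top (by norm_num) (ENNReal.add_lt_top.2 ⟨(hu 0).2, (hu 1).2⟩)

end HopTerm

section Uniform

variable {m : ℕ} {c : ℝ → Coeffs m} {K : Set (Phase m)} {t : ℝ}

/-- The assumptions on the family `δ ↦ c δ` give bounds that do not depend on `δ`. -/
theorem exists_controlled (hK : IsCompact K) (hA : Subquadratic c) (hB : UniformlyBounded c K t) :
    ∃ L B R : ℝ≥0, ∀ δ > 0, Controlled (c δ) K t L B R := by
  obtain ⟨C_E, hCE⟩ := hA.bound
  obtain ⟨B₀, hB₀⟩ := hB.bound 0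
  obtain ⟨B₁, hB₁⟩ := hB.bound 1
  obtain ⟨R, hR⟩ := (hK.image continuous_snd).isBounded.exists_norm_le
  refine ⟨C_E.toNNReal, (max B₀ B₁).toNNReal, R.toNNReal, fun δ hδ => ?_⟩
  refine ⟨fun k => ⟨hA.smooth δ hδ k, fun q => (hCE δ hδ k q).trans (Real.le_coe_toNNReal _)⟩,
    fun k l => (hB.smooth_d δ hδ k l).continuous, fun w hw k => ?_, fun w hw k l => ?_,
    fun z hz => (hR _ ⟨z, hz, rfl⟩).trans (Real.le_coe_toNNReal _)⟩
  · have h := (hB₁ δ hδ w hw k k).1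
    rw [norm_iteratedFDeriv_one] at h
    rw [gradient, LinearIsometryEquiv.norm_map]
    exact h.trans ((le_max_right _ _).trans (Real.le_coe_toNNReal _))
  · have h := (hB₀ δ hδ w hw k l).2.1
    rw [norm_iteratedFDeriv_zero] at h
    exact h.trans ((le_max_left _ _).trans (Real.le_coe_toNNReal _))

end Uniform

end FGASH

theorem theorem6 (m : ℕ) (c : ℝ → FGASH.Coeffs m) (K : Set (FGASH.Phase m)) (hK : IsCompact K)
    (t : ℝ) (ht : 0 ≤ t) (hA : FGASH.Subquadratic c) (hB : FGASH.UniformlyBounded c K t) :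
    ∃ C Ct : ℝ≥0, ∀ ε : ℝ, 0 < ε → ∀ δ : ℝ, 0 < δ →
      (∀ (l : Fin 2) (u₀ : FGASH.Pos m → ℂ), MemLp u₀ 2 volume → ∀ n : ℕ,
        (∀ x : FGASH.Pos m,
          IntegrableOn
            (fun w : FGASH.Phase m × (Fin n → ℝ) =>
              FGASH.integrand (c δ) l ε u₀ n t x w.1 w.2)
            (K ×ˢ FGASH.hopSimplex n t) volume) ∧
        MemLp (FGASH.hopTerm (c δ) l ε K u₀ n t) 2 volume ∧
        eLpNorm (FGASH.hopTerm (c δ) l ε K u₀ n t) 2 volume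
          ≤ ((C * Ct ^ n / (n ! : ℝ≥0) : ℝ≥0) : ℝ≥0∞) * eLpNorm u₀ 2 volume ∧
        Differentiable ℝ (FGASH.hopTerm (c δ) l ε K u₀ n t) ∧
        MemLp (fun x => ε • FGASH.cgrad (FGASH.hopTerm (c δ) l ε K u₀ n t) x) 2 volume ∧
        eLpNorm (fun x => ε • FGASH.cgrad (FGASH.hopTerm (c δ) l ε K u₀ n t) x) 2 volume
          ≤ ((C * Ct ^ n / (n ! : ℝ≥0) : ℝ≥0) : ℝ≥0∞) * eLpNorm u₀ 2 volume) ∧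
      (∀ u₀ : Fin 2 → FGASH.Pos m → ℂ, (∀ l, MemLp (u₀ l) 2 volume) →
        (∑' n : ℕ, eLpNorm (FGASH.ansatzTerm (c δ) ε K u₀ n t) 2 volume) < ⊤) := by
  obtain ⟨L, B, R, hc⟩ := FGASH.exists_controlled hK hA hB
  set A := FGASH.ampConst m t L B R with hAdef
  set r := FGASH.rateConst m t B R with hr
  set V : ℝ≥0 := m * ((R + B * t.toNNReal) + (1 + (volume K).toNNReal)) with hV
  have hVE : (V : ℝ≥0∞) = m * ((R + B * t.toNNReal : ℝ≥0) + (1 + volume K)) := by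
    rw [hV, ← ENNReal.coe_toNNReal hK.measure_lt_top.ne]
    push_cast
    simp
  refine ⟨A * (1 + V), r, fun ε hε δ hδ => ⟨fun l u₀ hu n => ⟨fun x => ?_, ?_, ?_, ?_, ?_, ?_⟩,
    fun u₀ hu => (hc δ hδ).tsum_ansatzTerm_lt_top hK ht hε hu⟩⟩
  · simp only [FGASH.integrand_eq]
    exact ((hc δ hδ).isSuperposition hK ht l n ε).integrableOn hε hu
      (FGASH.isWindow_gaussWin hε) x
  · exact (hc δ hδ).memLp_hopTerm hK ht hε hu l n
  · refine ((hc δ hδ).eLpNorm_hopTerm_le hK ht hε hu l n).trans ?_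
    rw [← hAdef, ← hr]
    gcongr
    exact le_mul_of_one_le_right' le_self_add
  · rw [(hc δ hδ).hopTerm_eq hK ht hε hu l n]
    exact ((hc δ hδ).differentiable_superpose hK ht hε hu l n).const_mul _
  · exact (hc δ hδ).memLp_cgrad_hopTerm hK ht hε hu l n
  · refine ((hc δ hδ).eLpNorm_cgrad_hopTerm_le hK ht hε hu l n).trans ?_
    rw [← hAdef, ← hr, ← hVE, ← ENNReal.coe_mul]
    gcongr
    calc A * r ^ n / (n ! : ℝ≥0) * V = A * V * r ^ n / (n ! : ℝ≥0) := by ring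
      _ ≤ A * (1 + V) * r ^ n / (n ! : ℝ≥0) := by
        gcongr
        exact le_add_self
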